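/- Let $q$ be an odd prime power, $G=SL_2(\mathbb F_q)$, and let $\psi\colon\mathbb F_q\to\mathbb C^\times$ be a non-trivial additive character. Representations are complex, "irrep" means irreducible representation, and $\widehat H$ denotes the set of isomorphism classes of irreps of a finite group $H$. *Tensor rank.* An irrep of $G$ lies in $F^k$ ($k\ge 0$) if it occurs in an $\ell$-fold tensor product, $\ell\le k$, of the four irreps of $G$ of dimensions $\frac{q\pm1}{2}$ (the $0$-fold product is the trivial representation; for $q=3$ the four irreps are, among those of dimensions $1,2$, the ones that occur in the oscillator representations of $SL_2(\mathbb F_3)$). It has tensor rank $k$ if it lies in $F^k$ but not in $F^{j}$ for $j<k$. Let $\widehat G_k\subset\widehat G$ be the set of irreps of tensor rank $k$. *Oscillator representation.* Let $k\in\{0,1,2\}$, let $\beta$ be a non-degenerate symmetric bilinear form on $U=\mathbb F_q^k$, and let $O_\beta$ be its isometry group. Let $V=\mathbb F_q^2$ with basis $e_0,e_1$ and symplectic form $\langle v,v'\rangle=v_0v_1'-v_1v_0'$, so that $W=U\otimes V$ is a symplectic space with the form $\beta\otimes\langle\,,\rangle$, on which $O_\beta$ and $G$ act by commuting symplectic automorphisms.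 Let $H=W\times\mathbb F_q$ be the Heisenberg group, $(w,z)(w',z')=(w+w',z+z'+\frac12\langle w,w'\rangle)$, and let $\pi$ be its representation with central character $\psi$ on the functions on $U$ given, for $w=x\otimes e_0+y\otimes e_1$, by $(\pi(w,z)f)(u)=\psi\big(z-\beta(x,u)-\tfrac12\beta(x,y)\big)f(u+y)$. The oscillator representation $\omega_{U\otimes V}$ is the unique representation $\omega$ of $Sp(W)$ on the functions on $U$ such that $\omega(g)\pi(w,z)\omega(g)^{-1}=\pi(gw,z)$ for all $g\in Sp(W)$, $(w,z)\in H$, and such that an element of $Sp(W)$ of the form $x\otimes e_0+y\otimes e_1\mapsto (x+Ay)\otimes e_0+y\otimes e_1$ acts by $f(u)\mapsto\psi(\tfrac12\beta(Au,u))f(u)$. (The last condition matters only for $k=1$, $q=3$.) Let $\omega_{U\otimes V,k}$ be the $k$-spectrum, i.e. the sum of the isotypic components in $\omega_{U\otimes V}|_G$ of the irreps in $\widehat G_k$. It is invariant under $O_\beta$ and $G$; let $\mathcal A_{O_\beta},\mathcal A_G\subset \mathrm{End}(\omega_{U\otimes V,k})$ be the algebras generated by the operators by which $O_\beta$, respectively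 $G$, acts on it. For $\tau\in\widehat{O_\beta}$ let $\eta(\tau)=\mathrm{Hom}_{O_\beta}(\tau,\omega_{U\otimes V,k})$, a representation of $G$, so that $\omega_{U\otimes V,k}=\bigoplus_\tau\tau\otimes\eta(\tau)$. **Theorem ($\eta$-correspondence).** 1. $\mathcal A_{O_\beta}$ and $\mathcal A_G$ are each other's commutant in $\mathrm{End}(\omega_{U\otimes V,k})$. Moreover, for every $\tau\in\widehat{O_\beta}$ that occurs in $\omega_{U\otimes V,k}$, the representation $\eta(\tau)$ is irreducible of tensor rank $k$, and $\tau\mapsto\eta(\tau)$ is an injection from the set of these $\tau$ into $\widehat G_k$. 2. Let $\varepsilon\in\mathbb F_q^\times$ be a non-square, and let $\beta_{k+},\beta_{k-}$ be the forms with associated quadratic forms $0,0$ if $k=0$; $x^2,\ \varepsilon x^2$ if $k=1$; $x^2-y^2,\ x^2-\varepsilon y^2$ if $k=2$. Then the images of the two correspondences together are all irreps of tensor rank $k$: $$\eta(\widehat{O_{\beta_{k+}}})\cup\eta(\widehat{O_{\beta_{k-}}})=\widehat G_k .$$ -/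

import Mathlib

open scoped TensorProduct

noncomputable section

namespace EtaCorrespondence

universe u v

/-! ### Quadratic spaces, isometry groups, the dual pair -/

/-- An inner product (non-degenerate symmetric bilinear form) on the `F`-vector space `U`. -/
structure QuadSpace (F : Type u) [Field F] (U : Type v) [AddCommGroup U] [Module F U] where
  form : LinearMap.BilinForm F U
  symm : ∀ x y, form x y = form y x
  nondeg : ∀ x, (∀ y, form x y = 0) → x = 0

/-- The group of linear automorphisms that preserve the bilinear form `B`. -/
def isometryGroup {F : Type u} [Field F] {M : Type v} [AddCommGroup M] [Module F M]
    (B : LinearMap.BilinForm F M) : Subgroup (M ≃ₗ[F] M) where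
  carrier := {g | ∀ x y, B (g x) (g y) = B x y}
  mul_mem' {a b} ha hb x y := by
    rw [LinearEquiv.mul_apply, LinearEquiv.mul_apply, ha, hb]
  one_mem' x y := rfl
  inv_mem' {a} ha x y := by
    have h := ha (a⁻¹ x) (a⁻¹ y)
    have e : ∀ z, a (a⁻¹ z) = z := fun z => a.apply_symm_apply z
    rw [e, e] at h
    exact h.symm

/-- The symplectic form `⟨v, v'⟩ = v₀ v'₁ - v₁ v'₀` on the plane `V = F²`. -/
def planeForm (F : Type u) [Field F] : LinearMap.BilinForm F (Fin 2 → F) :=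
  Matrix.toBilin' !![0, 1; -1, 0]

lemma planeForm_apply {F : Type u} [Field F] (v v' : Fin 2 → F) :
    planeForm F v v' = v 0 * v' 1 - v 1 * v' 0 := by
  simp [planeForm, Matrix.toBilin'_apply', dotProduct, Fin.sum_univ_two, Matrix.mulVec]
  ring

section DualPair

variable {F : Type u} [Field F] {U : Type v} [AddCommGroup U] [Module F U]

/-- The orthogonal group `O_β`. -/
abbrev QuadSpace.O (Q : QuadSpace F U) : Type v := isometryGroup Q.form

/-- The symplectic form `β ⊗ ⟨ , ⟩` on `W = U ⊗ V`. -/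
def QuadSpace.sympl (Q : QuadSpace F U) : LinearMap.BilinForm F (U ⊗[F] (Fin 2 → F)) :=
  LinearMap.BilinForm.tmul Q.form (planeForm F)

/-- The symplectic group `Sp(U ⊗ V)`. -/
abbrev QuadSpace.Sp (Q : QuadSpace F U) : Type (max u v) := isometryGroup Q.sympl

lemma QuadSpace.sympl_tmul (Q : QuadSpace F U) (u u' : U) (v v' : Fin 2 → F) :
    Q.sympl (u ⊗ₜ v) (u' ⊗ₜ v') = planeForm F v v' * Q.form u u' := rfl

lemma bilin_tensor_ext {M N : Type*} [AddCommGroup M] [Module F M] [AddCommGroup N] [Module F N]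
    (B B' : LinearMap.BilinForm F (M ⊗[F] N))
    (h : ∀ m n m' n', B (m ⊗ₜ n) (m' ⊗ₜ n') = B' (m ⊗ₜ n) (m' ⊗ₜ n')) (x y : M ⊗[F] N) :
    B x y = B' x y := by
  induction x using TensorProduct.induction_on with
  | zero => simp
  | add a b ha hb => simp [ha, hb]
  | tmul m n =>
    induction y using TensorProduct.induction_on with
    | zero => simp
    | add a b ha hb => simp [ha, hb]
    | tmul m' n' => exact h m n m' n'

/-- `O_β` acts on `U ⊗ V` through the first factor. -/
def QuadSpace.oToSp (Q : QuadSpace F U) : Q.O →* Q.Sp where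
  toFun o := ⟨TensorProduct.congr o.1 (LinearEquiv.refl F _), fun x y =>
    bilin_tensor_ext (Q.sympl.compl₁₂ (TensorProduct.congr o.1 (LinearEquiv.refl F _)).toLinearMap
      (TensorProduct.congr o.1 (LinearEquiv.refl F _)).toLinearMap) Q.sympl
      (fun m n m' n' => by simp [QuadSpace.sympl_tmul, o.2 m m']) x y⟩
  map_one' := by
    ext x
    induction x using TensorProduct.induction_on with
    | zero => simp
    | add a b ha hb => simp_all
    | tmul m n => simp
  map_mul' a b := by
    ext x
    induction x using TensorProduct.induction_on with
    | zero => simp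
    | add a b ha hb => simp_all
    | tmul m n => simp

/-- `G = SL₂(F)` acts on `U ⊗ V` through the second factor. -/
def QuadSpace.slToSp (Q : QuadSpace F U) : Matrix.SpecialLinearGroup (Fin 2) F →* Q.Sp where
  toFun g := ⟨TensorProduct.congr (LinearEquiv.refl F _) (Matrix.SpecialLinearGroup.toLin' g),
    fun x y => bilin_tensor_ext
      (Q.sympl.compl₁₂
        (TensorProduct.congr (LinearEquiv.refl F _)
          (Matrix.SpecialLinearGroup.toLin' g)).toLinearMap
        (TensorProduct.congr (LinearEquiv.refl F _)
          (Matrix.SpecialLinearGroup.toLin' g)).toLinearMap) Q.sympl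
      (fun m n m' n' => by
        have hg := g.det_coe
        rw [Matrix.det_fin_two] at hg
        simp only [LinearMap.compl₁₂_apply, LinearEquiv.coe_coe, TensorProduct.congr_tmul,
          QuadSpace.sympl_tmul, planeForm_apply, Matrix.SpecialLinearGroup.toLin'_apply,
          Matrix.toLin'_apply, Matrix.mulVec, dotProduct, Fin.sum_univ_two, LinearEquiv.refl_apply]
        linear_combination (n 0 * n' 1 - n 1 * n' 0) * Q.form m m' * hg) x y⟩
  map_one' := by
    ext x
    induction x using TensorProduct.induction_on with
    | zero => simp
    | add a b ha hb => simp_all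
    | tmul m n => simp
  map_mul' a b := by
    ext x
    induction x using TensorProduct.induction_on with
    | zero => simp
    | add a b ha hb => simp_all
    | tmul m n => simp

lemma QuadSpace.commute_oToSp_slToSp (Q : QuadSpace F U) (o : Q.O)
    (g : Matrix.SpecialLinearGroup (Fin 2) F) :
    Q.oToSp o * Q.slToSp g = Q.slToSp g * Q.oToSp o := by
  ext x
  induction x using TensorProduct.induction_on with
  | zero => simp
  | add a b ha hb => simp_all
  | tmul m n => simp [QuadSpace.oToSp, QuadSpace.slToSp]

/-! ### The Heisenberg group and the Schrödinger model -/

/-- The Heisenberg group `W × F` with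
`(w, z) (w', z') = (w + w', z + z' + ½ ⟨w, w'⟩)`. -/
@[ext]
structure Heisenberg {W : Type v} [AddCommGroup W] [Module F W]
    (B : LinearMap.BilinForm F W) where
  w : W
  z : F

namespace Heisenberg

variable {W : Type v} [AddCommGroup W] [Module F W] {B : LinearMap.BilinForm F W}

instance : Mul (Heisenberg B) := ⟨fun h h' => ⟨h.w + h'.w, h.z + h'.z + 2⁻¹ * B h.w h'.w⟩⟩
instance : One (Heisenberg B) := ⟨⟨0, 0⟩⟩
instance : Inv (Heisenberg B) := ⟨fun h => ⟨-h.w, -h.z + 2⁻¹ * B h.w h.w⟩⟩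

@[simp] lemma mul_w (h h' : Heisenberg B) : (h * h').w = h.w + h'.w := rfl
@[simp] lemma mul_z (h h' : Heisenberg B) :
    (h * h').z = h.z + h'.z + 2⁻¹ * B h.w h'.w := rfl
@[simp] lemma one_w : (1 : Heisenberg B).w = 0 := rfl
@[simp] lemma one_z : (1 : Heisenberg B).z = 0 := rfl
@[simp] lemma inv_w (h : Heisenberg B) : (h⁻¹).w = -h.w := rfl
@[simp] lemma inv_z (h : Heisenberg B) : (h⁻¹).z = -h.z + 2⁻¹ * B h.w h.w := rfl

instance : Group (Heisenberg B) :=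
  Group.ofLeftAxioms
    (fun a b c => by
      ext
      · simp [add_assoc]
      · simp; ring)
    (fun a => by ext <;> simp)
    (fun a => by ext <;> simp)

end Heisenberg

/-- The action `g (w, z) = (g w, z)` of the symplectic group on the Heisenberg group. -/
def QuadSpace.actHeis (Q : QuadSpace F U) (g : Q.Sp) (h : Heisenberg Q.sympl) :
    Heisenberg Q.sympl := ⟨g.1 h.w, h.z⟩

/-- The `i`-th coordinate `U ⊗ F² → U`, so that
`w = coord 0 w ⊗ e₀ + coord 1 w ⊗ e₁`. -/
def coord (F : Type u) [Field F] {U : Type v} [AddCommGroup U] [Module F U] (i : Fin 2) :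
    U ⊗[F] (Fin 2 → F) →ₗ[F] U :=
  (TensorProduct.rid F U).toLinearMap ∘ₗ LinearMap.lTensor U (LinearMap.proj i)

@[simp] lemma coord_tmul (i : Fin 2) (u : U) (v : Fin 2 → F) :
    coord F i (u ⊗ₜ[F] v) = v i • u := by
  simp [coord]

lemma coord_decomp (w : U ⊗[F] (Fin 2 → F)) :
    w = coord F 0 w ⊗ₜ Pi.single 0 1 + coord F 1 w ⊗ₜ Pi.single 1 1 := by
  induction w using TensorProduct.induction_on with
  | zero => simp
  | add a b ha hb =>
    rw [map_add, map_add, TensorProduct.add_tmul, TensorProduct.add_tmul]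
    nth_rewrite 1 [ha, hb]
    abel
  | tmul m n =>
    rw [coord_tmul, coord_tmul, TensorProduct.smul_tmul, TensorProduct.smul_tmul,
      ← TensorProduct.tmul_add]
    congr 1
    ext i
    fin_cases i <;> simp

lemma QuadSpace.sympl_coord (Q : QuadSpace F U) (w w' : U ⊗[F] (Fin 2 → F)) :
    Q.sympl w w' = Q.form (coord F 0 w) (coord F 1 w') - Q.form (coord F 1 w) (coord F 0 w') := by
  rw [coord_decomp w, coord_decomp w']
  simp [QuadSpace.sympl_tmul, planeForm_apply]
  ring

variable [NeZero (2 : F)]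

/-- The Heisenberg representation with central character `ψ` in the Schrödinger model: the
representation induced from the character `(x, z) ↦ ψ z` of `(U ⊗ e₀) × F`, restricted to
functions on `U = U ⊗ e₁`. For `w = x ⊗ e₀ + y ⊗ e₁`,
`(π(w, z) f)(u) = ψ(z - β(x, u) - ½ β(x, y)) f(u + y)`. -/
def QuadSpace.heisRep (Q : QuadSpace F U) (ψ : AddChar F ℂ) :
    Representation ℂ (Heisenberg Q.sympl) (U → ℂ) where
  toFun h :=
    { toFun := fun f u =>
        ψ (h.z - Q.form (coord F 0 h.w) u - 2⁻¹ * Q.form (coord F 0 h.w) (coord F 1 h.w)) *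
          f (u + coord F 1 h.w)
      map_add' := fun f f' => by ext u; simp [mul_add]
      map_smul' := fun c f => by ext u; simp; ring }
  map_one' := by ext f u; simp
  map_mul' h h' := by
    refine LinearMap.ext fun f => funext fun u => ?_
    simp only [LinearMap.coe_mk, AddHom.coe_mk, Module.End.mul_apply, Heisenberg.mul_w,
      Heisenberg.mul_z, map_add, LinearMap.add_apply, Q.sympl_coord]
    rw [← mul_assoc, ← AddChar.map_add_eq_mul, add_assoc u]
    congr 2
    rw [Q.symm (coord F 1 h.w) (coord F 0 h'.w)]
    have h2 : (2 : F) * 2⁻¹ = 1 := mul_inv_cancel₀ (NeZero.ne _)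
    linear_combination (-(Q.form (coord F 0 h'.w) (coord F 1 h.w))) * h2

lemma QuadSpace.heisRep_apply (Q : QuadSpace F U) (ψ : AddChar F ℂ) (h : Heisenberg Q.sympl)
    (f : U → ℂ) (u : U) : Q.heisRep ψ h f u =
      ψ (h.z - Q.form (coord F 0 h.w) u - 2⁻¹ * Q.form (coord F 0 h.w) (coord F 1 h.w)) *
        f (u + coord F 1 h.w) := rfl

/-- `ω` is the oscillator representation of `Sp(U ⊗ V)` in the Schrödinger model. The identity
`egorov` determines `ω` up to a character of `Sp(U ⊗ V)`; that character is trivial because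
`unipotent` fixes `ω` on the elements `(x, y) ↦ (x + A y, y)`, whose conjugates generate
`Sp(U ⊗ V)`. (The second condition matters only if `dim U = 1` and `|F| = 3`: in all other cases
`Sp(U ⊗ V)` has no non-trivial character.) -/
structure QuadSpace.IsOscillator (Q : QuadSpace F U) (ψ : AddChar F ℂ)
    (ω : Representation ℂ Q.Sp (U → ℂ)) : Prop where
  egorov : ∀ g h, ω g * Q.heisRep ψ h * ω g⁻¹ = Q.heisRep ψ (Q.actHeis g h)
  unipotent : ∀ (g : Q.Sp) (A : U →ₗ[F] U),
    (∀ w, coord F 0 (g.1 w) = coord F 0 w + A (coord F 1 w) ∧ coord F 1 (g.1 w) = coord F 1 w) →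
    ∀ f u, ω g f u = ψ (2⁻¹ * Q.form (A u) u) * f u

/-! ### Existence of the oscillator representation -/

section Existence

set_option linter.unusedSectionVars false

variable (Q : QuadSpace F U) (ψ : AddChar F ℂ)

/-- `M` satisfies the intertwining identity attached to `g`. -/
def QuadSpace.Intertw (g : Q.Sp) (M : Module.End ℂ (U → ℂ)) : Prop :=
  ∀ h, M * Q.heisRep ψ h = Q.heisRep ψ (Q.actHeis g h) * M

variable {Q ψ}

lemma exists_form_char_ne_one (hψ : ψ ≠ 1) {x : U} (hx : x ≠ 0) :
    ∃ v, ψ (Q.form x v) ≠ 1 := by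
  obtain ⟨a, ha⟩ : ∃ a, ψ a ≠ 1 := by
    by_contra! h
    exact hψ (by ext a; simpa using h a)
  obtain ⟨y, hy⟩ : ∃ y, Q.form x y ≠ 0 := by
    by_contra! h
    exact hx (Q.nondeg x h)
  refine ⟨(a / Q.form x y) • y, ?_⟩
  rw [map_smul, smul_eq_mul, div_mul_cancel₀ _ hy]
  exact ha

lemma sum_form_char [Fintype U] (hψ : ψ ≠ 1) {x : U} (hx : x ≠ 0) :
    ∑ v, ψ (Q.form x v) = 0 := by
  obtain ⟨v, hv⟩ := exists_form_char_ne_one (Q := Q) hψ hx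
  let χ : AddChar U ℂ := ψ.compAddMonoidHom (Q.form x).toAddMonoidHom
  have hχ : χ ≠ 0 := fun h => hv (by simpa [χ] using DFunLike.congr_fun h v)
  simpa [χ] using AddChar.sum_eq_zero_iff_ne_zero.2 hχ

lemma heis_e0 (x : U) (f : U → ℂ) (u : U) :
    Q.heisRep ψ ⟨x ⊗ₜ Pi.single 0 1, 0⟩ f u = ψ (-Q.form x u) * f u := by
  simp [QuadSpace.heisRep_apply]

lemma heis_e1 (y : U) (f : U → ℂ) (u : U) :
    Q.heisRep ψ ⟨y ⊗ₜ Pi.single 1 1, 0⟩ f u = f (u + y) := by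
  simp [QuadSpace.heisRep_apply]

open scoped Classical in
lemma heis_e1_single (y u : U) :
    Q.heisRep ψ ⟨y ⊗ₜ Pi.single 1 1, 0⟩ (Pi.single u 1) = Pi.single (u - y) (1 : ℂ) := by
  ext v
  rw [heis_e1]
  simp [Pi.single_apply, eq_sub_iff_add_eq]

open scoped Classical in
lemma end_eq_zero [Finite U] {M : Module.End ℂ (U → ℂ)}
    (h : ∀ u, M (Pi.single u 1) = 0) : M = 0 := by
  ext u : 2
  simpa using h u

/-- Schur's lemma for the Heisenberg representation. -/
lemma heis_schur [Finite U] (hψ : ψ ≠ 1) {A : Module.End ℂ (U → ℂ)}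
    (hA : ∀ h, A * Q.heisRep ψ h = Q.heisRep ψ h * A) : ∃ c : ℂ, A = c • 1 := by
  classical
  have hA' : ∀ h f, A (Q.heisRep ψ h f) = Q.heisRep ψ h (A f) := fun h f =>
    LinearMap.congr_fun (hA h) f
  have h0 : A (Pi.single 0 1) = (A (Pi.single 0 1) 0) • Pi.single 0 1 := by
    ext u
    by_cases hu : u = 0
    · subst hu; simp
    · obtain ⟨x, hx⟩ := exists_form_char_ne_one (Q := Q) hψ hu
      have e : Q.heisRep ψ ⟨(-x) ⊗ₜ Pi.single 0 1, 0⟩ (Pi.single 0 1) = Pi.single 0 (1 : ℂ) := by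
        ext v
        rw [heis_e0]
        by_cases hv : v = 0
        · subst hv; simp
        · simp [hv]
      have := congrFun (hA' ⟨(-x) ⊗ₜ Pi.single 0 1, 0⟩ (Pi.single 0 1)) u
      rw [e, heis_e0] at this
      have hz : A (Pi.single 0 1) u * (ψ (Q.form u x) - 1) = 0 := by
        rw [Q.symm u x]
        simp only [map_neg, LinearMap.neg_apply, neg_neg] at this
        linear_combination -this
      rcases mul_eq_zero.1 hz with h | h
      · simp [h, hu]
      · exact absurd (sub_eq_zero.1 h) hx
  refine ⟨A (Pi.single 0 1) 0, sub_eq_zero.1 (end_eq_zero fun u => ?_)⟩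
  have e : Pi.single u (1 : ℂ) = Q.heisRep ψ ⟨(-u) ⊗ₜ Pi.single 1 1, 0⟩ (Pi.single 0 1) := by
    rw [heis_e1_single]; simp
  rw [LinearMap.sub_apply, sub_eq_zero, LinearMap.smul_apply, Module.End.one_apply]
  conv_lhs => rw [e, hA', h0, map_smul, ← e]

/-- A non-zero intertwiner is injective. -/
lemma QuadSpace.Intertw.injective [Finite U] (hψ : ψ ≠ 1) {g : Q.Sp} {M : Module.End ℂ (U → ℂ)}
    (hM : Q.Intertw ψ g M) (h0 : M ≠ 0) : Function.Injective M := by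
  classical
  have := Fintype.ofFinite U
  have hM' : ∀ h f, M (Q.heisRep ψ h f) = Q.heisRep ψ (Q.actHeis g h) (M f) := fun h f =>
    LinearMap.congr_fun (hM h) f
  rw [injective_iff_map_eq_zero]
  intro f hf
  by_contra hne
  obtain ⟨u₀, hu₀⟩ : ∃ u, f u ≠ 0 := by
    by_contra! h
    exact hne (funext h)
  have key : (∑ x, ψ (Q.form x u₀) • Q.heisRep ψ ⟨x ⊗ₜ Pi.single 0 1, 0⟩ f) =
      ((Fintype.card U : ℂ) * f u₀) • Pi.single u₀ 1 := by
    ext u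
    simp only [Finset.sum_apply, Pi.smul_apply, heis_e0, smul_eq_mul]
    by_cases hu : u = u₀
    · subst hu
      simp [← mul_assoc, ← AddChar.map_add_eq_mul]
    · have : ∑ x, ψ (Q.form (u₀ - u) x) = 0 := sum_form_char hψ (sub_ne_zero.2 (Ne.symm hu))
      simp only [Pi.single_apply, hu, if_false, mul_zero]
      rw [← zero_mul (f u), ← this, Finset.sum_mul]
      refine Finset.sum_congr rfl fun x _ => ?_
      rw [← mul_assoc, ← AddChar.map_add_eq_mul, Q.symm _ x, map_sub, sub_eq_add_neg]
  have h1 : M (Pi.single u₀ 1) = 0 := by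
    have := congrArg M key
    rw [map_sum, map_smul] at this
    simp only [map_smul, hM', hf, map_zero, smul_zero, Finset.sum_const_zero] at this
    refine (smul_eq_zero.1 this.symm).resolve_left (mul_ne_zero ?_ hu₀)
    exact_mod_cast Fintype.card_ne_zero
  refine h0 (end_eq_zero fun u => ?_)
  have e : Pi.single u (1 : ℂ) =
      Q.heisRep ψ ⟨(u₀ - u) ⊗ₜ Pi.single 1 1, 0⟩ (Pi.single u₀ 1) := by
    rw [heis_e1_single]; simp
  rw [e, hM', h1, map_zero]

lemma actHeis_mul (g : Q.Sp) (h h' : Heisenberg Q.sympl) :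
    Q.actHeis g (h * h') = Q.actHeis g h * Q.actHeis g h' := by
  ext
  · simp [QuadSpace.actHeis]
  · have : Q.sympl (g.1 h.w) (g.1 h'.w) = Q.sympl h.w h'.w := g.2 _ _
    simp [QuadSpace.actHeis, this]

lemma heis_center (w : U ⊗[F] (Fin 2 → F)) (z : F) :
    Q.heisRep ψ ⟨w, z⟩ = ψ z • Q.heisRep ψ ⟨w, 0⟩ := by
  ext1; ext u
  simp only [LinearMap.smul_apply, Pi.smul_apply, QuadSpace.heisRep_apply, smul_eq_mul,
    ← mul_assoc, ← AddChar.map_add_eq_mul]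
  congr 2
  ring

open scoped Classical in
lemma heis_trace [Fintype U] (hψ : ψ ≠ 1) {w : U ⊗[F] (Fin 2 → F)} (hw : w ≠ 0) :
    ∑ v, Q.heisRep ψ ⟨w, 0⟩ (Pi.single v 1) v = 0 := by
  by_cases h1 : coord F 1 w = 0
  · have h0 : coord F 0 w ≠ 0 := by
      intro h
      apply hw
      rw [coord_decomp w, h, h1]
      simp
    have := sum_form_char (Q := Q) hψ (neg_ne_zero.2 h0)
    simpa [QuadSpace.heisRep_apply, h1] using this
  · refine Finset.sum_eq_zero fun v _ => ?_
    simp [QuadSpace.heisRep_apply, h1]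

lemma exists_intertw [Finite F] [Finite U] (hψ : ψ ≠ 1) (g : Q.Sp) :
    ∃ M : Module.End ℂ (U → ℂ), Q.Intertw ψ g M ∧ M ≠ 0 := by
  classical
  have := Fintype.ofFinite U
  have : Finite (Heisenberg Q.sympl) := by
    refine Finite.of_injective (fun h => (coord F 0 h.w, coord F 1 h.w, h.z)) fun h h' e => ?_
    simp only [Prod.mk.injEq] at e
    ext
    · rw [coord_decomp h.w, coord_decomp h'.w, e.1, e.2.1]
    · exact e.2.2
  have := Fintype.ofFinite (Heisenberg Q.sympl)
  -- averages of the rank one operators `f ↦ f v • δ₀`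
  let T : U → Module.End ℂ (U → ℂ) := fun v =>
    LinearMap.toSpanSingleton ℂ (U → ℂ) (Pi.single 0 1) ∘ₗ LinearMap.proj v
  let M : U → Module.End ℂ (U → ℂ) := fun v =>
    ∑ h : Heisenberg Q.sympl, Q.heisRep ψ (Q.actHeis g h) * T v * Q.heisRep ψ (h⁻¹)
  have hM : ∀ v, Q.Intertw ψ g (M v) := by
    intro v k
    simp only [M, Finset.sum_mul, Finset.mul_sum]
    refine Fintype.sum_equiv (Equiv.mulLeft k⁻¹) _ _ fun h => ?_
    have e1 : Q.heisRep ψ (Q.actHeis g h) =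
        Q.heisRep ψ (Q.actHeis g k) * Q.heisRep ψ (Q.actHeis g (k⁻¹ * h)) := by
      rw [← map_mul, ← actHeis_mul, mul_inv_cancel_left]
    have e2 : Q.heisRep ψ (k⁻¹ * h)⁻¹ = Q.heisRep ψ h⁻¹ * Q.heisRep ψ k := by
      rw [← map_mul, mul_inv_rev, inv_inv]
    rw [Equiv.coe_mulLeft, e1, e2]
    simp only [mul_assoc]
  by_contra! hall
  have h0 : ∀ v, M v (Pi.single v 1) 0 = 0 := fun v => by
    rw [hall _ (hM v)]; rfl
  have hterm : ∀ h : Heisenberg Q.sympl,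
      (∑ v, (Q.heisRep ψ (Q.actHeis g h) * T v * Q.heisRep ψ (h⁻¹)) (Pi.single v 1) 0) =
        if h.w = 0 then (Fintype.card U : ℂ) else 0 := by
    intro h
    have e : ∀ v, (Q.heisRep ψ (Q.actHeis g h) * T v * Q.heisRep ψ (h⁻¹)) (Pi.single v 1) 0 =
        Q.heisRep ψ (h⁻¹) (Pi.single v 1) v * Q.heisRep ψ (Q.actHeis g h) (Pi.single 0 1) 0 := by
      intro v
      simp [T, LinearMap.toSpanSingleton_apply]
    simp only [e, ← Finset.sum_mul]
    split_ifs with hw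
    · have hz : ψ (-h.z) * ψ h.z = 1 := by
        rw [← AddChar.map_add_eq_mul]; simp
      simp [QuadSpace.heisRep_apply, QuadSpace.actHeis, hw, mul_assoc, hz]
    · have : Q.heisRep ψ h⁻¹ = ψ (h⁻¹).z • Q.heisRep ψ ⟨-h.w, 0⟩ := heis_center _ _
      simp only [this, LinearMap.smul_apply, Pi.smul_apply, ← Finset.smul_sum,
        heis_trace hψ (neg_ne_zero.2 hw), smul_zero, zero_mul]
  have hsum : ∑ h : Heisenberg Q.sympl, (if h.w = 0 then (Fintype.card U : ℂ) else 0) = 0 := by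
    simp only [← hterm]
    rw [Finset.sum_comm]
    refine Finset.sum_eq_zero fun v _ => ?_
    rw [← h0 v]
    simp [M, LinearMap.sum_apply, Finset.sum_apply]
  rw [← Finset.sum_filter, Finset.sum_const, nsmul_eq_mul] at hsum
  rcases mul_eq_zero.1 hsum with h | h
  · rw [Nat.cast_eq_zero, Finset.card_eq_zero] at h
    have : (1 : Heisenberg Q.sympl) ∈
        Finset.univ.filter fun h : Heisenberg Q.sympl => h.w = 0 := by simp
    simp [h] at this
  · exact Fintype.card_ne_zero (α := U) (by exact_mod_cast h)

lemma QuadSpace.Intertw.mul {g g' : Q.Sp} {M M' : Module.End ℂ (U → ℂ)} (hM : Q.Intertw ψ g M)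
    (hM' : Q.Intertw ψ g' M') : Q.Intertw ψ (g * g') (M * M') := fun h => by
  have e : Q.actHeis (g * g') h = Q.actHeis g (Q.actHeis g' h) := rfl
  rw [mul_assoc, hM' h, ← mul_assoc, hM, mul_assoc, e]

lemma QuadSpace.Intertw.one : Q.Intertw ψ 1 1 := fun h => by
  have e : Q.actHeis 1 h = h := rfl
  rw [e, one_mul, mul_one]

lemma QuadSpace.Intertw.inv {g : Q.Sp} {M N : Module.End ℂ (U → ℂ)} (hM : Q.Intertw ψ g M)
    (h1 : M * N = 1) (h2 : N * M = 1) : Q.Intertw ψ g⁻¹ N := fun h => by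
  have e : Q.actHeis g (Q.actHeis g⁻¹ h) = h := by
    ext
    · exact g.1.apply_symm_apply _
    · rfl
  have := hM (Q.actHeis g⁻¹ h)
  rw [e] at this
  calc N * Q.heisRep ψ h = N * (Q.heisRep ψ h * M) * N := by
        rw [mul_assoc, mul_assoc, h1, mul_one]
    _ = Q.heisRep ψ (Q.actHeis g⁻¹ h) * N := by
        rw [← this, ← mul_assoc, h2, one_mul]

lemma QuadSpace.Intertw.exists_inv [Finite U] (hψ : ψ ≠ 1) {g : Q.Sp} {M : Module.End ℂ (U → ℂ)}
    (hM : Q.Intertw ψ g M) (h0 : M ≠ 0) : ∃ N, M * N = 1 ∧ N * M = 1 := by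
  let e := LinearEquiv.ofInjectiveEndo M (hM.injective hψ h0)
  refine ⟨e.symm.toLinearMap, ?_, ?_⟩
  · ext1; ext1
    exact congrFun (e.apply_symm_apply _) _
  · ext1; ext1
    exact congrFun (e.symm_apply_apply _) _

/-- Two intertwiners attached to the same element are proportional. -/
lemma QuadSpace.Intertw.eq_smul [Finite U] (hψ : ψ ≠ 1) {g : Q.Sp} {M M' : Module.End ℂ (U → ℂ)}
    (hM : Q.Intertw ψ g M) (h0 : M ≠ 0) (hM' : Q.Intertw ψ g M') : ∃ c : ℂ, M' = c • M := by
  obtain ⟨N, h1, h2⟩ := hM.exists_inv hψ h0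
  have hN := (hM.inv h1 h2).mul hM'
  rw [inv_mul_cancel] at hN
  obtain ⟨c, hc⟩ := heis_schur hψ (A := N * M') hN
  refine ⟨c, ?_⟩
  rw [← one_mul M', ← h1, mul_assoc, hc]
  simp

/-- The operator `f(u) ↦ f(-u)`. -/
def parity (U : Type v) [AddCommGroup U] : Module.End ℂ (U → ℂ) :=
  LinearMap.funLeft ℂ ℂ (fun u => -u)

lemma parity_sq : parity U * parity U = 1 := by
  refine LinearMap.ext fun f => funext fun u => ?_
  simp [parity, LinearMap.funLeft_apply]

lemma parity_heis (h : Heisenberg Q.sympl) :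
    parity U * Q.heisRep ψ h = Q.heisRep ψ ⟨-h.w, h.z⟩ * parity U := by
  refine LinearMap.ext fun f => funext fun u => ?_
  simp [parity, LinearMap.funLeft_apply, QuadSpace.heisRep_apply, add_comm]

lemma neg_ne_self_of_ne_zero (F : Type u) [Field F] [NeZero (2 : F)] {U : Type v} [AddCommGroup U]
    [Module F U] {u : U} (hu : u ≠ 0) : -u ≠ u := by
  intro h
  have h2 : (2 : F) • u = 0 := by
    rw [two_smul]; nth_rewrite 1 [← h]; simp
  exact hu ((smul_eq_zero.1 h2).resolve_left (NeZero.ne _))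


lemma trace_parity (F : Type u) [Field F] [NeZero (2 : F)] (U : Type v) [AddCommGroup U]
    [Module F U] [Finite U] : LinearMap.trace ℂ (U → ℂ) (parity U) = 1 := by
  classical
  have := Fintype.ofFinite U
  rw [LinearMap.trace_eq_matrix_trace ℂ (Pi.basisFun ℂ U), Matrix.trace]
  rw [Finset.sum_eq_single (0 : U)]
  · simp [parity, LinearMap.funLeft_apply]
  · intro u _ hu
    have := neg_ne_self_of_ne_zero F hu
    simp [parity, LinearMap.funLeft_apply, this]
  · simp

lemma QuadSpace.Intertw.parity_comm [Finite U] (hψ : ψ ≠ 1) {g : Q.Sp} {M : Module.End ℂ (U → ℂ)}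
    (hM : Q.Intertw ψ g M) (h0 : M ≠ 0) : parity U * M = M * parity U := by
  obtain ⟨N, h1, h2⟩ := hM.exists_inv hψ h0
  have hN := hM.inv h1 h2
  have key : ∀ h, (parity U * (N * parity U * M)) * Q.heisRep ψ h =
      Q.heisRep ψ h * (parity U * (N * parity U * M)) := by
    intro h
    have e : Q.actHeis g⁻¹ ⟨-(Q.actHeis g h).w, (Q.actHeis g h).z⟩ = ⟨-h.w, h.z⟩ := by
      ext
      · simp [QuadSpace.actHeis]
      · rfl
    calc (parity U * (N * parity U * M)) * Q.heisRep ψ h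
        = parity U * (N * parity U * (M * Q.heisRep ψ h)) := by simp only [mul_assoc]
      _ = parity U * (N * (parity U * Q.heisRep ψ (Q.actHeis g h)) * M) := by
          rw [hM h]; simp only [mul_assoc]
      _ = parity U * ((N * Q.heisRep ψ ⟨-(Q.actHeis g h).w, (Q.actHeis g h).z⟩) *
            parity U * M) := by rw [parity_heis]; simp only [mul_assoc]
      _ = (parity U * Q.heisRep ψ ⟨-h.w, h.z⟩) * (N * parity U * M) := by
          rw [hN, e]; simp only [mul_assoc]
      _ = Q.heisRep ψ h * (parity U * (N * parity U * M)) := by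
          rw [parity_heis]; simp only [neg_neg, mul_assoc]
  obtain ⟨c, hc⟩ := heis_schur hψ key
  have hc' : N * parity U * M = c • parity U := by
    calc N * parity U * M = parity U * parity U * (N * parity U * M) := by
          rw [parity_sq, one_mul]
      _ = c • parity U := by rw [mul_assoc, hc]; simp
  have ht := congrArg (LinearMap.trace ℂ (U → ℂ)) hc'
  rw [LinearMap.trace_mul_comm, ← mul_assoc, h1, one_mul, map_smul, trace_parity F U,
    smul_eq_mul, mul_one] at ht
  rw [← ht, one_smul] at hc'
  calc parity U * M = M * (N * parity U * M) := by
        rw [← mul_assoc, ← mul_assoc, h1, one_mul]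
    _ = _ := by rw [hc']

/-- Projection to even functions. -/
def evenProj (U : Type v) [AddCommGroup U] : Module.End ℂ (U → ℂ) := (2⁻¹ : ℂ) • (1 + parity U)

/-- Projection to odd functions. -/
def oddProj (U : Type v) [AddCommGroup U] : Module.End ℂ (U → ℂ) := (2⁻¹ : ℂ) • (1 - parity U)

lemma evenProj_apply (f : U → ℂ) (u : U) : evenProj U f u = 2⁻¹ * (f u + f (-u)) := by
  simp [evenProj, parity, LinearMap.funLeft_apply, mul_add]

lemma oddProj_apply (f : U → ℂ) (u : U) : oddProj U f u = 2⁻¹ * (f u - f (-u)) := by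
  simp [oddProj, parity, LinearMap.funLeft_apply]

lemma even_add_odd : evenProj U + oddProj U = 1 := by
  refine LinearMap.ext fun f => funext fun u => ?_
  simp [evenProj_apply, oddProj_apply]
  ring

lemma even_mul_even : evenProj U * evenProj U = evenProj U := by
  refine LinearMap.ext fun f => funext fun u => ?_
  simp [evenProj_apply]
  ring

lemma odd_mul_odd : oddProj U * oddProj U = oddProj U := by
  refine LinearMap.ext fun f => funext fun u => ?_
  simp [oddProj_apply]
  ring

lemma even_mul_odd : evenProj U * oddProj U = 0 := by
  refine LinearMap.ext fun f => funext fun u => ?_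
  simp [evenProj_apply, oddProj_apply]
  ring

lemma odd_mul_even : oddProj U * evenProj U = 0 := by
  refine LinearMap.ext fun f => funext fun u => ?_
  simp [evenProj_apply, oddProj_apply]
  ring

/-- For `M` commuting with the parity operator, the determinant of `M` on even functions. -/
def detEven (M : Module.End ℂ (U → ℂ)) : ℂ := LinearMap.det (M * evenProj U + oddProj U)

/-- For `M` commuting with the parity operator, the determinant of `M` on odd functions. -/
def detOdd (M : Module.End ℂ (U → ℂ)) : ℂ := LinearMap.det (M * oddProj U + evenProj U)

lemma comm_even {M : Module.End ℂ (U → ℂ)} (h : parity U * M = M * parity U) :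
    evenProj U * M = M * evenProj U := by
  simp [evenProj, mul_add, add_mul, h]

lemma comm_odd {M : Module.End ℂ (U → ℂ)} (h : parity U * M = M * parity U) :
    oddProj U * M = M * oddProj U := by
  simp [oddProj, mul_sub, sub_mul, h]

lemma detEven_mul (M : Module.End ℂ (U → ℂ)) {M' : Module.End ℂ (U → ℂ)}
    (h : parity U * M' = M' * parity U) : detEven (M * M') = detEven M * detEven M' := by
  rw [detEven, detEven, detEven, ← map_mul]
  congr 1
  have h1 : M * evenProj U * (M' * evenProj U) = M * M' * evenProj U := by
    rw [mul_assoc, ← mul_assoc (evenProj U), comm_even h, mul_assoc M', even_mul_even, mul_assoc]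
  have h2 : oddProj U * (M' * evenProj U) = 0 := by
    rw [← mul_assoc, comm_odd h, mul_assoc, odd_mul_even, mul_zero]
  rw [add_mul, mul_add, mul_add, h1, h2, odd_mul_odd, mul_assoc M (evenProj U), even_mul_odd, mul_zero,
    add_zero, zero_add]

lemma detOdd_mul (M : Module.End ℂ (U → ℂ)) {M' : Module.End ℂ (U → ℂ)}
    (h : parity U * M' = M' * parity U) : detOdd (M * M') = detOdd M * detOdd M' := by
  rw [detOdd, detOdd, detOdd, ← map_mul]
  congr 1
  have h1 : M * oddProj U * (M' * oddProj U) = M * M' * oddProj U := by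
    rw [mul_assoc, ← mul_assoc (oddProj U), comm_odd h, mul_assoc M', odd_mul_odd, mul_assoc]
  have h2 : evenProj U * (M' * oddProj U) = 0 := by
    rw [← mul_assoc, comm_even h, mul_assoc, even_mul_odd, mul_zero]
  rw [add_mul, mul_add, mul_add, h1, h2, even_mul_even, mul_assoc M (oddProj U), odd_mul_even, mul_zero,
    add_zero, zero_add]

lemma detEven_one : detEven (1 : Module.End ℂ (U → ℂ)) = 1 := by
  rw [detEven, one_mul, even_add_odd, map_one]

lemma detOdd_one : detOdd (1 : Module.End ℂ (U → ℂ)) = 1 := by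
  rw [detOdd, one_mul, add_comm, even_add_odd, map_one]

/-- Multiplication by the function `d`. -/
def mulOp (d : U → ℂ) : Module.End ℂ (U → ℂ) := LinearMap.mulLeft ℂ d

lemma mulOp_apply (d f : U → ℂ) (u : U) : mulOp d f u = d u * f u := rfl

lemma exists_odd_sign (F : Type u) [Field F] [NeZero (2 : F)] (U : Type v) [AddCommGroup U]
    [Module F U] : ∃ s : U → ℂ, (∀ u, s u * s u = 1) ∧ ∀ u, u ≠ 0 → s (-u) = -s u := by
  classical
  let _ := linearOrderOfSTO (WellOrderingRel (α := U))
  refine ⟨fun u => if u ≤ -u then 1 else -1, fun u => by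
    by_cases h : u ≤ -u <;> simp [h], fun u hu => ?_⟩
  have hne := neg_ne_self_of_ne_zero F hu
  rcases lt_or_gt_of_ne hne with h | h
  · simp [h.le, not_le.2 h]
  · simp [h.le, not_le.2 h]

/-- Multiplication by an even function with value `1` at `0` has equal determinants on even and
on odd functions. -/
lemma detEven_mulOp (F : Type u) [Field F] [NeZero (2 : F)] {U : Type v} [AddCommGroup U]
    [Module F U] {d : U → ℂ} (h0 : d 0 = 1) :
    detEven (mulOp d) = detOdd (mulOp d) := by
  obtain ⟨s, hs, hs'⟩ := exists_odd_sign F U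
  have hss : mulOp s * mulOp s = 1 := by
    refine LinearMap.ext fun f => funext fun u => ?_
    simp [mulOp_apply, ← mul_assoc, hs]
  have hconj : mulOp d * evenProj U + oddProj U =
      mulOp s * ((mulOp d * oddProj U + evenProj U) * mulOp s) := by
    refine LinearMap.ext fun f => funext fun u => ?_
    simp only [LinearMap.add_apply, Module.End.mul_apply, Pi.add_apply, mulOp_apply,
      evenProj_apply, oddProj_apply]
    by_cases hu : u = 0
    · subst hu
      rw [neg_zero, h0]
      linear_combination (-f 0) * hs 0
    · rw [hs' u hu]
      linear_combination (-(2⁻¹ * d u * (f u + f (-u)) + 2⁻¹ * (f u - f (-u)))) * hs u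
  rw [detEven, detOdd, hconj, map_mul, map_mul, mul_comm, mul_assoc, ← map_mul, hss, map_one,
    mul_one]

lemma det_mulOp [Fintype U] (d : U → ℂ) : LinearMap.det (mulOp d) = ∏ u, d u := by
  classical
  have : mulOp d = Matrix.toLin' (Matrix.diagonal d) := by
    refine LinearMap.ext fun f => funext fun u => ?_
    simp [mulOp_apply, Matrix.mulVec_diagonal]
  rw [this, LinearMap.det_toLin', Matrix.det_diagonal]

/-- The even functions have one dimension more than the odd ones. -/
lemma detEven_scalar (F : Type u) [Field F] [NeZero (2 : F)] {U : Type v} [AddCommGroup U]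
    [Module F U] [Finite U] (c : ℂ) :
    detEven (c • (1 : Module.End ℂ (U → ℂ))) = c * detOdd (c • (1 : Module.End ℂ (U → ℂ))) := by
  classical
  have := Fintype.ofFinite U
  let d : U → ℂ := fun u => if u = 0 then 1 else c
  let r : U → ℂ := fun u => if u = 0 then c else 1
  have h := detEven_mulOp F (U := U) (d := d) (by simp [d])
  have h1 : (c • (1 : Module.End ℂ (U → ℂ))) * evenProj U + oddProj U =
      mulOp r * (mulOp d * evenProj U + oddProj U) := by
    refine LinearMap.ext fun f => funext fun u => ?_
    by_cases hu : u = 0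
    · subst hu; simp [mulOp_apply, evenProj_apply, oddProj_apply, d, r]
    · simp [mulOp_apply, evenProj_apply, oddProj_apply, d, r, hu]
  have h2 : (c • (1 : Module.End ℂ (U → ℂ))) * oddProj U + evenProj U =
      mulOp d * oddProj U + evenProj U := by
    refine LinearMap.ext fun f => funext fun u => ?_
    by_cases hu : u = 0
    · subst hu; simp [mulOp_apply, evenProj_apply, oddProj_apply, d]
    · simp [mulOp_apply, evenProj_apply, oddProj_apply, d, hu]
  have hr : LinearMap.det (mulOp r) = c := by
    rw [det_mulOp]; simp [r]
  rw [detEven, detOdd, h1, h2, map_mul, hr]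
  rw [detEven, detOdd] at h
  rw [h]

variable (Q ψ) in
/-- The normalized intertwiners. -/
def QuadSpace.Normalized (g : Q.Sp) (M : Module.End ℂ (U → ℂ)) : Prop :=
  Q.Intertw ψ g M ∧ M ≠ 0 ∧ detEven M = detOdd M

lemma QuadSpace.Intertw.det_ne_zero [Finite U] (hψ : ψ ≠ 1) {g : Q.Sp}
    {M : Module.End ℂ (U → ℂ)} (hM : Q.Intertw ψ g M) (h0 : M ≠ 0) :
    detEven M ≠ 0 ∧ detOdd M ≠ 0 := by
  obtain ⟨N, -, h2⟩ := hM.exists_inv hψ h0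
  have hc := hM.parity_comm hψ h0
  have e : detEven N * detEven M = 1 := by rw [← detEven_mul _ hc, h2, detEven_one]
  have e' : detOdd N * detOdd M = 1 := by rw [← detOdd_mul _ hc, h2, detOdd_one]
  exact ⟨right_ne_zero_of_mul_eq_one e, right_ne_zero_of_mul_eq_one e'⟩

lemma QuadSpace.Normalized.eq [Finite U] (hψ : ψ ≠ 1) {g : Q.Sp}
    {M M' : Module.End ℂ (U → ℂ)} (h : Q.Normalized ψ g M) (h' : Q.Normalized ψ g M') :
    M = M' := by
  obtain ⟨c, rfl⟩ := h.1.eq_smul hψ h.2.1 h'.1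
  have hc := h.1.parity_comm hψ h.2.1
  have hd := h'.2.2
  have e : c • M = (c • 1) * M := by simp
  have hne := h'.1.det_ne_zero hψ h'.2.1
  rw [e, detEven_mul _ hc, detOdd_mul _ hc] at hne
  rw [e, detEven_mul _ hc, detOdd_mul _ hc, detEven_scalar F, h.2.2, mul_assoc] at hd
  have : c = 1 := by
    refine mul_right_cancel₀ hne.2 ?_
    rw [hd, one_mul]
  rw [this, one_smul]

lemma exists_normalized [Finite F] [Finite U] (hψ : ψ ≠ 1) (g : Q.Sp) :
    ∃ M, Q.Normalized ψ g M := by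
  obtain ⟨M, hM, h0⟩ := exists_intertw hψ g
  obtain ⟨he, ho⟩ := hM.det_ne_zero hψ h0
  have hc := hM.parity_comm hψ h0
  have hs : detOdd M / detEven M ≠ 0 := div_ne_zero ho he
  refine ⟨(detOdd M / detEven M) • M, fun h => ?_, smul_ne_zero hs h0, ?_⟩
  · rw [smul_mul_assoc, hM h, mul_smul_comm]
  · have e : (detOdd M / detEven M) • M = ((detOdd M / detEven M) • 1) * M := by simp
    rw [e, detEven_mul _ hc, detOdd_mul _ hc, detEven_scalar F]
    field_simp

lemma QuadSpace.Normalized.mul [Finite U] (hψ : ψ ≠ 1) {g g' : Q.Sp}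
    {M M' : Module.End ℂ (U → ℂ)} (h : Q.Normalized ψ g M) (h' : Q.Normalized ψ g' M') :
    Q.Normalized ψ (g * g') (M * M') := by
  refine ⟨h.1.mul h'.1, fun h0 => ?_, ?_⟩
  · obtain ⟨N, -, h2⟩ := h.1.exists_inv hψ h.2.1
    apply h'.2.1
    rw [← one_mul M', ← h2, mul_assoc, h0, mul_zero]
  · have hc := h'.1.parity_comm hψ h'.2.1
    rw [detEven_mul _ hc, detOdd_mul _ hc, h.2.2, h'.2.2]

lemma QuadSpace.Normalized.one : Q.Normalized ψ 1 1 :=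
  ⟨QuadSpace.Intertw.one, one_ne_zero, by rw [detEven_one, detOdd_one]⟩

lemma normalized_mulOp (g : Q.Sp) (A : U →ₗ[F] U)
    (hA : ∀ w, coord F 0 (g.1 w) = coord F 0 w + A (coord F 1 w) ∧
      coord F 1 (g.1 w) = coord F 1 w) :
    Q.Normalized ψ g (mulOp fun u => ψ (2⁻¹ * Q.form (A u) u)) := by
  have hsymm : ∀ x y, Q.form (A x) y = Q.form (A y) x := by
    intro x y
    have := g.2 (x ⊗ₜ Pi.single 1 1) (y ⊗ₜ Pi.single 1 1)
    rw [Q.sympl_coord, Q.sympl_coord] at this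
    simp only [hA] at this
    simp at this
    rw [sub_eq_zero, Q.symm x] at this
    exact this
  refine ⟨fun h => ?_, fun h => ?_, detEven_mulOp F (by simp)⟩
  · refine LinearMap.ext fun f => funext fun u => ?_
    simp only [Module.End.mul_apply, mulOp_apply, Q.heisRep_apply, QuadSpace.actHeis, hA,
      ← mul_assoc, ← AddChar.map_add_eq_mul]
    congr 2
    simp only [map_add, LinearMap.add_apply]
    have h2 : (2 : F) * 2⁻¹ = 1 := mul_inv_cancel₀ (NeZero.ne _)
    rw [hsymm u (coord F 1 h.w)]
    linear_combination (-(Q.form (A (coord F 1 h.w)) u)) * h2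
  · have := congrFun (LinearMap.congr_fun h 1) 0
    simp [mulOp_apply] at this

theorem exists_isOscillator [Finite F] [Finite U] (Q : QuadSpace F U) {ψ : AddChar F ℂ}
    (hψ : ψ ≠ 1) : ∃ ω, Q.IsOscillator ψ ω := by
  choose M hM using exists_normalized (Q := Q) hψ
  let ω : Representation ℂ Q.Sp (U → ℂ) :=
    { toFun := M
      map_one' := (hM 1).eq hψ QuadSpace.Normalized.one
      map_mul' := fun g g' => (hM (g * g')).eq hψ ((hM g).mul hψ (hM g')) }
  refine ⟨ω, fun g h => ?_, fun g A hA f u => ?_⟩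
  · have e : ω g * Q.heisRep ψ h = Q.heisRep ψ (Q.actHeis g h) * ω g := (hM g).1 h
    rw [e, mul_assoc, ← map_mul, mul_inv_cancel, map_one, mul_one]
  · have : ω g = _ := (hM g).eq hψ (normalized_mulOp g A hA)
    rw [this, mulOp_apply]

end Existence

/-! ### The oscillator representation and its restrictions -/

section Oscillator

variable [Finite F] [Finite U]

/-- The oscillator representation `ω_{U ⊗ V}` of `Sp(U ⊗ V)` on functions on `U`. -/
def QuadSpace.osc (Q : QuadSpace F U) {ψ : AddChar F ℂ} (hψ : ψ ≠ 1) :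
    Representation ℂ Q.Sp (U → ℂ) :=
  (exists_isOscillator Q hψ).choose

theorem QuadSpace.osc_isOscillator (Q : QuadSpace F U) {ψ : AddChar F ℂ} (hψ : ψ ≠ 1) :
    Q.IsOscillator ψ (Q.osc hψ) :=
  (exists_isOscillator Q hψ).choose_spec

/-- The restriction of the oscillator representation to `O_β`. -/
def QuadSpace.oscO (Q : QuadSpace F U) {ψ : AddChar F ℂ} (hψ : ψ ≠ 1) :
    Representation ℂ Q.O (U → ℂ) :=
  (Q.osc hψ).comp Q.oToSp

/-- The restriction of the oscillator representation to `G = SL₂(F)`. -/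
def QuadSpace.oscG (Q : QuadSpace F U) {ψ : AddChar F ℂ} (hψ : ψ ≠ 1) :
    Representation ℂ (Matrix.SpecialLinearGroup (Fin 2) F) (U → ℂ) :=
  (Q.osc hψ).comp Q.slToSp

lemma QuadSpace.oscO_oscG_comm (Q : QuadSpace F U) {ψ : AddChar F ℂ} (hψ : ψ ≠ 1) (o : Q.O)
    (g : Matrix.SpecialLinearGroup (Fin 2) F) (f : U → ℂ) :
    Q.oscO hψ o (Q.oscG hψ g f) = Q.oscG hψ g (Q.oscO hψ o f) := by
  have h : Q.oscO hψ o * Q.oscG hψ g = Q.oscG hψ g * Q.oscO hψ o := by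
    simp only [QuadSpace.oscO, QuadSpace.oscG, MonoidHom.comp_apply, ← map_mul,
      Q.commute_oToSp_slToSp]
  exact LinearMap.congr_fun h f

end Oscillator

end DualPair

/-- The quadratic spaces `β_{k±}` on `F^k` for `k ≤ 2`: the form is `0` for `k = 0`, `ε x²` for
`k = 1` and `x² - ε y²` for `k = 2`. The space is `β_{k+}` for `ε = 1` and `β_{k-}` for a
non-square `ε`. -/
def stdSpace {F : Type u} [Field F] (ε : Fˣ) (k : ℕ) : QuadSpace F (Fin k → F) where
  form := Matrix.toBilin' (Matrix.diagonal fun i : Fin k =>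
    (-1 : F) ^ (i : ℕ) * if (i : ℕ) + 1 = k then (ε : F) else 1)
  symm x y := by
    simp only [Matrix.toBilin'_apply', Matrix.mulVec_diagonal, dotProduct]
    exact Finset.sum_congr rfl fun i _ => by ring
  nondeg x hx := by
    ext i
    have h := hx (Pi.single i 1)
    have hne : ((-1 : F) ^ (i : ℕ) * if (i : ℕ) + 1 = k then (ε : F) else 1) ≠ 0 := by
      refine mul_ne_zero (pow_ne_zero _ (neg_ne_zero.2 one_ne_zero)) ?_
      split_ifs
      · exact ε.ne_zero
      · exact one_ne_zero
    simp only [Matrix.toBilin'_apply', Matrix.mulVec_diagonal, dotProduct] at h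
    rw [Finset.sum_eq_single i] at h
    · simp only [Pi.single_eq_same, mul_one] at h
      exact (mul_eq_zero.1 h).resolve_right hne
    · intro j _ hj
      simp [hj]
    · simp

lemma stdSpace_one {F : Type u} [Field F] (ε : Fˣ) (x y : Fin 1 → F) :
    (stdSpace ε 1).form x y = ε * (x 0 * y 0) := by
  simp [stdSpace, Matrix.toBilin'_apply', Matrix.mulVec_diagonal, dotProduct]
  ring

lemma stdSpace_two {F : Type u} [Field F] (ε : Fˣ) (x y : Fin 2 → F) :
    (stdSpace ε 2).form x y = x 0 * y 0 - ε * (x 1 * y 1) := by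
  simp [stdSpace, Matrix.toBilin'_apply', Matrix.mulVec_diagonal, dotProduct, Fin.sum_univ_two]
  ring

/-! ### Tensor rank -/

/-- `ρ` is isomorphic to a subrepresentation of `σ`. -/
def Occurs {G : Type*} [Group G] {M N : Type*} [AddCommGroup M] [Module ℂ M] [AddCommGroup N]
    [Module ℂ N] (ρ : Representation ℂ G M) (σ : Representation ℂ G N) : Prop :=
  ∃ f : Representation.IntertwiningMap ρ σ, Function.Injective f

section TensorRank

variable {F : Type u} [Field F] [Finite F] [NeZero (2 : F)]

/-- `ρ` is one of the four irreducible representations of `SL₂(F)` of dimension `(q ± 1) / 2`.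
For `q = 3` the trivial representation also has dimension `(q - 1) / 2`, and the irreducible
representation of dimension `q - 1` also has dimension `(q + 1) / 2`; in this case the four
representations that are meant are those that occur in the oscillator representations of
`SL₂(F)`. -/
def IsHalf {M : Type*} [AddCommGroup M] [Module ℂ M]
    (ρ : Representation ℂ (Matrix.SpecialLinearGroup (Fin 2) F) M) : Prop :=
  ρ.IsIrreducible ∧
  (2 * Module.finrank ℂ M = Nat.card F + 1 ∨ 2 * Module.finrank ℂ M + 1 = Nat.card F) ∧
  (Nat.card F = 3 →
    ∃ (ψ : AddChar F ℂ) (hψ : ψ ≠ 1), Occurs ρ ((stdSpace (1 : Fˣ) 1).oscG hψ))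

/-- `IsHalfProduct l σ`: `σ` is an `l`-fold tensor product of representations of dimension
`(q ± 1) / 2` as in `IsHalf` (the trivial representation for `l = 0`). -/
inductive IsHalfProduct (F : Type u) [Field F] [Finite F] [NeZero (2 : F)] :
    ℕ → ∀ (N : Type) [AddCommGroup N] [Module ℂ N],
      Representation ℂ (Matrix.SpecialLinearGroup (Fin 2) F) N → Prop
  | zero : IsHalfProduct F 0 ℂ
      (Representation.trivial ℂ (Matrix.SpecialLinearGroup (Fin 2) F) ℂ)
  | succ (l : ℕ) (M : Type) [AddCommGroup M] [Module ℂ M]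
      (ρ : Representation ℂ (Matrix.SpecialLinearGroup (Fin 2) F) M)
      (N : Type) [AddCommGroup N] [Module ℂ N]
      (σ : Representation ℂ (Matrix.SpecialLinearGroup (Fin 2) F) N)
      (hρ : IsHalf ρ) (hσ : IsHalfProduct F l N σ) :
      IsHalfProduct F (l + 1) (M ⊗[ℂ] N) (ρ.tprod σ)

/-- The irreducible representation `ρ` lies in the `k`-th step of the tensor rank filtration: it
appears in an `l`-fold tensor product, `l ≤ k`, of the representations of dimension
`(q ± 1) / 2`. -/
def InFiltration (k : ℕ) {M : Type*} [AddCommGroup M] [Module ℂ M]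
    (ρ : Representation ℂ (Matrix.SpecialLinearGroup (Fin 2) F) M) : Prop :=
  ∃ l ≤ k, ∃ (N : Type) (_ : AddCommGroup N) (_ : Module ℂ N)
    (σ : Representation ℂ (Matrix.SpecialLinearGroup (Fin 2) F) N),
    IsHalfProduct F l N σ ∧ Occurs ρ σ

/-- `ρ` is an irreducible representation of `SL₂(F)` of tensor rank `k`. -/
def IsIrrepOfRank (k : ℕ) {M : Type*} [AddCommGroup M] [Module ℂ M]
    (ρ : Representation ℂ (Matrix.SpecialLinearGroup (Fin 2) F) M) : Prop :=
  ρ.IsIrreducible ∧ InFiltration k ρ ∧ ∀ j < k, ¬ InFiltration j ρ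

end TensorRank

/-! ### The `k`-spectrum and the eta correspondence -/

section Eta

variable {F : Type u} [Field F] [Finite F] [NeZero (2 : F)] {U : Type v} [AddCommGroup U]
  [Module F U] [Finite U] (Q : QuadSpace F U) {ψ : AddChar F ℂ} (hψ : ψ ≠ 1) (k : ℕ)

/-- The `k`-spectrum: the sum of the isotypic components in `ω_{U ⊗ V}` of the irreducible
representations of `G` of tensor rank `k`, i.e. the sum of the images of all `G`-homomorphisms
from such representations. -/
def QuadSpace.spec : Submodule ℂ (U → ℂ) :=
  sSup {S | ∃ (M : Type) (_ : AddCommGroup M) (_ : Module ℂ M)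
    (ρ : Representation ℂ (Matrix.SpecialLinearGroup (Fin 2) F) M)
    (f : Representation.IntertwiningMap ρ (Q.oscG hψ)),
    IsIrrepOfRank k ρ ∧ S = LinearMap.range f.toLinearMap}

/-- The `k`-spectrum as a representation of `G`. -/
def QuadSpace.specG :
    Representation ℂ (Matrix.SpecialLinearGroup (Fin 2) F) (Q.spec hψ k) :=
  Subrepresentation.toRepresentation (ρ := Q.oscG hψ)
    { toSubmodule := Q.spec hψ k
      apply_mem_toSubmodule := fun g v hv => by
        suffices h : Q.spec hψ k ≤ (Q.spec hψ k).comap (Q.oscG hψ g) from h hv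
        refine sSup_le ?_
        rintro S ⟨M, i1, i2, ρ, f, hρ, rfl⟩ - ⟨m, rfl⟩
        have hle : LinearMap.range f.toLinearMap ≤ Q.spec hψ k :=
          le_sSup ⟨M, i1, i2, ρ, f, hρ, rfl⟩
        exact hle ⟨ρ g m, LinearMap.congr_fun (f.isIntertwining' g) m⟩ }

/-- The `k`-spectrum as a representation of `O_β`. -/
def QuadSpace.specO : Representation ℂ Q.O (Q.spec hψ k) :=
  Subrepresentation.toRepresentation (ρ := Q.oscO hψ)
    { toSubmodule := Q.spec hψ k
      apply_mem_toSubmodule := fun o v hv => by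
        suffices h : Q.spec hψ k ≤ (Q.spec hψ k).comap (Q.oscO hψ o) from h hv
        refine sSup_le ?_
        rintro S ⟨M, i1, i2, ρ, f, hρ, rfl⟩ - ⟨m, rfl⟩
        let f' : Representation.IntertwiningMap ρ (Q.oscG hψ) :=
          { toLinearMap := Q.oscO hψ o ∘ₗ f.toLinearMap
            isIntertwining' := fun g => by
              ext x
              have h1 : f.toLinearMap (ρ g x) = Q.oscG hψ g (f.toLinearMap x) :=
                LinearMap.congr_fun (f.isIntertwining' g) x
              simp only [LinearMap.comp_apply, h1, Q.oscO_oscG_comm] }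
        have hle : LinearMap.range f'.toLinearMap ≤ Q.spec hψ k :=
          le_sSup ⟨M, i1, i2, ρ, f', hρ, rfl⟩
        exact hle ⟨m, rfl⟩ }

/-- The algebra `𝒜_{O_β}`, acting on the `k`-spectrum. -/
def QuadSpace.algO : Subalgebra ℂ (Module.End ℂ (Q.spec hψ k)) :=
  Algebra.adjoin ℂ (Set.range (Q.specO hψ k))

/-- The algebra `𝒜_G`, acting on the `k`-spectrum. -/
def QuadSpace.algG : Subalgebra ℂ (Module.End ℂ (Q.spec hψ k)) :=
  Algebra.adjoin ℂ (Set.range (Q.specG hψ k))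

/-- The space `Hom_{O_β}(τ, k-spectrum)`. -/
def QuadSpace.etaSpace {T : Type*} [AddCommGroup T] [Module ℂ T] (τ : Representation ℂ Q.O T) :
    Submodule ℂ (T →ₗ[ℂ] (U → ℂ)) where
  carrier := {f | (∀ t, f t ∈ Q.spec hψ k) ∧ ∀ o t, f (τ o t) = Q.oscO hψ o (f t)}
  add_mem' {f f'} hf hf' := ⟨fun t => add_mem (hf.1 t) (hf'.1 t), fun o t => by
    simp only [LinearMap.add_apply, hf.2 o t, hf'.2 o t, map_add]⟩
  zero_mem' := ⟨fun t => zero_mem _, fun o t => by simp⟩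
  smul_mem' c f hf := ⟨fun t => Submodule.smul_mem _ c (hf.1 t), fun o t => by
    simp only [LinearMap.smul_apply, hf.2 o t, map_smul]⟩

/-- The eta correspondence: `η(τ) = Hom_{O_β}(τ, k-spectrum)`, on which `G` acts through the
`k`-spectrum. It is the multiplicity space of `τ`, so that the `k`-spectrum is the direct sum of
the `τ ⊗ η(τ)` over the irreducible representations `τ` of `O_β`. -/
def QuadSpace.eta {T : Type*} [AddCommGroup T] [Module ℂ T] (τ : Representation ℂ Q.O T) :
    Representation ℂ (Matrix.SpecialLinearGroup (Fin 2) F) (Q.etaSpace hψ k τ) where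
  toFun g :=
    { toFun := fun f => ⟨Q.oscG hψ g ∘ₗ f.1,
        fun t => (Q.specG hψ k g ⟨f.1 t, f.2.1 t⟩).2, fun o t => by
          simp only [LinearMap.comp_apply, f.2.2 o t, Q.oscO_oscG_comm]⟩
      map_add' := fun f f' => Subtype.ext (LinearMap.comp_add _ _ _)
      map_smul' := fun c f => Subtype.ext (LinearMap.comp_smul _ _ _) }
  map_one' := LinearMap.ext fun f => Subtype.ext (by simp [Module.End.one_eq_id])
  map_mul' g g' := LinearMap.ext fun f => Subtype.ext (by
    simp [Module.End.mul_eq_comp, LinearMap.comp_assoc])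

/-- `ρ` is an irreducible representation of `G` in the image of the eta correspondence. -/
def QuadSpace.InEtaImage {M : Type*} [AddCommGroup M] [Module ℂ M]
    (ρ : Representation ℂ (Matrix.SpecialLinearGroup (Fin 2) F) M) : Prop :=
  ρ.IsIrreducible ∧ ∃ (T : Type) (_ : AddCommGroup T) (_ : Module ℂ T)
    (τ : Representation ℂ Q.O T), τ.IsIrreducible ∧ Nonempty ((Q.eta hψ k τ).Equiv ρ)

end Eta

end EtaCorrespondence

end

open EtaCorrespondence

open scoped TensorProduct

noncomputable section

namespace EtaCorrespondence

universe u v w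

open Matrix (SpecialLinearGroup)
open Representation (IntertwiningMap)

set_option linter.unusedSectionVars false

/-! ### Generators of `SL₂` -/

section Generators

variable {F : Type u} [Field F]

/-! The heart of the matter is the commutant of `G = SL₂` in End(ω). The Heisenberg operators
attached to pairs (x, y) in U × U span End(ω) (`mem_span_heisOp`), and conjugation by `G` permutes
them as `G` permutes the pairs. Averaging over `G` therefore shows that the commutant is spanned by
sums of Heisenberg operators over `G`-orbits (`mem_of_commute`).

For k ≤ 2 these sums can be identified. A pair on an anisotropic line yields a combination of the
identity and the operator of a reflection (`sum_line_mem_of_anisotropic`). In the plane, the pairs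
of a given non-zero area form one orbit; the Fourier transform in the area of the sums over the
level sets is in general a multiple of the operator of a Cayley transform in O_β (`sum_area_mem`).
The exceptions are the isotropic lines and the degenerate parameters of the Cayley transform. They
give operators whose image consists of `G`-invariant functions (`oscG_eq_of_isotropic`). The trivial
representation has rank 0, so for k > 0 such operators vanish on the k-spectrum
(`mem_specAgree_of_invariant`). Hence on the k-spectrum the commutant of `G` is spanned by O_β
(`exists_span_oscO_of_commute`), although this may fail on all of ω.

Part 1 is then formal: Maschke's theorem and the double commutant theorem make the two algebras
mutual commutants, and the projections and transition maps between copies of τ, which commute with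
O_β, come from the group algebra of `G`. This makes η(τ) irreducible and lets it determine τ
(`eta_isIrrepOfRank`, `nonempty_equiv_of_eta_equiv`).

For part 2 it suffices that every irrep of rank k occurs in one of the two oscillator
representations, since an irrep ρ that occurs is η(τ) for any irreducible τ inside Hom_G(ρ, ω)
(`inEtaImage_of_occurs`). An irrep of rank k occurs in a k-fold product of the small irreps, and
tensor products of oscillator representations belong to orthogonal sums, so one is reduced to k = 1
and the classification of binary forms. For k = 1 and q ≠ 3 a representation of dimension (q ± 1)/2
is located by a dimension count: if Hom(ρ, ω) had no `G`-invariants, the general bound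
`finrank_bound` for representations of `SL₂` without invariants would contradict the number of
functionals on ρ of the weights that appear in ω. -/

/-- The upper unipotent matrix with entry `t`. -/
def upper (t : F) : SpecialLinearGroup (Fin 2) F := ⟨!![1, t; 0, 1], by simp⟩

/-- The Weyl element. -/
def weyl : SpecialLinearGroup (Fin 2) F := ⟨!![0, -1; 1, 0], by simp⟩

/-- The diagonal torus. -/
def torus (t : Fˣ) : SpecialLinearGroup (Fin 2) F :=
  ⟨!![(t : F), 0; 0, ((t⁻¹ : Fˣ) : F)], by simp⟩

@[simp] lemma coe_upper (t : F) : (upper t).1 = !![1, t; 0, 1] := rfl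

@[simp] lemma coe_weyl : (weyl : SpecialLinearGroup (Fin 2) F).1 = !![0, -1; 1, 0] := rfl

@[simp] lemma coe_torus (t : Fˣ) : (torus t).1 = !![(t : F), 0; 0, ((t⁻¹ : Fˣ) : F)] := rfl

lemma upper_mul (t t' : F) : upper t * upper t' = upper (t + t') := by
  ext i j; fin_cases i <;> fin_cases j <;> simp [Matrix.mul_apply, add_comm]

lemma upper_zero : upper (0 : F) = 1 := by
  ext i j; fin_cases i <;> fin_cases j <;> simp

lemma torus_mul (t t' : Fˣ) : torus t * torus t' = torus (t * t') := by
  ext i j; fin_cases i <;> fin_cases j <;> simp [Matrix.mul_apply, mul_comm]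

lemma torus_one : torus (1 : Fˣ) = 1 := by
  ext i j; fin_cases i <;> fin_cases j <;> simp

lemma torus_mul_upper (t : Fˣ) (x : F) : torus t * upper x = upper (t * t * x) * torus t := by
  ext i j; fin_cases i <;> fin_cases j <;> simp [Matrix.mul_apply]
  field_simp

lemma weyl_mul_torus (t : Fˣ) : weyl * torus t = torus t⁻¹ * weyl := by
  ext i j; fin_cases i <;> fin_cases j <;> simp [Matrix.mul_apply]

lemma weyl_mul_weyl : weyl * weyl = torus (-1 : Fˣ) := by
  ext i j; fin_cases i <;> fin_cases j <;> simp [Matrix.mul_apply]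

/-- The product of two elements of the big cell, put back into Bruhat form. It yields the invariance
of the sums over G/B and the quadratic relation used for the dimension bound. -/
lemma weyl_mul_upper_mul_weyl (t : Fˣ) :
    weyl * upper (t : F) * weyl =
      upper (-(t⁻¹ : Fˣ) : F) * weyl * torus t * upper (-(t⁻¹ : Fˣ) : F) := by
  ext i j; fin_cases i <;> fin_cases j <;> simp [Matrix.mul_apply]

/-- The small Bruhat cell; the next lemma is the big cell. -/
lemma eq_of_zero (g : SpecialLinearGroup (Fin 2) F) (h : g.1 1 0 = 0) :
    ∃ (t : Fˣ) (x : F), g = torus t * upper x := by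
  have hd := g.2
  rw [Matrix.det_fin_two, h, mul_zero, sub_zero] at hd
  have h0 : g.1 0 0 ≠ 0 := left_ne_zero_of_mul_eq_one hd
  refine ⟨Units.mk0 _ h0, (g.1 0 0)⁻¹ * g.1 0 1, ?_⟩
  ext i j; fin_cases i <;> fin_cases j <;> simp [Matrix.mul_apply, h]
  · field_simp
  · exact eq_inv_of_mul_eq_one_right hd

lemma eq_of_ne_zero (g : SpecialLinearGroup (Fin 2) F) (h : g.1 1 0 ≠ 0) :
    ∃ (x y : F) (t : Fˣ), g = upper x * weyl * torus t * upper y := by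
  have hd := g.2
  rw [Matrix.det_fin_two] at hd
  refine ⟨g.1 0 0 * (g.1 1 0)⁻¹, (g.1 1 0)⁻¹ * g.1 1 1, Units.mk0 _ h, ?_⟩
  ext i j; fin_cases i <;> fin_cases j <;> simp [Matrix.mul_apply]
  · field_simp
  · field_simp
    linear_combination -hd
  · field_simp

/-- The conjugates of upper unipotents by the Weyl element are the lower unipotents, and upper ·
lower · upper products reach the whole monomial coset of the Weyl element. Thus unipotents generate
the group. -/
lemma upper_mul_lower_mul_upper (t : Fˣ) :
    weyl * torus t = upper (-(t⁻¹ : Fˣ) : F) * (weyl * upper (-t : F) * weyl⁻¹) *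
      upper (-(t⁻¹ : Fˣ) : F) := by
  have : (weyl : SpecialLinearGroup (Fin 2) F)⁻¹ = torus (-1) * weyl := by
    refine inv_eq_of_mul_eq_one_right ?_
    ext i j; fin_cases i <;> fin_cases j <;> simp [Matrix.mul_apply]
  rw [this]
  ext i j; fin_cases i <;> fin_cases j <;> simp [Matrix.mul_apply]

/-- A subgroup that contains the upper unipotent matrices and their conjugates by the Weyl
element is everything. -/
lemma subgroup_eq_top (S : Subgroup (SpecialLinearGroup (Fin 2) F))
    (h1 : ∀ t, upper t ∈ S) (h2 : ∀ t, weyl * upper t * weyl⁻¹ ∈ S) : S = ⊤ := by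
  have hw : ∀ t : Fˣ, weyl * torus t ∈ S := fun t => by
    rw [upper_mul_lower_mul_upper]
    exact mul_mem (mul_mem (h1 _) (h2 _)) (h1 _)
  have hw1 : weyl ∈ S := by simpa [torus_one] using hw 1
  refine (Subgroup.eq_top_iff' S).2 fun g => ?_
  by_cases h : g.1 1 0 = 0
  · obtain ⟨t, x, rfl⟩ := eq_of_zero g h
    refine mul_mem ?_ (h1 x)
    exact (Subgroup.mul_mem_cancel_left S hw1).1 (hw t)
  · obtain ⟨x, y, t, rfl⟩ := eq_of_ne_zero g h
    refine mul_mem ?_ (h1 y)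
    rw [mul_assoc]
    exact mul_mem (h1 x) (hw t)

/-- A character of `SL₂` that is trivial on the upper unipotent matrices is trivial. -/
lemma char_eq_one {M : Type*} [CommMonoid M] (χ : SpecialLinearGroup (Fin 2) F →* M)
    (h : ∀ t, χ (upper t) = 1) (g : SpecialLinearGroup (Fin 2) F) : χ g = 1 := by
  have : χ.ker = ⊤ := by
    refine subgroup_eq_top _ h fun t => ?_
    have e : χ weyl * χ weyl⁻¹ = 1 := by rw [← map_mul, mul_inv_cancel, map_one]
    rw [MonoidHom.mem_ker, map_mul, map_mul, h, mul_one, e]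
  have hg : g ∈ χ.ker := this ▸ Subgroup.mem_top g
  exact hg

lemma weyl_generates (S : Subgroup (SpecialLinearGroup (Fin 2) F))
    (h1 : ∀ t, upper t ∈ S) (h2 : weyl ∈ S) : S = ⊤ :=
  subgroup_eq_top S h1 fun t => mul_mem (mul_mem h2 (h1 t)) (inv_mem h2)

end Generators

/-! ### The operators of the Schrödinger model -/

section Schroedinger

variable {F : Type u} [Field F] {U : Type v} [AddCommGroup U] [Module F U] [NeZero (2 : F)]
  (Q : QuadSpace F U) (ψ : AddChar F ℂ)

/-- The Heisenberg operator of `x ⊗ e₀ + y ⊗ e₁`. -/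
def QuadSpace.heisOp (x y : U) : Module.End ℂ (U → ℂ) :=
  Q.heisRep ψ ⟨x ⊗ₜ Pi.single 0 1 + y ⊗ₜ Pi.single 1 1, 0⟩

variable {Q ψ}

lemma heisOp_apply (x y : U) (f : U → ℂ) (u : U) :
    Q.heisOp ψ x y f u = ψ (-Q.form x u - 2⁻¹ * Q.form x y) * f (u + y) := by
  simp [QuadSpace.heisOp, QuadSpace.heisRep_apply]

lemma heisOp_zero : Q.heisOp ψ 0 0 = 1 := by
  refine LinearMap.ext fun f => funext fun u => ?_
  simp [heisOp_apply]

lemma heisOp_mul (x y x' y' : U) : Q.heisOp ψ x y * Q.heisOp ψ x' y' =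
    ψ (2⁻¹ * (Q.form x y' - Q.form y x')) • Q.heisOp ψ (x + x') (y + y') := by
  rw [QuadSpace.heisOp, QuadSpace.heisOp, QuadSpace.heisOp, ← map_mul, ← heis_center]
  congr 1
  ext
  · simp [TensorProduct.add_tmul]; abel
  · simp [Q.sympl_coord, sub_eq_add_neg]

lemma heisRep_eq (h : Heisenberg Q.sympl) :
    Q.heisRep ψ h = ψ h.z • Q.heisOp ψ (coord F 0 h.w) (coord F 1 h.w) := by
  rw [QuadSpace.heisOp, ← coord_decomp, ← heis_center]

lemma intertw_iff {g : Q.Sp} {M : Module.End ℂ (U → ℂ)} :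
    Q.Intertw ψ g M ↔ ∀ x y : U, M * Q.heisOp ψ x y =
      Q.heisOp ψ (coord F 0 (g.1 (x ⊗ₜ Pi.single 0 1 + y ⊗ₜ Pi.single 1 1)))
        (coord F 1 (g.1 (x ⊗ₜ Pi.single 0 1 + y ⊗ₜ Pi.single 1 1))) * M := by
  refine ⟨fun H x y => ?_, fun H h => ?_⟩
  · rw [QuadSpace.heisOp, H, heisRep_eq]
    simp [QuadSpace.actHeis]
  · rw [heisRep_eq, heisRep_eq, mul_smul_comm, smul_mul_assoc, H, ← coord_decomp]
    rfl

lemma coord_slToSp (g : SpecialLinearGroup (Fin 2) F) (x y : U) (i : Fin 2) :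
    coord F i ((Q.slToSp g).1 (x ⊗ₜ Pi.single 0 1 + y ⊗ₜ Pi.single 1 1)) =
      g.1 i 0 • x + g.1 i 1 • y := by
  simp [QuadSpace.slToSp, Matrix.SpecialLinearGroup.toLin'_apply, Matrix.toLin'_apply]

lemma coord_oToSp (o : Q.O) (x y : U) (i : Fin 2) :
    coord F i ((Q.oToSp o).1 (x ⊗ₜ Pi.single 0 1 + y ⊗ₜ Pi.single 1 1)) =
      if i = 0 then o.1 x else o.1 y := by
  fin_cases i <;> simp [QuadSpace.oToSp]

lemma intertw_slToSp_iff {g : SpecialLinearGroup (Fin 2) F} {M : Module.End ℂ (U → ℂ)} :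
    Q.Intertw ψ (Q.slToSp g) M ↔ ∀ x y : U, M * Q.heisOp ψ x y =
      Q.heisOp ψ (g.1 0 0 • x + g.1 0 1 • y) (g.1 1 0 • x + g.1 1 1 • y) * M := by
  rw [intertw_iff]
  simp only [coord_slToSp]

lemma intertw_oToSp_iff {o : Q.O} {M : Module.End ℂ (U → ℂ)} :
    Q.Intertw ψ (Q.oToSp o) M ↔ ∀ x y : U, M * Q.heisOp ψ x y =
      Q.heisOp ψ (o.1 x) (o.1 y) * M := by
  rw [intertw_iff]
  simp only [coord_oToSp, if_true, one_ne_zero, if_false]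

section Finite

variable [Finite F] [Finite U] (hψ : ψ ≠ 1)

lemma osc_intertw (g : Q.Sp) : Q.Intertw ψ g (Q.osc hψ g) := fun h => by
  rw [← (Q.osc_isOscillator hψ).egorov g h, mul_assoc, ← map_mul, inv_mul_cancel, map_one, mul_one]

lemma osc_ne_zero (g : Q.Sp) : Q.osc hψ g ≠ 0 := fun h => by
  have := congrArg (Q.osc hψ g⁻¹ * ·) h
  simp only [← map_mul, inv_mul_cancel, map_one, mul_zero] at this
  have h1 := congrFun (LinearMap.congr_fun this 1) (0 : U)
  simp at h1

lemma oscG_heisOp (g : SpecialLinearGroup (Fin 2) F) (x y : U) :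
    Q.oscG hψ g * Q.heisOp ψ x y =
      Q.heisOp ψ (g.1 0 0 • x + g.1 0 1 • y) (g.1 1 0 • x + g.1 1 1 • y) * Q.oscG hψ g :=
  intertw_slToSp_iff.1 (osc_intertw hψ _) x y

lemma oscG_upper (t : F) (f : U → ℂ) (u : U) :
    Q.oscG hψ (upper t) f u = ψ (2⁻¹ * (t * Q.form u u)) * f u := by
  have := (Q.osc_isOscillator hψ).unipotent (Q.slToSp (upper t)) (t • LinearMap.id)
    (fun w => by
      rw [coord_decomp w, coord_slToSp, coord_slToSp]
      simp) f u
  rw [QuadSpace.oscG, MonoidHom.comp_apply, this]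
  simp

/-- An intertwiner attached to an element of `O_β` is a multiple of the operator of that element. -/
lemma exists_eq_smul_oscO (o : Q.O) {M : Module.End ℂ (U → ℂ)}
    (h : ∀ x y : U, M * Q.heisOp ψ x y = Q.heisOp ψ (o.1 x) (o.1 y) * M) :
    ∃ c : ℂ, M = c • Q.oscO hψ o :=
  (osc_intertw hψ (Q.oToSp o)).eq_smul hψ (osc_ne_zero hψ _) (intertw_oToSp_iff.2 h)

lemma exists_eq_smul_oscG (g : SpecialLinearGroup (Fin 2) F) {M : Module.End ℂ (U → ℂ)}
    (h : ∀ x y : U, M * Q.heisOp ψ x y =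
      Q.heisOp ψ (g.1 0 0 • x + g.1 0 1 • y) (g.1 1 0 • x + g.1 1 1 • y) * M) :
    ∃ c : ℂ, M = c • Q.oscG hψ g :=
  (osc_intertw hψ (Q.slToSp g)).eq_smul hψ (osc_ne_zero hψ _) (intertw_slToSp_iff.2 h)

/-- Two representations of `SL₂` that are proportional and agree on the upper unipotent matrices
are equal. -/
lemma rep_eq_of_smul {F : Type u} [Field F] {M : Type*} [AddCommGroup M] [Module ℂ M]
    [Nontrivial M] (R R' : Representation ℂ (SpecialLinearGroup (Fin 2) F) M)
    (h : ∀ g, ∃ c : ℂ, R g = c • R' g) (hu : ∀ t, R (upper t) = R' (upper t)) : R = R' := by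
  have hne : ∀ g, R' g ≠ 0 := fun g h0 => by
    have : R' g * R' g⁻¹ = 1 := by rw [← map_mul, mul_inv_cancel, map_one]
    rw [h0, zero_mul] at this
    exact zero_ne_one this
  choose c hc using h
  have huniq : ∀ g (a b : ℂ), a • R' g = b • R' g → a = b := fun g a b hab =>
    smul_left_injective ℂ (hne g) hab
  -- The factor of proportionality is multiplicative and trivial on the upper unipotents, hence
  -- trivial.
  let χ : SpecialLinearGroup (Fin 2) F →* ℂ :=
    { toFun := c
      map_one' := huniq 1 _ _ (by rw [← hc, map_one, map_one, one_smul])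
      map_mul' := fun g g' => huniq (g * g') _ _ (by
        rw [← hc, map_mul, map_mul, hc, hc, smul_mul_smul_comm]) }
  have hχ := char_eq_one χ fun t => huniq (upper t) _ _ (by
    change c _ • _ = _
    rw [← hc, hu, one_smul])
  ext1 g
  rw [hc, show c g = 1 from hχ g, one_smul]

/-- Uniqueness of the restriction of the oscillator representation to `SL₂`. -/
lemma eq_oscG (R : Representation ℂ (SpecialLinearGroup (Fin 2) F) (U → ℂ))
    (h : ∀ g (x y : U), R g * Q.heisOp ψ x y =
      Q.heisOp ψ (g.1 0 0 • x + g.1 0 1 • y) (g.1 1 0 • x + g.1 1 1 • y) * R g)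
    (hu : ∀ t f u, R (upper t) f u = ψ (2⁻¹ * (t * Q.form u u)) * f u) :
    R = Q.oscG hψ := by
  refine rep_eq_of_smul _ _ (fun g => exists_eq_smul_oscG hψ g (h g)) fun t => ?_
  refine LinearMap.ext fun f => funext fun u => ?_
  rw [hu, oscG_upper]

end Finite

end Schroedinger

/-! ### The commutant of `SL₂` -/

/-! ### Elementary facts on irreducible representations -/

section Irreducible

variable {G : Type*} [Group G] {M : Type*} [AddCommGroup M] [Module ℂ M]

lemma exists_ne_zero_of_isIrreducible {ρ : Representation ℂ G M} (h : ρ.IsIrreducible) :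
    ∃ m : M, m ≠ 0 := by
  by_contra! h0
  have := h.toNontrivial
  refine bot_ne_top (α := Subrepresentation ρ) (Subrepresentation.toSubmodule_injective ?_)
  refine Submodule.ext fun m => ?_
  simp [h0 m]

/-- In an irreducible representation a stable subspace that contains a non-zero vector is
everything. -/
lemma mem_of_isIrreducible {ρ : Representation ℂ G M} (h : ρ.IsIrreducible) (S : Submodule ℂ M)
    (hS : ∀ g, ∀ m ∈ S, ρ g m ∈ S) {m : M} (hm : m ∈ S) (h0 : m ≠ 0) (m' : M) : m' ∈ S := by
  let S' : Subrepresentation ρ := ⟨S, fun g m hm => hS g m hm⟩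
  rcases h.eq_bot_or_eq_top S' with h1 | h1
  · exact absurd ((congrArg (m ∈ ·.toSubmodule) h1).mp hm) h0
  · exact (congrArg (m' ∈ ·.toSubmodule) h1).mpr trivial

lemma isIrreducible_of_forall {ρ : Representation ℂ G M} (h0 : ∃ m : M, m ≠ 0)
    (h : ∀ S : Submodule ℂ M, (∀ g, ∀ m ∈ S, ρ g m ∈ S) → ∀ m ∈ S, m ≠ 0 → S = ⊤) :
    ρ.IsIrreducible := by
  have : Nontrivial (Subrepresentation ρ) := by
    obtain ⟨m, hm⟩ := h0
    refine ⟨⊥, ⊤, fun e => hm ?_⟩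
    exact (congrArg (m ∈ ·.toSubmodule) e).mpr trivial
  refine ⟨fun S => ?_⟩
  by_cases hS : ∃ m ∈ S.toSubmodule, m ≠ 0
  · obtain ⟨m, hm, hm0⟩ := hS
    exact Or.inr (Subrepresentation.toSubmodule_injective
      (h _ (fun g m hm => S.apply_mem_toSubmodule g hm) m hm hm0))
  · push Not at hS
    refine Or.inl (Subrepresentation.toSubmodule_injective ((Submodule.eq_bot_iff _).2 hS))

lemma nonempty_equiv_of_trivial {ρ : Representation ℂ G M} (h : ρ.IsIrreducible)
    (ht : ∀ g m, ρ g m = m) : Nonempty (M ≃ₗ[ℂ] ℂ) := by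
  obtain ⟨m, hm⟩ := exists_ne_zero_of_isIrreducible h
  refine ⟨(LinearEquiv.ofBijective (LinearMap.toSpanSingleton ℂ M m) ⟨?_, fun m' => ?_⟩).symm⟩
  · exact smul_left_injective ℂ hm
  · have := mem_of_isIrreducible h (ℂ ∙ m) (fun g m hm => by rwa [ht])
      (Submodule.mem_span_singleton_self m) hm m'
    exact Submodule.mem_span_singleton.1 this

end Irreducible

/-! ### Orbits of `SL₂` on pairs of vectors -/

section Orbits

/-- The sum of `f` over the translates of `p` is a multiple of the sum over the orbit. -/
lemma card_smul_sum_orbit {G X M : Type*} [Group G] [Fintype G] [AddCommMonoid M]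
    (act : G → X → X) (hmul : ∀ g h x, act (g * h) x = act g (act h x)) (hone : ∀ x, act 1 x = x)
    (Y : Finset X) (hY : ∀ g, ∀ y ∈ Y, act g y ∈ Y) (p : X) (hp : ∀ y ∈ Y, ∃ g, act g p = y)
    (f : X → M) :
    Y.card • ∑ g, f (act g p) = Fintype.card G • ∑ y ∈ Y, f y := by
  calc Y.card • ∑ g, f (act g p) = ∑ y ∈ Y, ∑ g, f (act g y) := by
        rw [← Finset.sum_const]
        refine Finset.sum_congr rfl fun y hy => ?_
        obtain ⟨g₀, rfl⟩ := hp y hy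
        refine (Fintype.sum_equiv (Equiv.mulRight g₀) _ _ fun g => ?_).symm
        rw [Equiv.coe_mulRight, hmul]
    _ = ∑ g : G, ∑ y ∈ Y, f y := by
        rw [Finset.sum_comm]
        refine Finset.sum_congr rfl fun g _ => ?_
        refine Finset.sum_nbij' (act g) (act g⁻¹) (hY g) (hY g⁻¹) ?_ ?_ fun _ _ => rfl
        · intro y _; rw [← hmul, inv_mul_cancel, hone]
        · intro y _; rw [← hmul, mul_inv_cancel, hone]
    _ = _ := by rw [Finset.sum_const, Finset.card_univ]

variable {F : Type u} [Field F] {U : Type v} [AddCommGroup U] [Module F U]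

/-- The action of `SL₂` on pairs of vectors. -/
def slAct (g : SpecialLinearGroup (Fin 2) F) (p : U × U) : U × U :=
  (g.1 0 0 • p.1 + g.1 0 1 • p.2, g.1 1 0 • p.1 + g.1 1 1 • p.2)

lemma slAct_mul (g h : SpecialLinearGroup (Fin 2) F) (p : U × U) :
    slAct (g * h) p = slAct g (slAct h p) := by
  ext <;> simp [slAct, Matrix.mul_apply] <;> module

lemma slAct_one (p : U × U) : slAct (1 : SpecialLinearGroup (Fin 2) F) p = p := by
  ext <;> simp [slAct]

/-- The action of `SL₂` on pairs of vectors, as a permutation. -/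
def slPerm (g : SpecialLinearGroup (Fin 2) F) : U × U ≃ U × U where
  toFun := slAct g
  invFun := slAct g⁻¹
  left_inv p := by rw [← slAct_mul, inv_mul_cancel, slAct_one]
  right_inv p := by rw [← slAct_mul, mul_inv_cancel, slAct_one]

lemma slAct_smul (g : SpecialLinearGroup (Fin 2) F) (v : F × F) (z : U) :
    slAct g (v.1 • z, v.2 • z) = ((slAct g v).1 • z, (slAct g v).2 • z) := by
  ext <;> simp [slAct] <;> module

/-- Every non-zero vector is the first column of a matrix of determinant 1. -/
lemma exists_slAct_eq {v v' : F × F} (hv : v ≠ 0) (hv' : v' ≠ 0) :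
    ∃ g : SpecialLinearGroup (Fin 2) F, slAct g v = v' := by
  have key : ∀ v : F × F, v ≠ 0 →
      ∃ g : SpecialLinearGroup (Fin 2) F, slAct g ((1, 0) : F × F) = v := by
    rintro ⟨a, c⟩ h
    by_cases ha : a = 0
    · have hc : c ≠ 0 := fun hc => h (by simp [ha, hc])
      exact ⟨⟨!![a, -c⁻¹; c, 0], by simp [hc]⟩, by ext <;> simp [slAct]⟩
    · exact ⟨⟨!![a, 0; c, a⁻¹], by simp [ha]⟩, by ext <;> simp [slAct]⟩
  obtain ⟨g, rfl⟩ := key v hv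
  obtain ⟨g', rfl⟩ := key v' hv'
  refine ⟨g' * g⁻¹, ?_⟩
  rw [← slAct_mul, inv_mul_cancel_right]

/-- The area form on the plane. -/
def area (x y : Fin 2 → F) : F := x 0 * y 1 - x 1 * y 0

lemma area_slAct (g : SpecialLinearGroup (Fin 2) F) (p : (Fin 2 → F) × (Fin 2 → F)) :
    area (slAct g p).1 (slAct g p).2 = area p.1 p.2 := by
  have := g.2
  rw [Matrix.det_fin_two] at this
  simp only [area, slAct, Pi.add_apply, Pi.smul_apply, smul_eq_mul]
  linear_combination (p.1 0 * p.2 1 - p.1 1 * p.2 0) * this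

/-- Cramer's rule expands the vectors of `p'` in the basis `p`; the coefficients are quotients of
areas. The Plücker relation shows that the resulting matrix has determinant 1 exactly because the
two areas agree. -/
lemma exists_slAct_eq_of_area {p p' : (Fin 2 → F) × (Fin 2 → F)} (h0 : area p.1 p.2 ≠ 0)
    (h : area p'.1 p'.2 = area p.1 p.2) :
    ∃ g : SpecialLinearGroup (Fin 2) F, slAct g p = p' := by
  obtain ⟨x, y⟩ := p
  obtain ⟨x', y'⟩ := p'
  dsimp only at h h0
  set d := area x y with hd
  refine ⟨⟨!![area x' y / d, area x x' / d; area y' y / d, area x y' / d], ?_⟩, ?_⟩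
  · rw [Matrix.det_fin_two_of]
    field_simp
    have : area x' y * area x y' - area x x' * area y' y = area x' y' * area x y := by
      simp only [area]; ring
    rw [this, h, ← hd]; ring
  · ext i
    · simp only [slAct, Matrix.of_apply, Matrix.cons_val', Matrix.cons_val_zero, Pi.add_apply,
        Pi.smul_apply, smul_eq_mul, Matrix.cons_val_one, Matrix.cons_val_fin_one]
      field_simp
      rw [hd]
      fin_cases i <;> simp [area] <;> ring
    · simp only [slAct, Matrix.of_apply, Matrix.cons_val', Matrix.cons_val_zero, Pi.add_apply,
        Pi.smul_apply, smul_eq_mul, Matrix.cons_val_one, Matrix.cons_val_fin_one]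
      field_simp
      rw [hd]
      fin_cases i <;> simp [area] <;> ring

end Orbits

/-! ### Orbit sums of Heisenberg operators -/

section Commutant

variable {F : Type u} [Field F] {U : Type v} [AddCommGroup U] [Module F U] [NeZero (2 : F)]
  {Q : QuadSpace F U} {ψ : AddChar F ℂ}

/-- The Heisenberg operators span the endomorphism algebra. -/
lemma mem_span_heisOp [Finite U] (hψ : ψ ≠ 1) (A : Module.End ℂ (U → ℂ)) :
    A ∈ Submodule.span ℂ (Set.range fun p : U × U => Q.heisOp ψ p.1 p.2) := by
  classical
  have := Fintype.ofFinite U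
  set S := Submodule.span ℂ (Set.range fun p : U × U => Q.heisOp ψ p.1 p.2)
  -- The matrix units. Translation by v - u moves the value at v to u, and a Fourier sum over x
  -- isolates the point u.
  let E : U → U → Module.End ℂ (U → ℂ) := fun u v =>
    LinearMap.toSpanSingleton ℂ (U → ℂ) (Pi.single u 1) ∘ₗ LinearMap.proj v
  have hE : ∀ u v, E u v ∈ S := by
    intro u v
    have : (Fintype.card U : ℂ) • E u v =
        ∑ x, ψ (Q.form x u + 2⁻¹ * Q.form x (v - u)) • Q.heisOp ψ x (v - u) := by
      refine LinearMap.ext fun f => funext fun w => ?_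
      simp only [LinearMap.sum_apply, Finset.sum_apply, LinearMap.smul_apply, Pi.smul_apply,
        heisOp_apply, smul_eq_mul, ← mul_assoc, ← AddChar.map_add_eq_mul]
      have e : ∀ x, Q.form x u + 2⁻¹ * Q.form x (v - u) +
          (-Q.form x w - 2⁻¹ * Q.form x (v - u)) = Q.form (u - w) x := fun x => by
        rw [Q.symm (u - w), map_sub (Q.form x) u w]; ring
      simp only [e, ← Finset.sum_mul]
      by_cases hw : w = u
      · subst hw
        simp [E, LinearMap.toSpanSingleton_apply]
      · rw [sum_form_char hψ (sub_ne_zero.2 (Ne.symm hw))]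
        simp [E, LinearMap.toSpanSingleton_apply, hw]
    have hc : (Fintype.card U : ℂ) ≠ 0 := by exact_mod_cast Fintype.card_ne_zero
    rw [← inv_smul_smul₀ hc (E u v), this]
    exact S.smul_mem _ (S.sum_mem fun x _ => S.smul_mem _
      (Submodule.subset_span ⟨(x, v - u), rfl⟩))
  have hA : A = ∑ u, ∑ v, A (Pi.single v 1) u • E u v := by
    refine sub_eq_zero.1 (end_eq_zero fun v => funext fun u => ?_)
    simp [E, LinearMap.toSpanSingleton_apply, Pi.single_apply, Finset.sum_apply]
  rw [hA]
  exact S.sum_mem fun u _ => S.sum_mem fun v _ => S.smul_mem _ (hE u v)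

variable [Finite F] [Finite U] (hψ : ψ ≠ 1)

lemma oscG_conj_heisOp (g : SpecialLinearGroup (Fin 2) F) (p : U × U) :
    Q.oscG hψ g * Q.heisOp ψ p.1 p.2 * Q.oscG hψ g⁻¹ =
      Q.heisOp ψ (slAct g p).1 (slAct g p).2 := by
  rw [oscG_heisOp, mul_assoc, ← map_mul, mul_inv_cancel, map_one, mul_one]
  rfl

/-- To show that the commutant of `SL₂` lies in a subspace it suffices to consider the sums of
Heisenberg operators over orbits. -/
lemma mem_of_commute [Fintype (SpecialLinearGroup (Fin 2) F)]
    (S : Submodule ℂ (Module.End ℂ (U → ℂ)))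
    (hS : ∀ p : U × U, ∑ g : SpecialLinearGroup (Fin 2) F,
      Q.heisOp ψ (slAct g p).1 (slAct g p).2 ∈ S)
    {A : Module.End ℂ (U → ℂ)} (hA : ∀ g, A * Q.oscG hψ g = Q.oscG hψ g * A) : A ∈ S := by
  -- Averaging multiplies a commuting operator by the group order and turns a Heisenberg operator
  -- into a sum over the translates of its pair.
  let avg : Module.End ℂ (U → ℂ) →ₗ[ℂ] Module.End ℂ (U → ℂ) :=
    ∑ g, LinearMap.mulLeftRight ℂ (Q.oscG hψ g, Q.oscG hψ g⁻¹)
  have havg : ∀ A, avg A = ∑ g, Q.oscG hψ g * A * Q.oscG hψ g⁻¹ := fun A => by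
    simp [avg, LinearMap.sum_apply]
  have h1 : avg A ∈ S := by
    have : Submodule.span ℂ (Set.range fun p : U × U => Q.heisOp ψ p.1 p.2) ≤ S.comap avg := by
      rw [Submodule.span_le]
      rintro _ ⟨p, rfl⟩
      rw [SetLike.mem_coe, Submodule.mem_comap, havg]
      simp only [oscG_conj_heisOp]
      exact hS p
    exact this (mem_span_heisOp hψ A)
  have h2 : avg A = (Fintype.card (SpecialLinearGroup (Fin 2) F) : ℂ) • A := by
    rw [havg]
    simp only [← hA, mul_assoc, ← map_mul, mul_inv_cancel, map_one, mul_one]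
    rw [Finset.sum_const, Finset.card_univ, Nat.cast_smul_eq_nsmul]
  have hc : (Fintype.card (SpecialLinearGroup (Fin 2) F) : ℂ) ≠ 0 := by
    exact_mod_cast Fintype.card_ne_zero
  rw [← inv_smul_smul₀ hc A, ← h2]
  exact S.smul_mem _ h1

/-- A combination of Heisenberg operators with invariant coefficients commutes with `SL₂`. -/
lemma sum_heisOp_commute [Fintype U] (a : U × U → ℂ)
    (ha : ∀ (g : SpecialLinearGroup (Fin 2) F) p, a (slAct g p) = a p)
    (g : SpecialLinearGroup (Fin 2) F) :
    (∑ p, a p • Q.heisOp ψ p.1 p.2) * Q.oscG hψ g =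
      Q.oscG hψ g * ∑ p, a p • Q.heisOp ψ p.1 p.2 := by
  rw [Finset.sum_mul, Finset.mul_sum]
  refine (Fintype.sum_equiv (slPerm g) _ _ fun p => ?_).symm
  rw [mul_smul_comm, smul_mul_assoc, oscG_heisOp, show slPerm g p = slAct g p from rfl, ha]
  rfl

variable (Q) in
/-- The operators that agree on the `k`-spectrum with a combination of operators of `O_β`. -/
def specAgree (k : ℕ) : Submodule ℂ (Module.End ℂ (U → ℂ)) where
  carrier := {A | ∃ a ∈ Submodule.span ℂ (Set.range (Q.oscO hψ)), ∀ f ∈ Q.spec hψ k, A f = a f}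
  add_mem' := by
    rintro A B ⟨a, ha, hA⟩ ⟨b, hb, hB⟩
    exact ⟨a + b, add_mem ha hb, fun f hf => by
      rw [LinearMap.add_apply, LinearMap.add_apply, hA f hf, hB f hf]⟩
  zero_mem' := ⟨0, zero_mem _, fun f _ => rfl⟩
  smul_mem' := by
    rintro c A ⟨a, ha, hA⟩
    exact ⟨c • a, Submodule.smul_mem _ c ha, fun f hf => by
      rw [LinearMap.smul_apply, LinearMap.smul_apply, hA f hf]⟩

lemma oscO_mem_specAgree (k : ℕ) (o : Q.O) : Q.oscO hψ o ∈ specAgree Q hψ k :=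
  ⟨_, Submodule.subset_span ⟨o, rfl⟩, fun _ _ => rfl⟩

lemma one_mem_specAgree (k : ℕ) : 1 ∈ specAgree Q hψ k := by
  have := oscO_mem_specAgree hψ k (1 : Q.O)
  rwa [map_one] at this

/-- An operator that maps to the invariants of `SL₂` kills the spectrum of positive rank. -/
lemma mem_specAgree_of_invariant {k : ℕ} (hk : 0 < k) {B : Module.End ℂ (U → ℂ)}
    (hB : ∀ g, B * Q.oscG hψ g = Q.oscG hψ g * B) (hinv : ∀ g f, Q.oscG hψ g (B f) = B f) :
    B ∈ specAgree Q hψ k := by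
  refine ⟨0, zero_mem _, fun f hf => ?_⟩
  suffices h : Q.spec hψ k ≤ LinearMap.ker B from h hf
  refine sSup_le ?_
  rintro S ⟨M, i1, i2, ρ, φ, hρ, rfl⟩
  have := hρ.1
  let φ' : Representation.IntertwiningMap ρ (Q.oscG hψ) :=
    { toLinearMap := B ∘ₗ φ.toLinearMap
      isIntertwining' := fun g => by
        rw [LinearMap.comp_assoc, φ.isIntertwining', ← LinearMap.comp_assoc,
          ← LinearMap.comp_assoc]
        exact congrArg (· ∘ₗ φ.toLinearMap) (hB g) }
  -- If the composite were injective, `G` would act trivially on ρ, which would then lie in the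
  -- filtration step 0 < k.
  rcases Representation.IsIrreducible.injective_or_eq_zero φ' with h | h
  · exfalso
    have ht : ∀ g m, ρ g m = m := fun g m => h (by
      rw [φ'.isIntertwining]; exact hinv g _)
    obtain ⟨e⟩ := nonempty_equiv_of_trivial hρ.1 ht
    refine hρ.2.2 0 hk ⟨0, le_rfl, ℂ, _, _, _, IsHalfProduct.zero, ⟨e.toLinearMap, fun g => ?_⟩,
      e.injective⟩
    ext m
    simp [ht]
  · rintro _ ⟨m, rfl⟩
    exact congrArg (fun χ : Representation.IntertwiningMap ρ (Q.oscG hψ) => χ m) h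

/-- The linear map `L`, which preserves the form, as an element of `O_β`. -/
def mkIsometry (L : U →ₗ[F] U) (hL : ∀ x y, Q.form (L x) (L y) = Q.form x y) : Q.O :=
  ⟨LinearEquiv.ofBijective L (by
    have hi : Function.Injective L := (injective_iff_map_eq_zero L).2 fun x hx =>
      Q.nondeg x fun y => by rw [← hL, hx]; simp
    exact ⟨hi, Finite.surjective_of_injective hi⟩), hL⟩

lemma mkIsometry_apply (L : U →ₗ[F] U) (hL : ∀ x y, Q.form (L x) (L y) = Q.form x y) (x : U) :
    (mkIsometry L hL).1 x = L x := rfl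

/-- The sum of the Heisenberg operators over an anisotropic line is a multiple of the operator of
a reflection. -/
lemma sum_line_mem_of_anisotropic [Fintype F] (k : ℕ) {z : U} (hz : Q.form z z ≠ 0) :
    ∑ v : F × F, Q.heisOp ψ (v.1 • z) (v.2 • z) ∈ specAgree Q hψ k := by
  -- The reflection along z. It moves x and y by multiples of z, so a shift of the summation
  -- variable makes the sum intertwine (x, y) with (L x, L y).
  let L : U →ₗ[F] U := LinearMap.id - (2 / Q.form z z) • (Q.form z).smulRight z
  have hLa : ∀ x, L x = x - (2 / Q.form z z * Q.form z x) • z := fun x => by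
    simp [L, smul_smul]
  have hL : ∀ x y, Q.form (L x) (L y) = Q.form x y := fun x y => by
    simp only [hLa, map_sub, LinearMap.sub_apply, map_smul, LinearMap.smul_apply, smul_eq_mul,
      Q.symm x z]
    field_simp
    ring
  obtain ⟨c, hc⟩ := exists_eq_smul_oscO hψ (mkIsometry L hL)
    (M := ∑ v : F × F, Q.heisOp ψ (v.1 • z) (v.2 • z)) fun x y => by
      rw [Finset.sum_mul, Finset.mul_sum]
      refine Fintype.sum_equiv (Equiv.addRight (2 / Q.form z z * Q.form z x,
        2 / Q.form z z * Q.form z y)) _ _ fun v => ?_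
      rw [heisOp_mul, heisOp_mul, mkIsometry_apply, mkIsometry_apply, hLa, hLa]
      have e : ∀ (a b : F) (x : U), x - b • z + (a + b) • z = a • z + x := fun a b x => by module
      simp only [Equiv.coe_addRight, Prod.fst_add, Prod.snd_add, e]
      congr 2
      simp only [map_sub, LinearMap.sub_apply, map_smul, LinearMap.smul_apply, smul_eq_mul,
        Q.symm x z, Q.symm y z]
      field_simp
      ring
  rw [hc]
  exact Submodule.smul_mem _ c (oscO_mem_specAgree hψ k _)

/-- The sum over the translates of a pair of proportional vectors. -/
lemma sum_slAct_mem_of_line [Fintype F] [Fintype (SpecialLinearGroup (Fin 2) F)] (k : ℕ) {z : U}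
    (hz : ∑ v : F × F, Q.heisOp ψ (v.1 • z) (v.2 • z) ∈ specAgree Q hψ k) (v : F × F) :
    ∑ g : SpecialLinearGroup (Fin 2) F,
      Q.heisOp ψ (slAct g (v.1 • z, v.2 • z)).1 (slAct g (v.1 • z, v.2 • z)).2 ∈
        specAgree Q hψ k := by
  classical
  by_cases hv : v = 0
  · subst hv
    simp only [slAct_smul]
    have : ∀ g : SpecialLinearGroup (Fin 2) F, slAct g (0 : F × F) = 0 := fun g => by
      simp [slAct]
    simp only [this, Prod.fst_zero, Prod.snd_zero, zero_smul, heisOp_zero]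
    exact Submodule.sum_mem _ fun _ _ => one_mem_specAgree hψ k
  -- The orbit of v is the plane without the origin; the missing term of the line sum is the
  -- identity.
  · have h := card_smul_sum_orbit (G := SpecialLinearGroup (Fin 2) F) (slAct (F := F) (U := F))
      slAct_mul slAct_one (Finset.univ.erase 0) (fun g y hy => by
        rw [Finset.mem_erase] at hy ⊢
        refine ⟨fun h0 => hy.1 ?_, Finset.mem_univ _⟩
        rw [← slAct_one (F := F) y, ← inv_mul_cancel g, slAct_mul, h0]
        simp [slAct]) v (fun y hy => exists_slAct_eq hv (Finset.ne_of_mem_erase hy))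
      fun v => Q.heisOp ψ (v.1 • z) (v.2 • z)
    simp only [slAct_smul]
    rw [← Nat.cast_smul_eq_nsmul ℂ, ← Nat.cast_smul_eq_nsmul ℂ] at h
    have hc : ((Finset.univ.erase (0 : F × F)).card : ℂ) ≠ 0 := by
      rw [Nat.cast_ne_zero]
      exact Finset.card_ne_zero_of_mem (Finset.mem_erase.2 ⟨hv, Finset.mem_univ _⟩)
    rw [← inv_smul_smul₀ hc (∑ g, _), h]
    refine Submodule.smul_mem _ _ (Submodule.smul_mem _ _ ?_)
    rw [Finset.sum_erase_eq_sub (Finset.mem_univ _)]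
    refine sub_mem hz ?_
    simpa [heisOp_zero] using one_mem_specAgree hψ k

end Commutant

/-! ### The commutant of `SL₂` for binary forms -/

section Plane

variable {F : Type u} [Field F] [NeZero (2 : F)] {Q : QuadSpace F (Fin 2 → F)}
  {ψ : AddChar F ℂ}

lemma exists_smul_of_area {l x : Fin 2 → F} (hl : l ≠ 0) (h : area l x = 0) :
    ∃ a : F, x = a • l := by
  obtain ⟨i, hi⟩ := Function.ne_iff.1 hl
  rw [area] at h
  refine ⟨x i / l i, funext fun j => ?_⟩
  simp only [Pi.zero_apply] at hi
  simp only [Pi.smul_apply, smul_eq_mul]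
  field_simp
  fin_cases i <;> fin_cases j <;> simp
  · linear_combination h
  · linear_combination -h

/-- A vector that is orthogonal to an isotropic vector `l` lies on the line of `l`. -/
lemma exists_smul_of_orthogonal {l x : Fin 2 → F} (hl : l ≠ 0) (hll : Q.form l l = 0)
    (h : Q.form l x = 0) : ∃ a : F, x = a • l := by
  by_cases ha : area l x = 0
  · exact exists_smul_of_area hl ha
  -- Otherwise l and x form a basis of vectors orthogonal to l.
  · refine absurd (Q.nondeg l fun y => ?_) hl
    have : y = (area y x / area l x) • l + (area l y / area l x) • x := by
      ext i
      simp only [Pi.add_apply, Pi.smul_apply, smul_eq_mul]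
      field_simp
      fin_cases i <;> simp [area] <;> ring
    rw [this]
    simp [hll, h]

variable [Finite F] (hψ : ψ ≠ 1)

/-- Functions invariant under the Heisenberg operators of an isotropic line are invariant under
`SL₂`. -/
lemma oscG_eq_of_isotropic {l : Fin 2 → F} (hl : l ≠ 0) (hll : Q.form l l = 0)
    {f : (Fin 2 → F) → ℂ} (hf : ∀ a b : F, Q.heisOp ψ (a • l) (b • l) f = f)
    (g : SpecialLinearGroup (Fin 2) F) : Q.oscG hψ g f = f := by
  classical
  have hψ' : ∃ a, ψ a ≠ 1 := by
    by_contra! h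
    exact hψ (by ext a; simpa using h a)
  -- Invariance under the multiplication operators confines the support to the orthogonal complement
  -- of l, which is the line of l; invariance under translations makes f constant there. So the
  -- invariant functions are the multiples of `f₀`.
  have hsupp : ∀ f : (Fin 2 → F) → ℂ, (∀ a b : F, Q.heisOp ψ (a • l) (b • l) f = f) →
      ∀ u, Q.form l u ≠ 0 → f u = 0 := by
    intro f hf u hu
    obtain ⟨a, ha⟩ := hψ'
    have h := congrFun (hf (-(a / Q.form l u)) 0) u
    rw [heisOp_apply] at h
    simp only [neg_smul, map_neg, map_smul, LinearMap.neg_apply, LinearMap.smul_apply,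
      smul_eq_mul, zero_smul, map_zero, mul_zero, add_zero, sub_zero, neg_neg,
      div_mul_cancel₀ _ hu] at h
    have h' : (ψ a - 1) * f u = 0 := by linear_combination h
    exact (mul_eq_zero.1 h').resolve_left (sub_ne_zero.2 ha)
  let f₀ : (Fin 2 → F) → ℂ := fun u => if Q.form l u = 0 then 1 else 0
  have hf₀ : ∀ a b : F, Q.heisOp ψ (a • l) (b • l) f₀ = f₀ := fun a b => by
    ext u
    rw [heisOp_apply]
    by_cases hu : Q.form l u = 0
    · simp [f₀, hu, hll]
    · simp [f₀, hu, hll]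
  have hmul : ∀ f : (Fin 2 → F) → ℂ, (∀ a b : F, Q.heisOp ψ (a • l) (b • l) f = f) →
      f = f 0 • f₀ := by
    intro f hf
    ext u
    by_cases hu : Q.form l u = 0
    · obtain ⟨b, rfl⟩ := exists_smul_of_orthogonal hl hll hu
      have h := congrFun (hf 0 b) 0
      rw [heisOp_apply] at h
      simp only [zero_smul, map_zero, LinearMap.zero_apply, neg_zero, mul_zero, sub_zero,
        AddChar.map_zero_eq_one, one_mul, zero_add] at h
      simp [f₀, hll, h]
    · simp [f₀, hu, hsupp f hf u hu]
  -- `SL₂` only permutes the Heisenberg operators of the line, so it acts on the multiples of `f₀`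
  -- by a character.
  have hstable : ∀ g, ∀ f : (Fin 2 → F) → ℂ, (∀ a b : F, Q.heisOp ψ (a • l) (b • l) f = f) →
      ∀ a b : F, Q.heisOp ψ (a • l) (b • l) (Q.oscG hψ g f) = Q.oscG hψ g f := by
    intro g f hf a b
    have e := slAct_smul g (slAct g⁻¹ (a, b)) l
    rw [← slAct_mul, mul_inv_cancel, slAct_one] at e
    have h := LinearMap.congr_fun (oscG_heisOp (Q := Q) hψ g ((slAct g⁻¹ (a, b)).1 • l)
      ((slAct g⁻¹ (a, b)).2 • l)) f
    rw [Module.End.mul_apply, Module.End.mul_apply, hf] at h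
    have e1 := congrArg Prod.fst e
    have e2 := congrArg Prod.snd e
    rw [slAct] at e1 e2
    dsimp only at e1 e2
    rw [e1, e2] at h
    exact h.symm
  have h00 : f₀ 0 = 1 := by simp [f₀]
  let χ : SpecialLinearGroup (Fin 2) F →* ℂ :=
    { toFun := fun g => Q.oscG hψ g f₀ 0
      map_one' := by simp [h00]
      map_mul' := fun g g' => by
        rw [map_mul, Module.End.mul_apply, hmul _ (hstable g' f₀ hf₀), map_smul]
        simp [h00, mul_comm] }
  -- An upper unipotent multiplies the value at 0 by ψ(0) = 1.
  have hχ : χ g = 1 := char_eq_one χ (fun t => by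
    change Q.oscG hψ (upper t) f₀ 0 = 1
    rw [oscG_upper]
    simp [h00]) g
  have hg : Q.oscG hψ g f₀ = f₀ := by
    rw [hmul _ (hstable g f₀ hf₀), show Q.oscG hψ g f₀ 0 = 1 from hχ, one_smul]
  rw [hmul f hf, map_smul, hg]

/-- The sum of the Heisenberg operators over an isotropic line kills the `2`-spectrum. -/
lemma sum_line_mem_of_isotropic [Fintype F] {k : ℕ} (hk : 0 < k) {l : Fin 2 → F} (hl : l ≠ 0)
    (hll : Q.form l l = 0) :
    ∑ v : F × F, Q.heisOp ψ (v.1 • l) (v.2 • l) ∈ specAgree Q hψ k := by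
  refine mem_specAgree_of_invariant hψ hk (fun g => ?_) fun g f => ?_
  · rw [Finset.sum_mul, Finset.mul_sum]
    refine (Fintype.sum_equiv (slPerm g) _ _ fun v => ?_).symm
    have e := slAct_smul g v l
    rw [oscG_heisOp]
    congr 2
    · exact congrArg Prod.fst e
    · exact congrArg Prod.snd e
  -- On an isotropic line the operators multiply without phase factors, so their sum absorbs each of
  -- them.
  · refine oscG_eq_of_isotropic hψ hl hll (fun a b => ?_) g
    rw [LinearMap.sum_apply, map_sum]
    refine Fintype.sum_equiv (Equiv.addLeft (a, b)) _ _ fun v => ?_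
    rw [← Module.End.mul_apply, heisOp_mul]
    simp [hll, add_smul]

variable (Q) in
/-- The rotation `J` with `β(J x, y) = area x y`. -/
lemma exists_rotation : ∃ (J : (Fin 2 → F) →ₗ[F] (Fin 2 → F)) (n : F),
    (∀ x y, Q.form (J x) y = area x y) ∧ ∀ x, J (J x) = n • x := by
  classical
  let e₀ : Fin 2 → F := Pi.single 0 1
  let e₁ : Fin 2 → F := Pi.single 1 1
  set p := Q.form e₀ e₀ with hp
  set r := Q.form e₀ e₁ with hr
  set s := Q.form e₁ e₁ with hs
  have hform : ∀ x y, Q.form x y =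
      p * (x 0 * y 0) + r * (x 0 * y 1 + x 1 * y 0) + s * (x 1 * y 1) := by
    intro x y
    have hd : ∀ x : Fin 2 → F, x = x 0 • e₀ + x 1 • e₁ := fun x => by
      ext i; fin_cases i <;> simp [e₀, e₁]
    conv_lhs => rw [hd x, hd y]
    simp only [map_add, map_smul, LinearMap.add_apply, LinearMap.smul_apply, smul_eq_mul,
      Q.symm e₁ e₀, ← hp, ← hr, ← hs]
    ring
  -- If the Gram determinant vanishes, the columns of the adjugate of the Gram matrix lie, up to
  -- sign, in the radical; they vanish, and with them the form.
  have hδ : p * s - r * r ≠ 0 := by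
    intro h0
    have h1 : (![s, -r] : Fin 2 → F) = 0 := Q.nondeg _ fun y => by
      rw [hform]; simp; linear_combination (y 0) * h0
    have h2 : (![r, -p] : Fin 2 → F) = 0 := Q.nondeg _ fun y => by
      rw [hform]; simp; linear_combination (-y 1) * h0
    have hs0 : s = 0 := congrFun h1 0
    have hr0 : r = 0 := congrFun h2 0
    have hp0 : p = 0 := neg_eq_zero.1 (congrFun h2 1)
    have h3 : e₀ = 0 := Q.nondeg _ fun y => by rw [hform, hs0, hr0, hp0]; ring
    have := congrFun h3 0
    simp [e₀] at this
  set δ := p * s - r * r with hδd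
  -- J is the inverse Gram matrix times the rotation by a right angle. Its trace is 0 and its
  -- determinant δ⁻¹, so its square is -δ⁻¹.
  refine ⟨δ⁻¹ • Matrix.toLin' !![-r, -s; p, r], -δ⁻¹, fun x y => ?_, fun x => ?_⟩
  · rw [hform]
    simp [Matrix.toLin'_apply, dotProduct, Fin.sum_univ_two, area]
    field_simp
    rw [hδd]
    ring
  · ext i
    simp only [LinearMap.smul_apply, map_smul, Matrix.toLin'_apply, Pi.smul_apply, smul_eq_mul]
    field_simp
    fin_cases i <;> simp [Matrix.mulVec, dotProduct, Fin.sum_univ_two, hδd] <;> ring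

lemma area_add_left (x x' y : Fin 2 → F) : area (x + x') y = area x y + area x' y := by
  simp [area]; ring

lemma area_add_right (x y y' : Fin 2 → F) : area x (y + y') = area x y + area x y' := by
  simp [area]; ring

lemma area_comm (x y : Fin 2 → F) : area x y = -area y x := by
  simp only [area]; ring

/-- The sums of the Heisenberg operators weighted by a character of the area. -/
lemma sum_area_mem [Fintype F] {k : ℕ} (hk : 0 < k) (c : F) :
    ∑ p : (Fin 2 → F) × (Fin 2 → F), ψ (c * area p.1 p.2) • Q.heisOp ψ p.1 p.2 ∈
      specAgree Q hψ k := by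
  obtain ⟨J, n, hJ, hJJ⟩ := exists_rotation Q
  have h2 : (2 : F) ≠ 0 := NeZero.ne _
  have hJ' : ∀ x y, Q.form x (J y) = -Q.form (J x) y := fun x y => by
    rw [Q.symm, hJ, hJ, area_comm]
  -- multiplication from the right and from the left
  have hR : ∀ x y, (∑ p : (Fin 2 → F) × (Fin 2 → F),
      ψ (c * area p.1 p.2) • Q.heisOp ψ p.1 p.2) * Q.heisOp ψ x y =
      ∑ p : (Fin 2 → F) × (Fin 2 → F), ψ (c * area p.1 p.2 + c * area x y +
        (Q.form p.1 (c • J y + (2⁻¹ : F) • y) - Q.form p.2 (c • J x + (2⁻¹ : F) • x))) •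
          Q.heisOp ψ p.1 p.2 := by
    intro x y
    rw [Finset.sum_mul]
    refine Fintype.sum_equiv (Equiv.addRight (x, y)) _ _ fun p => ?_
    rw [smul_mul_assoc, heisOp_mul, smul_smul, ← AddChar.map_add_eq_mul]
    simp only [Equiv.coe_addRight, Prod.fst_add, Prod.snd_add]
    congr 2
    simp only [area_add_left, area_add_right, map_add, map_smul, LinearMap.add_apply,
      smul_eq_mul, hJ', hJ, Q.symm y x]
    rw [area_comm y x]
    rw [area_comm p.2 x]
    ring
  have hLm : ∀ x y, Q.heisOp ψ x y * (∑ p : (Fin 2 → F) × (Fin 2 → F),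
      ψ (c * area p.1 p.2) • Q.heisOp ψ p.1 p.2) =
      ∑ p : (Fin 2 → F) × (Fin 2 → F), ψ (c * area p.1 p.2 + c * area x y +
        (Q.form p.1 (c • J y - (2⁻¹ : F) • y) - Q.form p.2 (c • J x - (2⁻¹ : F) • x))) •
          Q.heisOp ψ p.1 p.2 := by
    intro x y
    rw [Finset.mul_sum]
    refine Fintype.sum_equiv (Equiv.addLeft (x, y)) _ _ fun p => ?_
    rw [mul_smul_comm, heisOp_mul, smul_smul, ← AddChar.map_add_eq_mul]
    simp only [Equiv.coe_addLeft, Prod.fst_add, Prod.snd_add]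
    congr 2
    simp only [area_add_left, area_add_right, map_add, map_sub, map_smul, LinearMap.add_apply,
      smul_eq_mul, hJ', hJ, Q.symm y x, Q.symm p.1, Q.symm p.2]
    rw [area_comm y x]
    rw [area_comm p.2 x]
    ring
  let K : (Fin 2 → F) →ₗ[F] (Fin 2 → F) := c • J + (2⁻¹ : F) • LinearMap.id
  have hK : ∀ x, K x = c • J x + (2⁻¹ : F) • x := fun x => rfl
  -- Since J² = n, (c J - ½)(c J + ½) = -m. So L exists as the Cayley transform -m⁻¹ K² when m ≠ 0.
  set m : F := 2⁻¹ * 2⁻¹ - c * c * n with hm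
  have hKK : ∀ x y, Q.form (K x) (K y) = m * Q.form x y := fun x y => by
    simp only [hK, map_add, map_smul, LinearMap.add_apply, LinearMap.smul_apply, smul_eq_mul,
      hJ', hJJ, hm]
    ring
  have hKm : ∀ x, c • J (K x) - (2⁻¹ : F) • K x = (-m) • x := fun x => by
    simp only [hK, map_add, map_smul, hJJ, hm]
    module
  -- In the degenerate case K scales the form by 0, so its image contains an isotropic vector killed
  -- by c J - ½. The Heisenberg operators of that line fix the sum from the left, so its image
  -- consists of invariants.
  by_cases hm0 : m = 0
  -- If K = 0, the symmetric form would be a multiple of the alternating area form, hence zero.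
  · have hKne : ∃ x, K x ≠ 0 := by
      by_contra! h
      have hq : ∀ x y, c * area x y = -(2⁻¹ * Q.form x y) := fun x y => by
        have := congrArg (Q.form · y) (h x)
        simp only [hK, map_add, map_smul, LinearMap.add_apply, LinearMap.smul_apply, smul_eq_mul,
          hJ, map_zero, LinearMap.zero_apply] at this
        linear_combination this
      have hf0 : ∀ x y, Q.form x y = 0 := fun x y => by
        have e1 := hq x y
        have e2 := hq y x
        rw [area_comm, Q.symm] at e2
        have h2' : (2 : F) * 2⁻¹ = 1 := mul_inv_cancel₀ h2
        linear_combination e1 + e2 - Q.form x y * h2'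
      have := congrFun (Q.nondeg 1 (hf0 1)) 0
      simp at this
    obtain ⟨x, hx⟩ := hKne
    have hll : Q.form (K x) (K x) = 0 := by rw [hKK, hm0, zero_mul]
    refine mem_specAgree_of_invariant hψ hk
      (sum_heisOp_commute hψ (fun p => ψ (c * area p.1 p.2)) fun g p => by rw [area_slAct])
      fun g f => ?_
    refine oscG_eq_of_isotropic hψ hx hll (fun a b => ?_) g
    rw [← Module.End.mul_apply, hLm]
    congr 1
    refine Finset.sum_congr rfl fun p _ => ?_
    congr 2
    have e : ∀ a : F, c • J (a • K x) - (2⁻¹ : F) • a • K x = 0 := fun a => by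
      rw [map_smul, smul_comm c, smul_comm (2⁻¹ : F), ← smul_sub, hKm, hm0]
      simp
    rw [e, e]
    have : area (a • K x) (b • K x) = 0 := by simp [area]; ring
    rw [this]
    simp
  · let L : (Fin 2 → F) →ₗ[F] (Fin 2 → F) := (-m⁻¹) • (K ∘ₗ K)
    have hLa : ∀ x, L x = (-m⁻¹) • K (K x) := fun x => rfl
    have hL : ∀ x y, Q.form (L x) (L y) = Q.form x y := fun x y => by
      simp only [hLa, map_smul, LinearMap.smul_apply, smul_eq_mul, hKK]
      field_simp
    obtain ⟨d, hd⟩ := exists_eq_smul_oscO hψ (mkIsometry L hL) (M := ∑ p : (Fin 2 → F) ×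
      (Fin 2 → F), ψ (c * area p.1 p.2) • Q.heisOp ψ p.1 p.2) fun x y => by
        rw [hR, hLm, mkIsometry_apply, mkIsometry_apply]
        refine Finset.sum_congr rfl fun p _ => ?_
        have e : ∀ x, c • J (L x) - (2⁻¹ : F) • L x = c • J x + (2⁻¹ : F) • x := fun x => by
          rw [hLa, map_smul, smul_comm c, smul_comm (2⁻¹ : F), ← smul_sub, hKm, smul_smul,
            neg_mul_neg, inv_mul_cancel₀ hm0, one_smul, hK]
        -- L is an isometry that commutes with J, and the area is β(J x, y).
        have e' : area (L x) (L y) = area x y := by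
          have hJL : ∀ x, J (L x) = L (J x) := fun x => by
            simp only [hLa, hK, map_smul, map_add]
          rw [← hJ, hJL, hL, hJ]
        rw [e, e, e']
    rw [hd]
    exact Submodule.smul_mem _ d (oscO_mem_specAgree hψ k _)

/-- The sum of the Heisenberg operators over the pairs of vectors of given area. -/
lemma sum_area_eq_mem [Fintype F] [DecidableEq F] {k : ℕ} (hk : 0 < k) (d : F) :
    ∑ p : (Fin 2 → F) × (Fin 2 → F) with area p.1 p.2 = d, Q.heisOp ψ p.1 p.2 ∈
      specAgree Q hψ k := by
  -- Fourier inversion in the area variable.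
  have key : (Fintype.card F : ℂ) • (∑ p : (Fin 2 → F) × (Fin 2 → F) with area p.1 p.2 = d,
      Q.heisOp ψ p.1 p.2) = ∑ c : F, ψ (-(c * d)) • ∑ p : (Fin 2 → F) × (Fin 2 → F),
        ψ (c * area p.1 p.2) • Q.heisOp ψ p.1 p.2 := by
    simp only [Finset.smul_sum, smul_smul, ← AddChar.map_add_eq_mul]
    rw [Finset.sum_comm, Finset.sum_filter]
    refine Finset.sum_congr rfl fun p _ => ?_
    rw [← Finset.sum_smul]
    have e : ∀ c, -(c * d) + c * area p.1 p.2 = c * (area p.1 p.2 - d) := fun c => by ring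
    simp only [e]
    have hp : ψ.IsPrimitive := AddChar.IsPrimitive.of_ne_one hψ
    rw [AddChar.sum_mulShift _ hp]
    by_cases h : area p.1 p.2 = d
    · simp [h]
    · simp [h, sub_ne_zero]
  have hc : (Fintype.card F : ℂ) ≠ 0 := by exact_mod_cast Fintype.card_ne_zero
  rw [← inv_smul_smul₀ hc (∑ p with _, _), key]
  exact Submodule.smul_mem _ _ (Submodule.sum_mem _ fun c _ =>
    Submodule.smul_mem _ _ (sum_area_mem hψ hk c))

/-- A pair of area zero spans at most a line, isotropic or not; for non-zero area the orbit is the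
full level set of the area. -/
lemma sum_slAct_mem_plane [Fintype (SpecialLinearGroup (Fin 2) F)] {k : ℕ} (hk : 0 < k)
    (p : (Fin 2 → F) × (Fin 2 → F)) :
    ∑ g : SpecialLinearGroup (Fin 2) F, Q.heisOp ψ (slAct g p).1 (slAct g p).2 ∈
      specAgree Q hψ k := by
  classical
  have := Fintype.ofFinite F
  by_cases h : area p.1 p.2 = 0
  · obtain ⟨z, hz, v, rfl⟩ : ∃ z : Fin 2 → F, z ≠ 0 ∧ ∃ v : F × F, p = (v.1 • z, v.2 • z) := by
      by_cases h1 : p.1 = 0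
      · by_cases h2 : p.2 = 0
        · exact ⟨1, one_ne_zero, 0, by ext <;> simp [h1, h2]⟩
        · exact ⟨p.2, h2, (0, 1), by ext <;> simp [h1]⟩
      · obtain ⟨a, ha⟩ := exists_smul_of_area h1 h
        exact ⟨p.1, h1, (1, a), by ext <;> simp [ha]⟩
    refine sum_slAct_mem_of_line hψ k ?_ v
    by_cases hzz : Q.form z z = 0
    · exact sum_line_mem_of_isotropic hψ hk hz hzz
    · exact sum_line_mem_of_anisotropic hψ k hzz
  · have h' := card_smul_sum_orbit (G := SpecialLinearGroup (Fin 2) F)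
      (slAct (F := F) (U := Fin 2 → F)) slAct_mul slAct_one
      (Finset.univ.filter fun p' => area p'.1 p'.2 = area p.1 p.2) (fun g y hy => by
        simp only [Finset.mem_filter, Finset.mem_univ, true_and] at hy ⊢
        rw [area_slAct, hy]) p (fun y hy => exists_slAct_eq_of_area h (by simpa using hy))
      fun p => Q.heisOp ψ p.1 p.2
    rw [← Nat.cast_smul_eq_nsmul ℂ, ← Nat.cast_smul_eq_nsmul ℂ] at h'
    have hc : ((Finset.univ.filter fun p' : (Fin 2 → F) × (Fin 2 → F) =>
        area p'.1 p'.2 = area p.1 p.2).card : ℂ) ≠ 0 := by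
      rw [Nat.cast_ne_zero]
      exact Finset.card_ne_zero_of_mem (a := p) (by simp)
    rw [← inv_smul_smul₀ hc (∑ g, _), h']
    exact Submodule.smul_mem _ _ (Submodule.smul_mem _ _ (sum_area_eq_mem hψ hk _))

end Plane

/-- On the `k`-spectrum, every operator that commutes with `SL₂` is a combination of operators of
`O_β`. -/
theorem exists_span_oscO_of_commute {F : Type u} [Field F] [NeZero (2 : F)] [Finite F]
    {ψ : AddChar F ℂ} (hψ : ψ ≠ 1) {k : ℕ} (hk : k ≤ 2) (Q : QuadSpace F (Fin k → F))
    {A : Module.End ℂ ((Fin k → F) → ℂ)} (hA : ∀ g, A * Q.oscG hψ g = Q.oscG hψ g * A) :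
    A ∈ specAgree Q hψ k := by
  classical
  have := Fintype.ofFinite F
  refine mem_of_commute hψ _ (fun p => ?_) hA
  interval_cases k
  -- For k = 0 the only Heisenberg operator is the identity.
  · have := sum_slAct_mem_of_line hψ 0 (Q := Q) (z := 0) (by
      simp only [smul_zero, heisOp_zero]
      exact Submodule.sum_mem _ fun _ _ => one_mem_specAgree hψ 0) 0
    convert this using 1
    refine Finset.sum_congr rfl fun g _ => ?_
    congr 1 <;> exact Subsingleton.elim _ _
  -- For k = 1 all of U is one line, anisotropic since the form is non-degenerate.
  · have h1 : ∀ x : Fin 1 → F, x = x 0 • 1 := fun x => by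
      ext i; fin_cases i; simp
    have := sum_slAct_mem_of_line hψ 1 (Q := Q) (z := 1) (sum_line_mem_of_anisotropic hψ 1
      fun h => one_ne_zero (Q.nondeg 1 fun y => by rw [h1 y, map_smul, h, smul_zero]))
      (p.1 0, p.2 0)
    simp only [← h1] at this
    exact this
  · exact sum_slAct_mem_plane hψ two_pos p

/-! ### Double commutants -/

lemma map_rep {G M N : Type*} [Group G] [AddCommMonoid M] [Module ℂ M] [AddCommMonoid N]
    [Module ℂ N] {ρ : Representation ℂ G M} {σ : Representation ℂ G N} (φ : IntertwiningMap ρ σ)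
    (g : G) (m : M) : φ (ρ g m) = σ g (φ m) :=
  LinearMap.congr_fun (φ.isIntertwining' g) m

lemma intertwining_asAlgebraHom {G M N : Type*} [Group G] [AddCommMonoid M] [Module ℂ M]
    [AddCommMonoid N] [Module ℂ N] {ρ : Representation ℂ G M} {σ : Representation ℂ G N}
    (φ : IntertwiningMap ρ σ) (r : MonoidAlgebra ℂ G) (m : M) :
    φ (ρ.asAlgebraHom r m) = σ.asAlgebraHom r (φ m) := by
  induction r using MonoidAlgebra.induction_linear with
  | zero => simp
  | add x y hx hy => simp [hx, hy]
  | single g a => simp [map_rep]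

lemma mem_centralizer_adjoin_iff {A : Type*} [Semiring A] [Algebra ℂ A] {s : Set A} {z : A} :
    z ∈ Subalgebra.centralizer ℂ (Algebra.adjoin ℂ s : Set A) ↔ ∀ g ∈ s, g * z = z * g := by
  refine ⟨fun h g hg => h g (Algebra.subset_adjoin hg), fun h => ?_⟩
  have : Algebra.adjoin ℂ s ≤ Subalgebra.centralizer ℂ {z} :=
    Algebra.adjoin_le fun g hg => by
      rintro _ rfl
      exact (h g hg).symm
  exact fun g hg => (this hg z rfl).symm

section Maschke

variable {G : Type*} [Group G] {M N : Type*} [AddCommGroup M] [Module ℂ M] [AddCommGroup N]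
  [Module ℂ N]

/-- Maschke's theorem: an injective intertwining map has an equivariant retraction. -/
lemma exists_retraction [Finite G] {ρ : Representation ℂ G M} {σ : Representation ℂ G N}
    (φ : IntertwiningMap ρ σ) (hφ : Function.Injective φ) :
    ∃ π : IntertwiningMap σ ρ, ∀ m, π (φ m) = m := by
  have : NeZero (Nat.card G : ℂ) := ⟨by simp [Nat.card_pos.ne']⟩
  obtain ⟨g, hg⟩ := MonoidAlgebra.exists_leftInverse_of_injective
    (IntertwiningMap.equivLinearMapAsModule ρ σ φ) (LinearMap.ker_eq_bot.2 hφ)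
  exact ⟨(IntertwiningMap.equivLinearMapAsModule σ ρ).symm g, fun m => LinearMap.congr_fun hg m⟩

lemma mem_adjoin_range_iff (ρ : Representation ℂ G M) (A : Module.End ℂ M) :
    A ∈ Algebra.adjoin ℂ (Set.range ρ) ↔ ∃ r, ρ.asAlgebraHom r = A := by
  suffices h : Algebra.adjoin ℂ (Set.range ρ) = ρ.asAlgebraHom.range by rw [h]; rfl
  refine le_antisymm (Algebra.adjoin_le ?_) ?_
  · rintro _ ⟨g, rfl⟩
    exact ⟨MonoidAlgebra.of ℂ G g, ρ.asAlgebraHom_of g⟩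
  · rintro _ ⟨r, rfl⟩
    change ρ.asAlgebraHom r ∈ _
    induction r using MonoidAlgebra.induction_linear with
    | zero => rw [map_zero]; exact zero_mem _
    | add x y hx hy => rw [map_add]; exact add_mem hx hy
    | single g a =>
      rw [Representation.asAlgebraHom_single]
      exact Subalgebra.smul_mem _ (Algebra.subset_adjoin (Set.mem_range_self g)) a

/-- The double commutant theorem for a representation of a finite group. -/
lemma mem_adjoin_of_forall_commute [Finite G] [FiniteDimensional ℂ M] (ρ : Representation ℂ G M)
    (C : Module.End ℂ M)
    (hC : ∀ A : Module.End ℂ M, (∀ g, A * ρ g = ρ g * A) → C * A = A * C) :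
    C ∈ Algebra.adjoin ℂ (Set.range ρ) := by
  classical
  have : NeZero (Nat.card G : ℂ) := ⟨by simp [Nat.card_pos.ne']⟩
  have hC' : ∀ (A : Module.End (MonoidAlgebra ℂ G) ρ.asModule) (m : M), C (A m) = A (C m) := by
    intro A m
    let φ : IntertwiningMap ρ ρ := (IntertwiningMap.equivLinearMapAsModule ρ ρ).symm A
    exact LinearMap.congr_fun (hC φ.toLinearMap fun g => φ.isIntertwining' g) m
  -- By hypothesis C is linear over the commutant. Jacobson's density theorem, which needs
  -- semisimplicity from Maschke's theorem, matches it with a group algebra element on a finite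
  -- basis, hence everywhere.
  let f : Module.End (Module.End (MonoidAlgebra ℂ G) ρ.asModule) ρ.asModule :=
    { toFun := fun m => C m
      map_add' := fun x y => C.map_add x y
      map_smul' := fun A m => hC' A m }
  let b := Module.finBasis ℂ M
  let s : Finset ρ.asModule := Finset.univ.image fun i => (b i : M)
  obtain ⟨r, hr⟩ := jacobson_density f s
  rw [mem_adjoin_range_iff]
  refine ⟨r, b.ext fun i => ?_⟩
  exact (hr (b i) (Finset.mem_image_of_mem _ (Finset.mem_univ i))).symm

lemma asAlgebraHom_mem {M : Type*} [AddCommMonoid M] [Module ℂ M] {ρ : Representation ℂ G M}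
    (S : Submodule ℂ M) (hS : ∀ g, ∀ m ∈ S, ρ g m ∈ S) (r : MonoidAlgebra ℂ G) {m : M}
    (hm : m ∈ S) :
    ρ.asAlgebraHom r m ∈ S := by
  induction r using MonoidAlgebra.induction_linear with
  | zero => simp
  | add x y hx hy => simpa using add_mem hx hy
  | single g a => simpa using S.smul_mem a (hS g m hm)

lemma isIrreducible_of_equiv {ρ : Representation ℂ G M} {σ : Representation ℂ G N}
    (e : ρ.Equiv σ) (h : ρ.IsIrreducible) : σ.IsIrreducible := by
  refine isIrreducible_of_forall ?_ fun S hS n hn hn0 => ?_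
  · obtain ⟨m, hm⟩ := exists_ne_zero_of_isIrreducible h
    exact ⟨e m, fun h0 => hm (by simpa using congrArg e.symm h0)⟩
  · refine (Submodule.eq_top_iff'.2) fun n' => ?_
    have := mem_of_isIrreducible h (S.comap e.toLinearEquiv.toLinearMap) (fun g m hm => by
      have := map_rep e.toIntertwiningMap g m
      simp only [Submodule.mem_comap] at hm ⊢
      have h1 := hS g _ hm
      exact this ▸ h1) (m := e.symm n) (by
        change e (e.symm n) ∈ S
        rwa [e.apply_symm_apply]) (fun h0 => hn0 (by
          rw [← e.apply_symm_apply n, h0, map_zero])) (e.symm n')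
    rw [← e.apply_symm_apply n']
    exact this

/-- A non-zero finite-dimensional representation has an irreducible subrepresentation. -/
lemma exists_irreducible_sub [FiniteDimensional ℂ M] (ρ : Representation ℂ G M) {m : M}
    (hm : m ≠ 0) : ∃ (n : ℕ) (τ : Representation ℂ G (Fin n → ℂ)) (f : IntertwiningMap τ ρ),
      τ.IsIrreducible ∧ Function.Injective f := by
  -- A non-zero subrepresentation of least dimension is irreducible. It is transported to ℂⁿ so that
  -- its space lies in `Type`, as `QuadSpace.InEtaImage` demands.
  have hne : ∃ n, ∃ S : Subrepresentation ρ, S.toSubmodule ≠ ⊥ ∧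
      Module.finrank ℂ S.toSubmodule = n :=
    ⟨_, ⊤, fun h => hm ((Submodule.mem_bot ℂ).1 (h ▸ Submodule.mem_top)), rfl⟩
  classical
  obtain ⟨S, hS, hn⟩ := Nat.find_spec hne
  let e : S.toSubmodule ≃ₗ[ℂ] (Fin (Module.finrank ℂ S.toSubmodule) → ℂ) :=
    (Module.finBasis ℂ S.toSubmodule).equivFun
  let τ : Representation ℂ G (Fin (Module.finrank ℂ S.toSubmodule) → ℂ) :=
    { toFun := fun o => e.conj (S.toRepresentation o)
      map_one' := by rw [map_one]; exact LinearEquiv.conj_id e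
      map_mul' := fun o o' => by rw [map_mul]; exact LinearEquiv.conj_comp e _ _ }
  have hτe : ∀ o t, e.symm (τ o t) = S.toRepresentation o (e.symm t) := fun o t => by
    simp [τ, LinearEquiv.conj_apply]
  refine ⟨_, τ, ⟨S.toSubmodule.subtype ∘ₗ e.symm.toLinearMap, fun g => LinearMap.ext fun t =>
    congrArg Subtype.val (hτe g t)⟩, isIrreducible_of_equiv (.mk e fun o =>
      LinearMap.ext fun s => by
        change e _ = e (S.toRepresentation o (e.symm (e s)))
        rw [e.symm_apply_apply]) ?_, Subtype.val_injective.comp e.symm.injective⟩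
  refine isIrreducible_of_forall ?_ fun S' hS' x hx hx0 => ?_
  · obtain ⟨x, hx, hx0⟩ := Submodule.exists_mem_ne_zero_of_ne_bot hS
    exact ⟨⟨x, hx⟩, fun h => hx0 (congrArg Subtype.val h)⟩
  · let S'' : Subrepresentation ρ := ⟨S'.map S.toSubmodule.subtype, by
      rintro g _ ⟨y, hy, rfl⟩
      exact ⟨S.toRepresentation g y, hS' g y hy, rfl⟩⟩
    have hmin := Nat.find_min' hne ⟨S'', fun h => hx0 ?_, rfl⟩
    · rw [← hn] at hmin
      have e : Module.finrank ℂ S''.toSubmodule = Module.finrank ℂ S' :=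
        Submodule.finrank_map_subtype_eq _ _
      rw [e] at hmin
      exact Submodule.eq_top_of_finrank_eq (le_antisymm (Submodule.finrank_le _) hmin)
    · have : (x : M) ∈ S''.toSubmodule := ⟨x, hx, rfl⟩
      rw [h, Submodule.mem_bot] at this
      exact Subtype.ext this

lemma Occurs.trans {P : Type*} [AddCommGroup P] [Module ℂ P] {ρ : Representation ℂ G M}
    {σ : Representation ℂ G N} {κ : Representation ℂ G P} (h : Occurs ρ σ) (h' : Occurs σ κ) :
    Occurs ρ κ := by
  obtain ⟨f, hf⟩ := h
  obtain ⟨f', hf'⟩ := h'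
  exact ⟨f'.comp f, hf'.comp hf⟩

lemma occurs_of_equiv {ρ : Representation ℂ G M} {σ : Representation ℂ G N} (e : ρ.Equiv σ) :
    Occurs ρ σ :=
  ⟨e.toIntertwiningMap, e.toLinearEquiv.injective⟩

end Maschke

/-! ### Tensor rank under embeddings and isomorphisms -/

section Rank

variable {F : Type u} [Field F] [Finite F] [NeZero (2 : F)]

lemma InFiltration.of_occurs {k : ℕ} {M N : Type*} [AddCommGroup M] [Module ℂ M] [AddCommGroup N]
    [Module ℂ N] {ρ : Representation ℂ (SpecialLinearGroup (Fin 2) F) M}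
    {σ : Representation ℂ (SpecialLinearGroup (Fin 2) F) N} (h : Occurs σ ρ)
    (hρ : InFiltration k ρ) : InFiltration k σ := by
  obtain ⟨l, hl, N', i1, i2, κ, hκ, ho⟩ := hρ
  exact ⟨l, hl, N', i1, i2, κ, hκ, h.trans ho⟩

lemma IsIrrepOfRank.of_equiv {k : ℕ} {M N : Type*} [AddCommGroup M] [Module ℂ M] [AddCommGroup N]
    [Module ℂ N] {ρ : Representation ℂ (SpecialLinearGroup (Fin 2) F) M}
    {σ : Representation ℂ (SpecialLinearGroup (Fin 2) F) N} (e : ρ.Equiv σ)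
    (h : IsIrrepOfRank k ρ) : IsIrrepOfRank k σ :=
  ⟨isIrreducible_of_equiv e h.1, h.2.1.of_occurs (occurs_of_equiv e.symm),
    fun j hj h' => h.2.2 j hj (h'.of_occurs (occurs_of_equiv e))⟩

end Rank

/-! ### The eta correspondence, given the commutant of `SL₂` -/

section Eta

variable {F : Type u} [Field F] [Finite F] [NeZero (2 : F)] {U : Type v} [AddCommGroup U]
  [Module F U] [Finite U] {Q : QuadSpace F U} {ψ : AddChar F ℂ} (hψ : ψ ≠ 1) {k : ℕ}

instance : Finite Q.O :=
  Finite.of_injective (fun o : Q.O => (o.1 : U → U)) fun _ _ h =>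
    Subtype.ext (LinearEquiv.ext (congrFun h))

/-- The inclusion of the `k`-spectrum. -/
def specIncl : IntertwiningMap (Q.specG hψ k) (Q.oscG hψ) where
  toLinearMap := (Q.spec hψ k).subtype
  isIntertwining' _ := rfl

lemma specO_commute_specG (o : Q.O) (g : SpecialLinearGroup (Fin 2) F) :
    Q.specO hψ k o * Q.specG hψ k g = Q.specG hψ k g * Q.specO hψ k o :=
  LinearMap.ext fun x => Subtype.ext (Q.oscO_oscG_comm hψ o g x.1)

lemma algO_le_centralizer :
    Q.algO hψ k ≤ Subalgebra.centralizer ℂ (Q.algG hψ k : Set (Module.End ℂ (Q.spec hψ k))) := by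
  refine Algebra.adjoin_le ?_
  rintro _ ⟨o, rfl⟩
  rw [SetLike.mem_coe, QuadSpace.algG, mem_centralizer_adjoin_iff]
  rintro _ ⟨g, rfl⟩
  exact (specO_commute_specG hψ o g).symm

variable (Q k) in
/-- On the `k`-spectrum every operator that commutes with `SL₂` agrees with an element of the
algebra generated by `O_β`. -/
def HasSpecCommutant : Prop :=
  ∀ A : Module.End ℂ (U → ℂ), (∀ g, A * Q.oscG hψ g = Q.oscG hψ g * A) → A ∈ specAgree Q hψ k

/-- An operator on the k-spectrum that commutes with `G` extends to ω by composition with an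
equivariant retraction, so the knowledge of the commutant on ω applies. -/
theorem centralizer_algG (hC : HasSpecCommutant Q hψ k) :
    Subalgebra.centralizer ℂ (Q.algG hψ k : Set (Module.End ℂ (Q.spec hψ k))) = Q.algO hψ k := by
  refine le_antisymm (fun A hA => ?_) (algO_le_centralizer hψ)
  obtain ⟨π, hπ⟩ := exists_retraction (specIncl (Q := Q) hψ (k := k)) Subtype.val_injective
  have hA' : ∀ g, A * Q.specG hψ k g = Q.specG hψ k g * A := fun g =>
    ((Subalgebra.mem_centralizer_iff ℂ).1 hA _ (Algebra.subset_adjoin ⟨g, rfl⟩)).symm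
  obtain ⟨a, ha, hAa⟩ := hC ((Q.spec hψ k).subtype ∘ₗ A ∘ₗ π.toLinearMap) fun g => by
    refine LinearMap.ext fun f => ?_
    have h1 : π (Q.oscG hψ g f) = Q.specG hψ k g (π f) := map_rep π g f
    have h2 : A (Q.specG hψ k g (π f)) = Q.specG hψ k g (A (π f)) :=
      LinearMap.congr_fun (hA' g) _
    change (A (π (Q.oscG hψ g f))).1 = (Q.specG hψ k g (A (π f))).1
    rw [h1, h2]
  have key : ∀ a ∈ Submodule.span ℂ (Set.range (Q.oscO hψ)),
      ∃ b ∈ Q.algO hψ k, ∀ x, (b x).1 = a x.1 := by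
    intro a ha
    induction ha using Submodule.span_induction with
    | mem a h =>
      obtain ⟨o, rfl⟩ := h
      exact ⟨Q.specO hψ k o, Algebra.subset_adjoin ⟨o, rfl⟩, fun x => rfl⟩
    | zero => exact ⟨0, zero_mem _, fun x => rfl⟩
    | add x y _ _ hx hy =>
      obtain ⟨b, hb, hb'⟩ := hx
      obtain ⟨c, hc, hc'⟩ := hy
      exact ⟨b + c, add_mem hb hc, fun x => by
        rw [LinearMap.add_apply, LinearMap.add_apply, Submodule.coe_add, hb', hc']⟩
    | smul t x _ hx =>
      obtain ⟨b, hb, hb'⟩ := hx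
      exact ⟨t • b, Subalgebra.smul_mem _ hb t, fun x => by
        rw [LinearMap.smul_apply, LinearMap.smul_apply, Submodule.coe_smul, hb']⟩
  obtain ⟨b, hb, hb'⟩ := key a ha
  have : A = b := by
    refine LinearMap.ext fun x => Subtype.ext ?_
    rw [hb', ← hAa _ x.2]
    change (A x).1 = (A (π (specIncl hψ x))).1
    rw [hπ]
  rwa [this]

/-- The commutant of `G` is generated by O_β, so an operator that commutes with O_β lies in the
double commutant of `G`, which is the image of its group algebra. -/
theorem mem_algG (hC : HasSpecCommutant Q hψ k)
    {A : Module.End ℂ (Q.spec hψ k)} (hA : ∀ o, A * Q.specO hψ k o =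
    Q.specO hψ k o * A) : A ∈ Q.algG hψ k := by
  refine mem_adjoin_of_forall_commute _ A fun B hB => ?_
  have hB' : B ∈ Q.algO hψ k := by
    rw [← centralizer_algG hψ hC, QuadSpace.algG, mem_centralizer_adjoin_iff]
    rintro _ ⟨g, rfl⟩
    exact (hB g).symm
  have hle : Q.algO hψ k ≤ Subalgebra.centralizer ℂ {A} := by
    refine Algebra.adjoin_le ?_
    rintro _ ⟨o, rfl⟩
    rw [SetLike.mem_coe, Subalgebra.mem_centralizer_iff]
    rintro _ rfl
    exact hA o
  exact (Subalgebra.mem_centralizer_iff ℂ).1 (hle hB') A rfl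

theorem centralizer_algO (hC : HasSpecCommutant Q hψ k) :
    Subalgebra.centralizer ℂ (Q.algO hψ k : Set (Module.End ℂ (Q.spec hψ k))) = Q.algG hψ k := by
  refine le_antisymm (fun A hA => mem_algG hψ hC fun o => ?_)
    ((Subalgebra.le_centralizer_iff _ _).1 (algO_le_centralizer hψ))
  exact ((Subalgebra.mem_centralizer_iff ℂ).1 hA _ (Algebra.subset_adjoin ⟨o, rfl⟩)).symm

variable {T : Type*} [AddCommGroup T] [Module ℂ T] {τ : Representation ℂ Q.O T}

/-- An element of `η(τ)` as an intertwining map. -/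
def etaMap (f : Q.etaSpace hψ k τ) : IntertwiningMap τ (Q.specO hψ k) where
  toLinearMap := f.1.codRestrict _ f.2.1
  isIntertwining' o := LinearMap.ext fun t => Subtype.ext (f.2.2 o t)

lemma etaMap_coe (f : Q.etaSpace hψ k τ) (t : T) : (etaMap hψ f t).1 = f.1 t := rfl

/-- An intertwining map as an element of `η(τ)`. -/
def ofEtaMap (φ : IntertwiningMap τ (Q.specO hψ k)) : Q.etaSpace hψ k τ :=
  ⟨(Q.spec hψ k).subtype ∘ₗ φ.toLinearMap, fun t => (φ t).2,
    fun o t => congrArg Subtype.val (map_rep φ o t)⟩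

lemma etaMap_injective (hτ : τ.IsIrreducible) {f : Q.etaSpace hψ k τ} (hf : f ≠ 0) :
    Function.Injective (etaMap hψ f) := by
  refine (Representation.IsIrreducible.injective_or_eq_zero (etaMap hψ f)).resolve_right
    fun h => hf (Subtype.ext (LinearMap.ext fun t => ?_))
  rw [← etaMap_coe, h]
  rfl

lemma eta_asAlgebraHom (r : MonoidAlgebra ℂ (SpecialLinearGroup (Fin 2) F))
    (f : Q.etaSpace hψ k τ) (t : T) :
    etaMap hψ ((Q.eta hψ k τ).asAlgebraHom r f) t =
      (Q.specG hψ k).asAlgebraHom r (etaMap hψ f t) := by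
  induction r using MonoidAlgebra.induction_linear with
  | zero => simp; rfl
  | add x y hx hy =>
    rw [map_add, map_add, LinearMap.add_apply, LinearMap.add_apply, ← hx, ← hy]
    rfl
  | single g a =>
    rw [Representation.asAlgebraHom_single, Representation.asAlgebraHom_single]
    rfl

lemma exists_ne_zero_of_occurs (hτ : τ.IsIrreducible) (ho : Occurs τ (Q.specO hψ k)) :
    ∃ f : Q.etaSpace hψ k τ, f ≠ 0 := by
  obtain ⟨φ, hφ⟩ := ho
  obtain ⟨t, ht⟩ := exists_ne_zero_of_isIrreducible hτ
  refine ⟨ofEtaMap hψ φ, fun h => ht (hφ (Subtype.ext ?_))⟩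
  have h1 : (φ t).1 = 0 := LinearMap.congr_fun (congrArg Subtype.val h) t
  rw [map_zero, h1]
  rfl

/-- Evaluation at a vector of `τ`. -/
def etaEval (t : T) : IntertwiningMap (Q.eta hψ k τ) (Q.oscG hψ) where
  toLinearMap := LinearMap.applyₗ t ∘ₗ (Q.etaSpace hψ k τ).subtype
  isIntertwining' _ := rfl

lemma etaEval_injective (hτ : τ.IsIrreducible) {t : T} (ht : t ≠ 0) :
    Function.Injective (etaEval (Q := Q) (τ := τ) hψ (k := k) t) := by
  refine (injective_iff_map_eq_zero _).2 fun f hf => ?_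
  by_contra h0
  refine ht (etaMap_injective hψ hτ h0 (Subtype.ext ?_))
  rw [map_zero]
  exact hf

/-- An irreducible representation inside the `k`-spectrum has rank `k`. -/
lemma isIrrepOfRank_of_injective {M : Type*} [AddCommGroup M] [Module ℂ M]
    {ρ : Representation ℂ (SpecialLinearGroup (Fin 2) F) M} (hρ : ρ.IsIrreducible)
    (φ : IntertwiningMap ρ (Q.oscG hψ)) (hφ : Function.Injective φ)
    (hs : ∀ m, φ m ∈ Q.spec hψ k) : IsIrrepOfRank k ρ := by
  obtain ⟨π, hπ⟩ := exists_retraction φ hφ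
  obtain ⟨m, hm⟩ := exists_ne_zero_of_isIrreducible hρ
  by_contra hcon
  -- If ρ did not have rank k, then by Schur's lemma the retraction onto ρ would kill every
  -- generator of the k-spectrum, hence ρ itself.
  have hle : Q.spec hψ k ≤ LinearMap.ker π.toLinearMap := by
    refine sSup_le ?_
    rintro S ⟨M', i1, i2, ρ', f, hρ', rfl⟩
    have := hρ'.1
    rcases Representation.IsIrreducible.bijective_or_eq_zero (π.comp f) with h | h
    · exact absurd (hρ'.of_equiv ((π.comp f).ofBijective h)) hcon
    · rintro _ ⟨x, rfl⟩
      exact congrArg (fun χ : IntertwiningMap ρ' ρ => χ x) h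
  refine hm ?_
  rw [← hπ m]
  exact hle (hs m)

/-- The transition operator between elements of multiplicity spaces comes from the group algebra
of `SL₂`. -/
lemma exists_asAlgebraHom (hC : HasSpecCommutant Q hψ k) (hτ : τ.IsIrreducible)
    {f : Q.etaSpace hψ k τ} (hf : f ≠ 0) :
    ∃ π : IntertwiningMap (Q.specO hψ k) τ, (∀ t, π (etaMap hψ f t) = t) ∧
      ∀ f' : Q.etaSpace hψ k τ, ∃ r,
        (Q.specG hψ k).asAlgebraHom r = (etaMap hψ f').toLinearMap ∘ₗ π.toLinearMap := by
  obtain ⟨π, hπ⟩ := exists_retraction (etaMap hψ f) (etaMap_injective hψ hτ hf)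
  refine ⟨π, hπ, fun f' => ?_⟩
  rw [← mem_adjoin_range_iff]
  refine mem_algG hψ hC fun o => ?_
  exact ((etaMap hψ f').comp π).isIntertwining' o

/-- Every non-zero f in η(τ) is cyclic: with a retraction π of f, the operator f' ∘ π commutes with
O_β, so it is given by some r in the group algebra, and r f = f' ∘ π ∘ f = f'. Evaluation at a
vector of τ embeds η(τ) into the k-spectrum, which gives the rank. -/
theorem eta_isIrrepOfRank (hC : HasSpecCommutant Q hψ k) (hτ : τ.IsIrreducible)
    (ho : Occurs τ (Q.specO hψ k)) :
    IsIrrepOfRank (M := Q.etaSpace hψ k τ) k (Q.eta hψ k τ) := by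
  have hirr : Representation.IsIrreducible (V := Q.etaSpace hψ k τ) (Q.eta hψ k τ) := by
    refine isIrreducible_of_forall (exists_ne_zero_of_occurs hψ hτ ho) fun S hS f hf hf0 => ?_
    obtain ⟨π, hπ, hr⟩ := exists_asAlgebraHom hψ hC hτ hf0
    refine Submodule.eq_top_iff'.2 fun f' => ?_
    obtain ⟨r, hr⟩ := hr f'
    have : (Q.eta hψ k τ).asAlgebraHom r f = f' := by
      refine Subtype.ext (LinearMap.ext fun t => ?_)
      rw [← etaMap_coe hψ, ← etaMap_coe hψ, eta_asAlgebraHom, hr]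
      change (etaMap hψ f' (π (etaMap hψ f t))).1 = _
      rw [hπ]
    rw [← this]
    exact asAlgebraHom_mem S hS r hf
  obtain ⟨t, ht⟩ := exists_ne_zero_of_isIrreducible hτ
  exact isIrrepOfRank_of_injective hψ hirr (etaEval hψ t) (etaEval_injective hψ hτ ht)
    fun f => f.2.1 t

/-- The projection f ∘ π onto a copy of τ comes from some r in the group algebra with r f = f,
whence r (e f) = e f. Were π ∘ (e f) zero, then e f = r (e f) = f ∘ π ∘ (e f) would vanish too. So π
∘ (e f) is a non-zero map from τ' to τ, and Schur's lemma applies. -/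
theorem nonempty_equiv_of_eta_equiv (hC : HasSpecCommutant Q hψ k) {T' : Type*}
    [AddCommGroup T'] [Module ℂ T'] {τ' : Representation ℂ Q.O T'} (hτ : τ.IsIrreducible) (hτ' : τ'.IsIrreducible)
    (ho : Occurs τ (Q.specO hψ k)) (e : (Q.eta hψ k τ).Equiv (Q.eta hψ k τ')) :
    Nonempty (τ.Equiv τ') := by
  obtain ⟨f, hf⟩ := exists_ne_zero_of_occurs hψ hτ ho
  obtain ⟨π, hπ, hr⟩ := exists_asAlgebraHom hψ hC hτ hf
  obtain ⟨r, hr⟩ := hr f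
  have h1 : (Q.eta hψ k τ).asAlgebraHom r f = f := by
    refine Subtype.ext (LinearMap.ext fun t => ?_)
    rw [← etaMap_coe hψ, ← etaMap_coe hψ, eta_asAlgebraHom, hr]
    change (etaMap hψ f (π (etaMap hψ f t))).1 = _
    rw [hπ]
  have h2 := intertwining_asAlgebraHom e.toIntertwiningMap r f
  rw [h1] at h2
  rcases Representation.IsIrreducible.bijective_or_eq_zero (π.comp (etaMap hψ (e f))) with h | h
  · exact ⟨((π.comp (etaMap hψ (e f))).ofBijective h).symm⟩
  · exfalso
    have h0 : e f = 0 := by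
      refine Subtype.ext (LinearMap.ext fun t => ?_)
      have h2' : e f = (Q.eta hψ k τ').asAlgebraHom r (e f) := h2
      rw [h2', ← etaMap_coe hψ, eta_asAlgebraHom, hr]
      have h3 : π (etaMap hψ (e f) t) = 0 :=
        congrArg (fun χ : IntertwiningMap τ' τ => χ t) h
      change (etaMap hψ f (π (etaMap hψ (e f) t))).1 = _
      rw [h3, map_zero]
      rfl
    exact hf (by rw [← e.symm_apply_apply f, h0, map_zero])

/-- Isomorphic representations of `O_β` have isomorphic images. -/
def etaCongr {T' : Type*} [AddCommGroup T'] [Module ℂ T'] {τ' : Representation ℂ Q.O T'}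
    (e : τ.Equiv τ') : (Q.eta hψ k τ).Equiv (Q.eta hψ k τ') :=
  have hs : ∀ o t, e.symm (τ' o t) = τ o (e.symm t) := fun o t =>
    map_rep e.symm.toIntertwiningMap o t
  have he : ∀ o t, e (τ o t) = τ' o (e t) := fun o t => map_rep e.toIntertwiningMap o t
  .mk
    { toFun := fun f => ⟨f.1 ∘ₗ e.symm.toLinearMap, fun t => f.2.1 _, fun o t => by
        change f.1 (e.symm (τ' o t)) = Q.oscO hψ o (f.1 (e.symm t))
        rw [hs, f.2.2]⟩
      invFun := fun f => ⟨f.1 ∘ₗ e.toLinearMap, fun t => f.2.1 _, fun o t => by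
        change f.1 (e (τ o t)) = Q.oscO hψ o (f.1 (e t))
        rw [he, f.2.2]⟩
      map_add' := fun f f' => rfl
      map_smul' := fun c f => rfl
      left_inv := fun f => Subtype.ext (LinearMap.ext fun t =>
        congrArg f.1 (e.symm_apply_apply t))
      right_inv := fun f => Subtype.ext (LinearMap.ext fun t =>
        congrArg f.1 (e.apply_symm_apply t)) }
    fun g => rfl

lemma occurs_specO_of_ne_zero (hτ : τ.IsIrreducible) {f : Q.etaSpace hψ k τ} (hf : f ≠ 0) :
    Occurs τ (Q.specO hψ k) :=
  ⟨etaMap hψ f, etaMap_injective hψ hτ hf⟩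

/-- The action of `O_β` on the space of `SL₂`-homomorphisms to the oscillator representation. -/
def homRep {M : Type*} [AddCommGroup M] [Module ℂ M]
    (ρ : Representation ℂ (SpecialLinearGroup (Fin 2) F) M) :
    Representation ℂ Q.O (IntertwiningMap ρ (Q.oscG hψ)) where
  toFun o :=
    { toFun := fun h => ⟨Q.oscO hψ o ∘ₗ h.toLinearMap, fun g => LinearMap.ext fun m => by
        change Q.oscO hψ o (h (ρ g m)) = Q.oscG hψ g (Q.oscO hψ o (h m))
        rw [h.isIntertwining, Q.oscO_oscG_comm]⟩
      map_add' := fun h h' => IntertwiningMap.ext (LinearMap.comp_add _ _ _)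
      map_smul' := fun c h => IntertwiningMap.ext (LinearMap.comp_smul _ _ _) }
  map_one' := LinearMap.ext fun h => IntertwiningMap.ext (LinearMap.ext fun m => by
    change Q.oscO hψ 1 (h m) = h m
    rw [map_one]; rfl)
  map_mul' o o' := LinearMap.ext fun h => IntertwiningMap.ext (LinearMap.ext fun m => by
    change Q.oscO hψ (o * o') (h m) = Q.oscO hψ o (Q.oscO hψ o' (h m))
    rw [map_mul]; rfl)

lemma finiteDimensional_of_occurs {M : Type*} [AddCommGroup M] [Module ℂ M]
    {ρ : Representation ℂ (SpecialLinearGroup (Fin 2) F) M} (h : Occurs ρ (Q.oscG hψ)) :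
    FiniteDimensional ℂ M :=
  h.elim fun f hf => Module.Finite.of_injective f.toLinearMap hf

/-- O_β acts on Hom_G(ρ, ω), which is non-zero. For an irreducible τ inside it, evaluation gives a
non-zero map from ρ to η(τ), and both sides are irreducible. -/
theorem inEtaImage_of_occurs
    (hC : HasSpecCommutant Q hψ k)
    {M : Type} [AddCommGroup M] [Module ℂ M]
    {ρ : Representation ℂ (SpecialLinearGroup (Fin 2) F) M} (hρ : IsIrrepOfRank k ρ)
    (ho : Occurs ρ (Q.oscG hψ)) : Q.InEtaImage hψ k ρ := by
  have := finiteDimensional_of_occurs hψ ho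
  have := hρ.1
  obtain ⟨φ, hφ⟩ := ho
  have hspec : ∀ (h : IntertwiningMap ρ (Q.oscG hψ)) m, h m ∈ Q.spec hψ k := fun h m =>
    (le_sSup ⟨M, _, _, ρ, h, hρ, rfl⟩ : LinearMap.range h.toLinearMap ≤ Q.spec hψ k) ⟨m, rfl⟩
  obtain ⟨m₀, hm₀⟩ := exists_ne_zero_of_isIrreducible hρ.1
  have hφ0 : φ ≠ 0 := fun h => hm₀ (hφ (by rw [h]; rfl))
  obtain ⟨n, τ, f, hτ, hf⟩ := exists_irreducible_sub (homRep hψ ρ) hφ0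
  let ev : IntertwiningMap ρ (Q.eta hψ k τ) :=
    { toFun := fun m => ⟨{
          toFun := fun t => f t m
          map_add' := fun t t' => by rw [map_add]; rfl
          map_smul' := fun c t => by rw [map_smul]; rfl },
        fun t => hspec _ m, fun o t =>
          congrArg (fun h : IntertwiningMap ρ (Q.oscG hψ) => h m) (map_rep f o t)⟩
      map_add' := fun m m' => Subtype.ext (LinearMap.ext fun t => map_add (f t) m m')
      map_smul' := fun c m => Subtype.ext (LinearMap.ext fun t => map_smul (f t) c m)
      isIntertwining' := fun g => LinearMap.ext fun m => Subtype.ext (LinearMap.ext fun t =>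
        map_rep (f t) g m) }
  have hev : ev ≠ 0 := by
    obtain ⟨s, hs⟩ := exists_ne_zero_of_isIrreducible hτ
    intro h0
    refine hs (hf ?_)
    rw [map_zero]
    refine IntertwiningMap.ext (LinearMap.ext fun m => ?_)
    exact congrArg (fun χ : IntertwiningMap ρ (Q.eta hψ k τ) => (χ m).1 s) h0
  obtain ⟨m, hm⟩ : ∃ m, ev m ≠ 0 := by
    by_contra! h
    exact hev (IntertwiningMap.ext (LinearMap.ext h))
  have := (eta_isIrrepOfRank hψ hC hτ (occurs_specO_of_ne_zero hψ hτ hm)).1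
  have hb := (Representation.IsIrreducible.bijective_or_eq_zero
    (W := Q.etaSpace hψ k τ) ev).resolve_right hev
  exact ⟨hρ.1, _, _, _, τ, hτ, ⟨(ev.ofBijective hb).symm⟩⟩

theorem isIrrepOfRank_of_inEtaImage
    (hC : HasSpecCommutant Q hψ k)
    {M : Type*} [AddCommGroup M] [Module ℂ M]
    {ρ : Representation ℂ (SpecialLinearGroup (Fin 2) F) M} (h : Q.InEtaImage hψ k ρ) :
    IsIrrepOfRank k ρ := by
  obtain ⟨hρ, T, _, _, τ, hτ, ⟨e⟩⟩ := h
  obtain ⟨m, hm⟩ := exists_ne_zero_of_isIrreducible hρ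
  have hf : e.symm m ≠ 0 := fun h0 => hm (by rw [← e.apply_symm_apply m, h0, map_zero])
  exact (eta_isIrrepOfRank hψ hC hτ (occurs_specO_of_ne_zero hψ hτ hf)).of_equiv e

end Eta

/-! ### A dimension bound for representations of `SL₂` without invariants -/

section Bound

lemma sum_eq_zero_add_units {F : Type*} [Field F] [Fintype F] [Fintype Fˣ] {M : Type*}
    [AddCommMonoid M] (f : F → M) : ∑ t, f t = f 0 + ∑ t : Fˣ, f t := by
  classical
  rw [Fintype.sum_eq_add_sum_subtype_ne f 0]
  congr 1
  exact (Fintype.sum_equiv unitsEquivNeZero _ _ fun t => rfl).symm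

variable {F : Type u} [Field F] {M : Type v} [AddCommGroup M] [Module ℂ M]
  (σ : Representation ℂ (SpecialLinearGroup (Fin 2) F) M)

/-- The vectors fixed by the upper unipotent matrices. -/
def fixedUpper : Submodule ℂ M where
  carrier := {v | ∀ t, σ (upper t) v = v}
  add_mem' {v w} hv hw t := by rw [map_add, hv t, hw t]
  zero_mem' t := map_zero _
  smul_mem' c v hv t := by rw [map_smul, hv t]

/-- The vectors fixed by the upper triangular matrices. -/
def fixedBorel : Submodule ℂ M where
  carrier := {v | (∀ t, σ (upper t) v = v) ∧ ∀ t, σ (torus t) v = v}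
  add_mem' {v w} hv hw := ⟨fun t => by rw [map_add, hv.1 t, hw.1 t],
    fun t => by rw [map_add, hv.2 t, hw.2 t]⟩
  zero_mem' := ⟨fun t => map_zero _, fun t => map_zero _⟩
  smul_mem' c v hv := ⟨fun t => by rw [map_smul, hv.1 t], fun t => by rw [map_smul, hv.2 t]⟩

variable {σ}

/-- The sum of the translates of a vector fixed by the upper triangular matrices is invariant. -/
lemma sum_translates_invariant [Fintype F] {v : M} (hN : ∀ t, σ (upper t) v = v)
    (hT : ∀ t, σ (torus t) v = v) (g : SpecialLinearGroup (Fin 2) F) :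
    σ g (v + ∑ t : F, σ (upper t) (σ weyl v)) = v + ∑ t : F, σ (upper t) (σ weyl v) := by
  classical
  set w := v + ∑ t : F, σ (upper t) (σ weyl v) with hw
  have hm : ∀ g h x, σ g (σ h x) = σ (g * h) x := fun g h x => by rw [map_mul]; rfl
  let S : Subgroup (SpecialLinearGroup (Fin 2) F) :=
    { carrier := {g | σ g w = w}
      mul_mem' := fun {a b} ha hb => by
        change σ (a * b) w = w
        change σ a w = w at ha
        change σ b w = w at hb
        rw [← hm, hb, ha]
      one_mem' := by simp
      inv_mem' := fun {a} ha => by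
        change σ a⁻¹ w = w
        change σ a w = w at ha
        conv_lhs => rw [← ha]
        rw [hm, inv_mul_cancel, map_one]; rfl }
  have hS : S = ⊤ := by
    refine weyl_generates S (fun x => ?_) ?_
    · change σ (upper x) w = w
      rw [hw, map_add, hN, map_sum]
      congr 1
      refine Fintype.sum_equiv (Equiv.addLeft x) _ _ fun t => ?_
      rw [hm, upper_mul, Equiv.coe_addLeft]
    · change σ weyl w = w
      -- The Weyl element exchanges v with the term at t = 0, and permutes the other terms by t ↦
      -- -t⁻¹.
      have h1 : ∑ t : Fˣ, σ weyl (σ (upper (t : F)) (σ weyl v)) =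
          ∑ t : Fˣ, σ (upper (t : F)) (σ weyl v) := by
        refine Fintype.sum_equiv ((Equiv.inv Fˣ).trans (Equiv.neg Fˣ)) _ _ fun t => ?_
        rw [hm, hm, weyl_mul_upper_mul_weyl, ← hm, ← hm, ← hm, hN, hT]
        simp
      rw [hw, map_add, map_sum,
        sum_eq_zero_add_units (fun t : F => σ weyl (σ (upper t) (σ weyl v))),
        sum_eq_zero_add_units (fun t : F => σ (upper t) (σ weyl v)), h1, upper_zero, map_one,
        Module.End.one_apply, hm weyl weyl, weyl_mul_weyl, hT]
      abel
  have : g ∈ S := hS ▸ Subgroup.mem_top g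
  exact this

variable [Fintype F] [DecidableEq F] (σ)

/-- The projection to the vectors fixed by the upper unipotent matrices. -/
def projUpper : Module.End ℂ M := (Fintype.card F : ℂ)⁻¹ • ∑ t : F, σ (upper t)

/-- The projection to the vectors fixed by the torus. -/
def projTorus : Module.End ℂ M := (Fintype.card Fˣ : ℂ)⁻¹ • ∑ t : Fˣ, σ (torus t)

lemma upper_mul_projUpper (t : F) : σ (upper t) * projUpper σ = projUpper σ := by
  rw [projUpper, mul_smul_comm, Finset.mul_sum]
  congr 1
  exact Fintype.sum_equiv (Equiv.addLeft t) _ _ fun x => by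
    rw [← map_mul, upper_mul, Equiv.coe_addLeft]

lemma projUpper_mul_upper (t : F) : projUpper σ * σ (upper t) = projUpper σ := by
  rw [projUpper, smul_mul_assoc, Finset.sum_mul]
  congr 1
  exact Fintype.sum_equiv (Equiv.addRight t) _ _ fun x => by
    rw [← map_mul, upper_mul, Equiv.coe_addRight]

lemma torus_mul_projTorus (t : Fˣ) : σ (torus t) * projTorus σ = projTorus σ := by
  rw [projTorus, mul_smul_comm, Finset.mul_sum]
  congr 1
  exact Fintype.sum_equiv (Equiv.mulLeft t) _ _ fun x => by
    rw [← map_mul, torus_mul, Equiv.coe_mulLeft]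

lemma projTorus_mul_torus (t : Fˣ) : projTorus σ * σ (torus t) = projTorus σ := by
  rw [projTorus, smul_mul_assoc, Finset.sum_mul]
  congr 1
  exact Fintype.sum_equiv (Equiv.mulRight t) _ _ fun x => by
    rw [← map_mul, torus_mul, Equiv.coe_mulRight]

lemma torus_mul_projUpper (t : Fˣ) : σ (torus t) * projUpper σ = projUpper σ * σ (torus t) := by
  rw [projUpper, mul_smul_comm, smul_mul_assoc, Finset.sum_mul, Finset.mul_sum]
  congr 1
  refine Fintype.sum_equiv ((Units.mulLeft (t * t))) _ _ fun x => ?_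
  rw [← map_mul, ← map_mul, torus_mul_upper]
  simp

lemma projTorus_mul_projUpper : projTorus σ * projUpper σ = projUpper σ * projTorus σ := by
  rw [projTorus, smul_mul_assoc, mul_smul_comm, Finset.sum_mul, Finset.mul_sum]
  simp only [torus_mul_projUpper]

lemma weyl_mul_projTorus : σ weyl * projTorus σ = projTorus σ * σ weyl := by
  rw [projTorus, smul_mul_assoc, mul_smul_comm, Finset.sum_mul, Finset.mul_sum]
  congr 1
  refine Fintype.sum_equiv (Equiv.inv Fˣ) _ _ fun x => ?_
  rw [← map_mul, ← map_mul, weyl_mul_torus, Equiv.inv_apply]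

lemma projUpper_apply {v : M} (hv : v ∈ fixedUpper σ) : projUpper σ v = v := by
  rw [projUpper, LinearMap.smul_apply, LinearMap.sum_apply]
  simp only [hv _, Finset.sum_const, Finset.card_univ]
  rw [← Nat.cast_smul_eq_nsmul ℂ, inv_smul_smul₀ (by exact_mod_cast Fintype.card_ne_zero)]

lemma projTorus_apply {v : M} (hv : ∀ t, σ (torus t) v = v) : projTorus σ v = v := by
  rw [projTorus, LinearMap.smul_apply, LinearMap.sum_apply]
  simp only [hv _, Finset.sum_const, Finset.card_univ]
  rw [← Nat.cast_smul_eq_nsmul ℂ, inv_smul_smul₀ (by exact_mod_cast Fintype.card_ne_zero)]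

lemma isProj_projUpper : LinearMap.IsProj (fixedUpper σ) (projUpper σ) :=
  ⟨fun v t => LinearMap.congr_fun (upper_mul_projUpper σ t) v, fun _ hv => projUpper_apply σ hv⟩

lemma isProj_projBorel : LinearMap.IsProj (fixedBorel σ) (projUpper σ * projTorus σ) := by
  refine ⟨fun v => ⟨fun t => ?_, fun t => ?_⟩, fun v hv => ?_⟩
  · rw [← Module.End.mul_apply, ← mul_assoc, upper_mul_projUpper]
  · rw [← Module.End.mul_apply, ← mul_assoc, torus_mul_projUpper, mul_assoc, torus_mul_projTorus]
  · rw [Module.End.mul_apply, projTorus_apply σ hv.2, projUpper_apply σ hv.1]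

/-- A representation of `SL₂` without invariants has large dimension. -/
theorem finrank_bound [FiniteDimensional ℂ M] (h0 : ∀ v, (∀ g, σ g v = v) → v = 0) :
    (Fintype.card F + 1) * Module.finrank ℂ (fixedUpper σ) +
      (Fintype.card F - 1) * Module.finrank ℂ (fixedBorel σ) ≤ 2 * Module.finrank ℂ M := by
  -- The idea is to build a `G`-equivariant idempotent P that fixes every N-fixed vector, where N is
  -- the group of upper unipotents and B the upper triangular group. P is a sum over G/B of
  -- conjugates of one element E of the algebra of N- and torus averages. Twice its trace is the
  -- left-hand side, and its rank is at most dim M.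
  obtain ⟨q, hq⟩ : ∃ q : ℂ, q = (Fintype.card F : ℂ) := ⟨_, rfl⟩
  have hq0 : q ≠ 0 := by rw [hq]; exact_mod_cast Fintype.card_ne_zero
  have hq1 : q + 1 ≠ 0 := by rw [hq]; exact_mod_cast Nat.succ_ne_zero (Fintype.card F)
  have hcard : (Fintype.card Fˣ : ℂ) = q - 1 := by
    have h1 : 1 ≤ Fintype.card F := Fintype.card_pos
    rw [Fintype.card_units, Nat.cast_sub h1, hq, Nat.cast_one]
  have hcard0 : q - 1 ≠ 0 := by rw [← hcard]; exact_mod_cast Fintype.card_ne_zero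
  set e := projUpper σ with he
  set p := projTorus σ with hp
  set S := σ weyl with hS
  set b := e * p with hb
  set Z := σ (torus (-1)) with hZ
  have hee : e * e = e := (isProj_projUpper σ).isIdempotentElem
  have hbb : b * b = b := (isProj_projBorel σ).isIdempotentElem
  have hpe : p * e = b := projTorus_mul_projUpper σ
  have heb : e * b = b := by rw [hb, ← mul_assoc, hee]
  have hbe : b * e = b := by rw [hb, mul_assoc, hpe, heb]
  have hSp : S * p = p * S := weyl_mul_projTorus σ
  have hSS : S * S = Z := by rw [hS, hZ, ← map_mul, weyl_mul_weyl]
  have hZZ : Z * Z = 1 := by rw [hZ, ← map_mul, torus_mul]; simp [torus_one]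
  have hZe : Z * e = e * Z := torus_mul_projUpper σ _
  have hpZ : p * Z = p := projTorus_mul_torus σ _
  have hSZ : S * Z = Z * S := by rw [← hSS, mul_assoc]
  have hsum : ∑ t : F, σ (upper t) = q • e := by
    rw [he, projUpper, ← hq, smul_inv_smul₀ hq0]
  have hsumT : ∑ t : Fˣ, σ (torus t) = (q - 1) • p := by
    rw [hp, projTorus, hcard, smul_inv_smul₀ hcard0]
  have hSinv : σ weyl⁻¹ = S * Z := by
    have h1 : S * (S * Z) = 1 := by rw [← mul_assoc, hSS, hZZ]
    have h2 : σ weyl⁻¹ * S = 1 := by rw [hS, ← map_mul, inv_mul_cancel, map_one]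
    calc σ weyl⁻¹ = σ weyl⁻¹ * (S * (S * Z)) := by rw [h1, mul_one]
      _ = S * Z := by rw [← mul_assoc, h2, one_mul]
  -- the translates of a vector fixed by the triangular matrices sum up to zero
  have h1 : e * (S * b) = (-q⁻¹) • b := by
    refine LinearMap.ext fun v => ?_
    have hv := (isProj_projBorel σ).map_mem v
    have := h0 _ fun g => sum_translates_invariant hv.1 hv.2 g
    have h2 : b v + (q • e) (S (b v)) = 0 := by
      rw [← hsum, LinearMap.sum_apply]
      exact this
    change e (S (b v)) = (-q⁻¹) • b v
    rw [LinearMap.smul_apply] at h2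
    rw [← inv_smul_smul₀ hq0 (e (S (b v))), ← neg_eq_of_add_eq_zero_right h2, smul_neg, neg_smul]
  -- This is e S e S⁻¹ e, as S Z = S⁻¹. The term t = 0 of the middle average gives e; for t ≠ 0 the
  -- Bruhat relation moves the unipotents outwards and leaves the sum over the torus, that is `b` by
  -- way of `h1`.
  have h2 : e * (S * (e * (S * (Z * e)))) = q⁻¹ • (e - ((q - 1) / q) • b) := by
    have h3 : e * (S * (q • e) * S) * e = Z * e + (q - 1) • (e * (S * b)) := by
      rw [← hsum, Finset.mul_sum, Finset.sum_mul, sum_eq_zero_add_units, mul_add, add_mul,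
        upper_zero, map_one, mul_one, hSS, ← hZe, mul_assoc Z, hee, ← hpe, ← mul_smul_comm,
        ← mul_smul_comm, ← smul_mul_assoc, ← hsumT]
      congr 1
      simp only [Finset.mul_sum, Finset.sum_mul]
      refine Finset.sum_congr rfl fun t _ => ?_
      have h4 : S * σ (upper (t : F)) * S = σ (upper (-(t⁻¹ : Fˣ) : F)) * S * σ (torus t) *
          σ (upper (-(t⁻¹ : Fˣ) : F)) := by
        rw [hS, ← map_mul, ← map_mul, weyl_mul_upper_mul_weyl, map_mul, map_mul, map_mul]
      rw [h4]
      simp only [mul_assoc]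
      rw [upper_mul_projUpper, ← mul_assoc e, projUpper_mul_upper]
    calc e * (S * (e * (S * (Z * e)))) = q⁻¹ • (e * (S * (q • e) * S) * e * Z) := by
          simp only [mul_smul_comm, smul_mul_assoc, mul_assoc, inv_smul_smul₀ hq0, hZe]
      _ = q⁻¹ • (e - ((q - 1) / q) • b) := by
          rw [h3, h1, hZe, add_mul, mul_assoc, hZZ, mul_one, smul_mul_assoc, smul_mul_assoc, hb,
            mul_assoc e p, hpZ]
          congr 1
          rw [smul_smul, sub_eq_add_neg e, ← neg_smul]
          congr 2
          ring
  have h3 : e * (S * (b * (S * (Z * e)))) = (q⁻¹ * q⁻¹) • b := by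
    have h4 : b * (S * (Z * e)) = (-q⁻¹) • b := by
      rw [← h1, hb, hZe, ← hZe, ← mul_assoc S, hSZ, mul_assoc, mul_assoc, ← mul_assoc p Z, hpZ,
        ← mul_assoc p, ← hSp, mul_assoc, hpe, hb]
    calc e * (S * (b * (S * (Z * e)))) = e * (S * b) * (b * (S * (Z * e))) := by
          simp only [mul_assoc]
          rw [← mul_assoc b b, hbb]
      _ = (q⁻¹ * q⁻¹) • b := by
          rw [h1, h4, smul_mul_smul_comm, hbb, neg_mul_neg]
  -- the idempotent
  set κ : ℂ := (q - 1) / (q + 1) with hκ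
  set E : Module.End ℂ M := (2⁻¹ : ℂ) • (e + κ • b) with hE
  have hEe : E * e = E := by rw [hE, smul_mul_assoc, add_mul, hee, smul_mul_assoc, hbe]
  have hEN : ∀ t, σ (upper t) * E = E := fun t => by
    rw [hE, mul_smul_comm, mul_add, mul_smul_comm, hb, ← mul_assoc, upper_mul_projUpper]
  have hNE : ∀ t, E * σ (upper t) = E := fun t => by
    rw [← hEe, mul_assoc, projUpper_mul_upper]
  have hET : ∀ t, σ (torus t) * E = E * σ (torus t) := fun t => by
    rw [hE, mul_smul_comm, mul_add, mul_smul_comm, smul_mul_assoc, add_mul, smul_mul_assoc, hb,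
      ← mul_assoc, torus_mul_projUpper, mul_assoc, torus_mul_projTorus, mul_assoc,
      projTorus_mul_torus]
  let P : Module.End ℂ M := E + ∑ t : F, σ (upper t) * (S * E * σ weyl⁻¹) * σ (upper t)⁻¹
  have hPcomm : ∀ g, σ g * P = P * σ g := by
    intro g
    have hupper : ∀ t : F, (upper t)⁻¹ = upper (-t) := fun t => by
      refine inv_eq_of_mul_eq_one_right ?_
      rw [upper_mul, add_neg_cancel, upper_zero]
    have htorus : ∀ t : Fˣ, (torus t)⁻¹ = torus t⁻¹ := fun t => by
      refine inv_eq_of_mul_eq_one_right ?_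
      rw [torus_mul, mul_inv_cancel, torus_one]
    -- P is the sum of the translates of E in the representation on End(M), where E is fixed by the
    -- triangular matrices.
    have := sum_translates_invariant (σ := Representation.linHom σ σ) (v := E) (fun t => by
        rw [Representation.linHom_apply, hupper]
        change σ (upper t) * (E * σ (upper (-t))) = E
        rw [hNE, hEN]) (fun t => by
        rw [Representation.linHom_apply, htorus]
        change σ (torus t) * (E * σ (torus t⁻¹)) = E
        rw [← mul_assoc, hET, mul_assoc, ← map_mul, torus_mul, mul_inv_cancel, torus_one, map_one,
          mul_one]) g
    have h5 : σ g * (P * σ g⁻¹) = P := by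
      have hP : P = E + ∑ t : F, Representation.linHom σ σ (upper t)
          (Representation.linHom σ σ weyl E) := by
        simp only [P, Representation.linHom_apply, mul_assoc]
        rfl
      rw [hP]
      exact this
    calc σ g * P = σ g * (P * σ g⁻¹) * σ g := by
          rw [mul_assoc, mul_assoc, ← map_mul, inv_mul_cancel, map_one, mul_one]
      _ = P * σ g := by rw [h5]
  have hPe : P * e = e := by
    have h5 : ∀ t : F, σ (upper t) * (S * E * σ weyl⁻¹) * σ (upper t)⁻¹ * e =
        σ (upper t) * (S * E * σ weyl⁻¹ * e) := fun t => by
      have h6 : σ (upper t)⁻¹ * e = e := by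
        conv_lhs => rw [he, ← upper_mul_projUpper σ t]
        rw [← mul_assoc, ← map_mul, inv_mul_cancel, map_one, one_mul]
      rw [mul_assoc, h6, mul_assoc]
    have h6 : q • (e * (S * E * σ weyl⁻¹ * e)) =
        (2⁻¹ : ℂ) • (q • (e * (S * (e * (S * (Z * e))))) +
          (q * κ) • (e * (S * (b * (S * (Z * e)))))) := by
      rw [hE, hSinv]
      simp only [mul_smul_comm, smul_mul_assoc, mul_add, add_mul, mul_assoc, smul_add, smul_smul]
      congr 2 <;> ring
    change (E + ∑ t : F, _) * e = e
    rw [add_mul, Finset.sum_mul]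
    simp only [h5]
    rw [← Finset.sum_mul, hsum, smul_mul_assoc q, h6, h2, h3, hEe, hE, hκ]
    simp only [smul_sub, smul_add, smul_smul]
    have h8 : (2⁻¹ : ℂ) * (q * q⁻¹) = 2⁻¹ := by rw [mul_inv_cancel₀ hq0, mul_one]
    rw [h8]
    have h9 : (2⁻¹ : ℂ) • e + (2⁻¹ * ((q - 1) / (q + 1))) • b +
        ((2⁻¹ : ℂ) • e - (2⁻¹ * (q * (q⁻¹ * ((q - 1) / q)))) • b +
          (2⁻¹ * (q * ((q - 1) / (q + 1)) * (q⁻¹ * q⁻¹))) • b) = e +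
        (2⁻¹ * ((q - 1) / (q + 1)) - 2⁻¹ * (q * (q⁻¹ * ((q - 1) / q))) +
          2⁻¹ * (q * ((q - 1) / (q + 1)) * (q⁻¹ * q⁻¹))) • b := by module
    have h10 : 2⁻¹ * ((q - 1) / (q + 1)) - 2⁻¹ * (q * (q⁻¹ * ((q - 1) / q))) +
          2⁻¹ * (q * ((q - 1) / (q + 1)) * (q⁻¹ * q⁻¹)) = 0 := by
      field_simp
      ring
    rw [h9, h10, zero_smul, add_zero]
  have hPE : P * E = E := by
    rw [hE, mul_smul_comm, mul_add, mul_smul_comm, hPe, hb, ← mul_assoc, hPe]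
  -- P commutes with `G` and fixes E, so it fixes each conjugate of E and hence their sum.
  have hPP : IsIdempotentElem P := by
    change P * (E + ∑ t : F, _) = E + ∑ t : F, _
    rw [mul_add, hPE, Finset.mul_sum]
    congr 1
    refine Finset.sum_congr rfl fun t _ => ?_
    rw [← mul_assoc, ← mul_assoc, ← hPcomm, mul_assoc (σ (upper t)), ← mul_assoc P,
      ← mul_assoc P, ← hPcomm, mul_assoc S, hPE]
  have htr : LinearMap.trace ℂ M P = (q + 1) * LinearMap.trace ℂ M E := by
    have h5 : ∀ t : F, LinearMap.trace ℂ M (σ (upper t) * (S * E * σ weyl⁻¹) * σ (upper t)⁻¹) =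
        LinearMap.trace ℂ M E := fun t => by
      rw [LinearMap.trace_mul_comm, ← mul_assoc, ← map_mul, inv_mul_cancel, map_one, one_mul,
        LinearMap.trace_mul_comm, ← mul_assoc, hS, ← map_mul, inv_mul_cancel, map_one, one_mul]
    change LinearMap.trace ℂ M (E + ∑ t : F, _) = _
    rw [map_add, map_sum]
    simp only [h5]
    rw [Finset.sum_const, Finset.card_univ, nsmul_eq_mul, ← hq]
    ring
  have htrE : LinearMap.trace ℂ M E = 2⁻¹ * (Module.finrank ℂ (fixedUpper σ) +
      κ * Module.finrank ℂ (fixedBorel σ)) := by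
    rw [hE, map_smul, map_add, map_smul, (isProj_projUpper σ).trace, (isProj_projBorel σ).trace]
    rfl
  have hfin : ((Fintype.card F + 1) * Module.finrank ℂ (fixedUpper σ) +
      (Fintype.card F - 1 : ℕ) * Module.finrank ℂ (fixedBorel σ) : ℕ) =
      2 * Module.finrank ℂ (LinearMap.range P) := by
    have h5 := (LinearMap.IsIdempotentElem.isProj_range P hPP).trace
    rw [htr, htrE, hκ] at h5
    have hc : ((Fintype.card F - 1 : ℕ) : ℂ) = q - 1 := by
      rw [← hcard, Fintype.card_units]
    rw [← Nat.cast_inj (R := ℂ)]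
    push_cast
    rw [hc, ← hq, ← h5]
    field_simp
  rw [hfin]
  exact Nat.mul_le_mul_left 2 (Submodule.finrank_le _)

end Bound

/-! ### The representations of dimension `(q ± 1) / 2` -/

/-! ### Square classes in a finite field -/

section Squares

variable {F : Type u} [Field F] [Finite F]

lemma ringChar_ne_two (F : Type u) [Field F] [NeZero (2 : F)] : ringChar F ≠ 2 := fun h => by
  have := ringChar.Nat.cast_ringChar (R := F)
  rw [h] at this
  exact NeZero.ne (2 : F) (by exact_mod_cast this)

/-- Modulo squares every unit is `1` or a given non-square. -/
lemma eq_sq_or_eq_mul_sq {ε : Fˣ} (hε : ¬ IsSquare ε) (c : Fˣ) :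
    ∃ s : Fˣ, c = s * s ∨ c = ε * (s * s) := by
  classical
  have := Fintype.ofFinite F
  have key : ∀ c : Fˣ, IsSquare (c : F) → IsSquare c := by
    rintro c ⟨s, hs⟩
    have h0 : s ≠ 0 := fun h => c.ne_zero (by rw [hs, h, mul_zero])
    exact ⟨Units.mk0 s h0, Units.ext hs⟩
  by_cases hc : IsSquare c
  · obtain ⟨s, hs⟩ := hc
    exact ⟨s, Or.inl hs⟩
  · have h1 : IsSquare (c * ε) := by
      refine key _ ?_
      rw [← quadraticChar_one_iff_isSquare (Units.ne_zero _), Units.val_mul, map_mul,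
        quadraticChar_neg_one_iff_not_isSquare.2 fun h => hc (key _ h),
        quadraticChar_neg_one_iff_not_isSquare.2 fun h => hε (key _ h)]
      rfl
    obtain ⟨s, hs⟩ := h1
    refine ⟨s * ε⁻¹, Or.inr ?_⟩
    rw [← eq_mul_inv_iff_mul_eq] at hs
    rw [hs, mul_mul_mul_comm, ← mul_assoc, mul_comm ε, mul_assoc (s * s), mul_comm ε,
      mul_assoc ε⁻¹, inv_mul_cancel, mul_one]

/-- The sum of a function that is invariant under multiplication by squares. -/
lemma two_mul_sum_eq [Fintype F] [NeZero (2 : F)] {f : F → ℕ}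
    (hf : ∀ (s : Fˣ) c, f (s * s * c) = f c) {ε : Fˣ} (hε : ¬ IsSquare ε) :
    2 * ∑ c, f c = (Fintype.card F - 1) * (f 1 + f ε) + 2 * f 0 := by
  classical
  -- Off 0, f is a combination of 1 and the quadratic character, and the latter sums to zero.
  have h1 : ∀ c : F, 2 * (f c : ℤ) = (f 1 + f ε) + quadraticChar F c * (f 1 - f ε) +
      if c = 0 then 2 * (f 0 : ℤ) - (f 1 + f ε) else 0 := by
    intro c
    by_cases hc : c = 0
    · rw [hc, if_pos rfl, MulChar.map_zero]
      ring
    · rw [if_neg hc]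
      obtain ⟨s, hs | hs⟩ := eq_sq_or_eq_mul_sq hε (Units.mk0 c hc)
      · have h2 : c = s * s * 1 := by simpa using congrArg Units.val hs
        have h3 : quadraticChar F c = 1 :=
          (quadraticChar_one_iff_isSquare hc).2 ⟨s, by rw [h2, mul_one]⟩
        rw [h3, h2, hf]
        ring
      · have h2 : c = s * s * ε := by
          rw [mul_comm]
          simpa using congrArg Units.val hs
        have h3 : quadraticChar F c = -1 := by
          rw [quadraticChar_neg_one_iff_not_isSquare]
          rintro ⟨r, hr⟩
          have hr0 : r ≠ 0 := fun h => hc (by rw [hr, h, mul_zero])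
          refine hε ⟨Units.mk0 r hr0 * s⁻¹, Units.ext ?_⟩
          have : (ε : F) = (s : F)⁻¹ * (s : F)⁻¹ * c := by rw [h2]; field_simp
          rw [this, hr]
          push_cast
          rw [Units.val_mk0]
          ring
        rw [h3, h2, hf]
        ring
  have h2 : 2 * ∑ c, (f c : ℤ) = (Fintype.card F - 1) * (f 1 + f ε) + 2 * f 0 := by
    rw [Finset.mul_sum, Finset.sum_congr rfl fun c _ => h1 c, Finset.sum_add_distrib,
      Finset.sum_add_distrib, ← Finset.sum_mul, quadraticChar_sum_zero (ringChar_ne_two F),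
      Finset.sum_ite_eq' Finset.univ 0, if_pos (Finset.mem_univ _), Finset.sum_const,
      Finset.card_univ, nsmul_eq_mul]
    ring
  have h3 : 1 ≤ Fintype.card F := Fintype.card_pos
  zify [h3]
  exact h2

end Squares

/-! ### Weights of the upper unipotent group on the dual space -/

section Weights

variable {F : Type u} [Field F] {M : Type v} [AddCommGroup M] [Module ℂ M]
  (ρ : Representation ℂ (SpecialLinearGroup (Fin 2) F) M) (ψ : AddChar F ℂ)

/-- The functionals on which the upper unipotent matrices act by the character `t ↦ ψ (c t)`. -/
def weightSpace (c : F) : Submodule ℂ (Module.Dual ℂ M) where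
  carrier := {l | ∀ t m, l (ρ (upper t) m) = ψ (c * t) * l m}
  add_mem' {l l'} h h' t m := by rw [LinearMap.add_apply, h, h', LinearMap.add_apply, mul_add]
  zero_mem' t m := by simp
  smul_mem' a l h t m := by
    rw [LinearMap.smul_apply, h, LinearMap.smul_apply, smul_eq_mul, smul_eq_mul, mul_left_comm]

variable {ρ ψ}

/-- The torus rescales weights by squares, so the multiplicity of a weight depends only on its
square class. -/
lemma weightSpace_comp_torus {c : F} {l : Module.Dual ℂ M} (h : l ∈ weightSpace ρ ψ c) (s : Fˣ) :
    l ∘ₗ ρ (torus s) ∈ weightSpace ρ ψ (s * s * c) := fun t m => by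
  rw [LinearMap.comp_apply, ← Module.End.mul_apply, ← map_mul, torus_mul_upper, map_mul,
    Module.End.mul_apply, h, LinearMap.comp_apply]
  congr 2
  ring

lemma finrank_weightSpace_sq [FiniteDimensional ℂ M] (s : Fˣ) (c : F) :
    Module.finrank ℂ (weightSpace ρ ψ (s * s * c)) = Module.finrank ℂ (weightSpace ρ ψ c) := by
  have key : ∀ (s : Fˣ) (c : F), Module.finrank ℂ (weightSpace ρ ψ c) ≤
      Module.finrank ℂ (weightSpace ρ ψ (s * s * c)) := by
    intro s c
    let T : weightSpace ρ ψ c →ₗ[ℂ] weightSpace ρ ψ (s * s * c) :=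
      { toFun := fun l => ⟨l.1 ∘ₗ ρ (torus s), weightSpace_comp_torus l.2 s⟩
        map_add' := fun l l' => rfl
        map_smul' := fun a l => rfl }
    refine LinearMap.finrank_le_finrank_of_injective (f := T) fun l l' h => ?_
    refine Subtype.ext (LinearMap.ext fun m => ?_)
    have h1 := LinearMap.congr_fun (congrArg Subtype.val h) (ρ (torus s)⁻¹ m)
    change l.1 (ρ (torus s) (ρ (torus s)⁻¹ m)) = l'.1 (ρ (torus s) (ρ (torus s)⁻¹ m)) at h1
    rwa [← Module.End.mul_apply, ← map_mul, mul_inv_cancel, map_one] at h1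
  refine le_antisymm ?_ (key s c)
  refine (key s⁻¹ _).trans (le_of_eq ?_)
  rw [show (s⁻¹ : Fˣ) * (s⁻¹ : Fˣ) * (s * s * c) = c by push_cast; field_simp]

/-- If all weights are zero, then the representation is trivial. -/
lemma apply_eq_of_weightSpace_eq [FiniteDimensional ℂ M]
    (h : Module.finrank ℂ (weightSpace ρ ψ 0) = Module.finrank ℂ M)
    (g : SpecialLinearGroup (Fin 2) F) (m : M) : ρ g m = m := by
  have htop : weightSpace ρ ψ 0 = ⊤ :=
    Submodule.eq_top_of_finrank_eq (h.trans Subspace.dual_finrank_eq.symm)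
  have h1 : ∀ t, ρ (upper t) = 1 := fun t => LinearMap.ext fun m => by
    rw [← sub_eq_zero, ← Module.forall_dual_apply_eq_zero_iff ℂ]
    intro l
    have hl : l ∈ weightSpace ρ ψ 0 := htop ▸ Submodule.mem_top
    rw [map_sub, hl, zero_mul, AddChar.map_zero_eq_one, one_mul, Module.End.one_apply, sub_self]
  have h2 : (MonoidHom.ker ρ) = ⊤ := subgroup_eq_top _ (fun t => h1 t) fun t => by
    rw [MonoidHom.mem_ker, map_mul, map_mul, h1, mul_one, ← map_mul, mul_inv_cancel, map_one]
  have hg : g ∈ MonoidHom.ker ρ := h2 ▸ Subgroup.mem_top g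
  rw [MonoidHom.mem_ker.1 hg]
  rfl

variable [Fintype F] (ρ ψ)

/-- The projection to a weight space. -/
def weightProj (c : F) : Module.End ℂ (Module.Dual ℂ M) :=
  (Fintype.card F : ℂ)⁻¹ • ∑ t : F, ψ (-(c * t)) • (ρ (upper t)).dualMap

variable {ρ ψ}

lemma weightProj_apply (c : F) (l : Module.Dual ℂ M) (m : M) : weightProj ρ ψ c l m =
    (Fintype.card F : ℂ)⁻¹ * ∑ t : F, ψ (-(c * t)) * l (ρ (upper t) m) := by
  simp [weightProj, LinearMap.sum_apply]

lemma isProj_weightProj (c : F) : LinearMap.IsProj (weightSpace ρ ψ c) (weightProj ρ ψ c) := by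
  refine ⟨fun l s m => ?_, fun l hl => LinearMap.ext fun m => ?_⟩
  · rw [weightProj_apply, weightProj_apply, mul_left_comm (ψ (c * s)),
      Finset.mul_sum _ _ (ψ (c * s))]
    congr 1
    refine Fintype.sum_equiv (Equiv.addRight s) (fun t => ψ (-(c * t)) * l (ρ (upper t)
      (ρ (upper s) m))) (fun t => ψ (c * s) * (ψ (-(c * t)) * l (ρ (upper t) m))) fun t => ?_
    rw [← Module.End.mul_apply, ← map_mul, upper_mul, Equiv.coe_addRight, ← mul_assoc,
      ← AddChar.map_add_eq_mul]
    congr 2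
    ring
  · rw [weightProj_apply]
    have : ∀ t, ψ (-(c * t)) * l (ρ (upper t) m) = l m := fun t => by
      rw [hl, ← mul_assoc, ← AddChar.map_add_eq_mul, neg_add_cancel, AddChar.map_zero_eq_one,
        one_mul]
    simp only [this, Finset.sum_const, Finset.card_univ, nsmul_eq_mul]
    rw [inv_mul_cancel_left₀ (by exact_mod_cast Fintype.card_ne_zero)]

/-- Orthogonality of characters: summed over c, only the term t = 0 survives. -/
lemma sum_weightProj (hψ : ψ ≠ 1) : ∑ c, weightProj ρ ψ c = 1 := by
  classical
  refine LinearMap.ext fun l => LinearMap.ext fun m => ?_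
  rw [LinearMap.sum_apply, LinearMap.sum_apply]
  simp only [weightProj_apply]
  rw [← Finset.mul_sum, Finset.sum_comm]
  have h1 : ∀ t : F, ∑ c, ψ (-(c * t)) * l (ρ (upper t) m) =
      if t = 0 then (Fintype.card F : ℂ) * l m else 0 := fun t => by
    have h2 := AddChar.sum_mulShift (-t) (AddChar.IsPrimitive.of_ne_one hψ)
    rw [← Finset.sum_mul]
    simp only [mul_neg, neg_eq_zero] at h2
    rw [h2]
    split_ifs with h
    · rw [h, upper_zero, map_one]
      simp
    · simp
  simp only [h1]
  rw [Finset.sum_ite_eq' Finset.univ 0, if_pos (Finset.mem_univ _),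
    inv_mul_cancel_left₀ (by exact_mod_cast Fintype.card_ne_zero)]
  rfl

lemma sum_finrank_weightSpace [FiniteDimensional ℂ M] (hψ : ψ ≠ 1) :
    ∑ c, Module.finrank ℂ (weightSpace ρ ψ c) = Module.finrank ℂ M := by
  have h1 := congrArg (LinearMap.trace ℂ _) (sum_weightProj (ρ := ρ) hψ)
  rw [map_sum, LinearMap.trace_one, Subspace.dual_finrank_eq,
    Finset.sum_congr rfl fun c _ => (isProj_weightProj (ρ := ρ) (ψ := ψ) c).trace] at h1
  exact_mod_cast h1

/-- Each of the two square classes contains (q - 1)/2 non-zero weights. The factor ½ matches the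
characters by which unipotents act in the oscillator representation. -/
lemma two_mul_finrank_eq [NeZero (2 : F)] [FiniteDimensional ℂ M] (hψ : ψ ≠ 1) {ε : Fˣ}
    (hε : ¬ IsSquare ε) : 2 * Module.finrank ℂ M = (Fintype.card F - 1) *
      (Module.finrank ℂ (weightSpace ρ ψ (2⁻¹ * (1 : Fˣ))) +
        Module.finrank ℂ (weightSpace ρ ψ (2⁻¹ * ε))) +
      2 * Module.finrank ℂ (weightSpace ρ ψ 0) := by
  have h2 : (2 : F)⁻¹ ≠ 0 := inv_ne_zero (NeZero.ne _)
  have h := two_mul_sum_eq (f := fun c => Module.finrank ℂ (weightSpace ρ ψ (2⁻¹ * c)))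
    (fun s c => by
      rw [← finrank_weightSpace_sq s (2⁻¹ * c), mul_left_comm]) hε
  rw [mul_zero] at h
  rw [Units.val_one, ← h, ← sum_finrank_weightSpace (ρ := ρ) hψ]
  congr 1
  exact (Fintype.sum_equiv (Equiv.mulLeft₀ _ h2) _ _ fun c => rfl).symm

end Weights

/-! ### Locating the small irreps in the oscillator representations -/

section Half

variable {F : Type u} [Field F] [NeZero (2 : F)] {M : Type v} [AddCommGroup M] [Module ℂ M]
  {ρ : Representation ℂ (SpecialLinearGroup (Fin 2) F) M} {ψ : AddChar F ℂ} (hψ : ψ ≠ 1)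

/-- A family of functionals of the right weights is a homomorphism to the oscillator
representation over the unipotent group. -/
lemma pi_mem_fixedUpper [Finite F] {U : Type w} [AddCommGroup U] [Module F U] [Finite U]
    (Q : QuadSpace F U) {l : U → Module.Dual ℂ M}
    (hl : ∀ u, l u ∈ weightSpace ρ ψ (2⁻¹ * Q.form u u)) :
    LinearMap.pi l ∈ fixedUpper (Representation.linHom ρ (Q.oscG hψ)) := fun t => by
  refine LinearMap.ext fun m => funext fun u => ?_
  have h1 := hl u t (ρ (upper t)⁻¹ m)
  rw [← Module.End.mul_apply, ← map_mul, mul_inv_cancel, map_one, Module.End.one_apply] at h1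
  rw [Representation.linHom_apply, LinearMap.comp_apply, LinearMap.comp_apply, oscG_upper,
    LinearMap.pi_apply, LinearMap.pi_apply, h1]
  congr 2
  ring

/-- Unipotents act on ω diagonally at each point of U, so a choice of a functional of the right
weight at each point is an N-equivariant map. -/
lemma sum_finrank_le_finrank_fixedUpper [Finite F] [FiniteDimensional ℂ M] {U : Type w}
    [AddCommGroup U] [Module F U] [Fintype U] (Q : QuadSpace F U) :
    ∑ u, Module.finrank ℂ (weightSpace ρ ψ (2⁻¹ * Q.form u u)) ≤
      Module.finrank ℂ (fixedUpper (Representation.linHom ρ (Q.oscG hψ))) := by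
  rw [← Module.finrank_pi_fintype ℂ]
  let T : (∀ u, weightSpace ρ ψ (2⁻¹ * Q.form u u)) →ₗ[ℂ]
      fixedUpper (Representation.linHom ρ (Q.oscG hψ)) :=
    { toFun := fun l => ⟨LinearMap.pi fun u => (l u).1, pi_mem_fixedUpper hψ Q fun u => (l u).2⟩
      map_add' := fun l l' => rfl
      map_smul' := fun a l => rfl }
  refine LinearMap.finrank_le_finrank_of_injective (f := T) fun l l' h => ?_
  refine funext fun u => Subtype.ext (LinearMap.ext fun m => ?_)
  exact congrFun (LinearMap.congr_fun (congrArg Subtype.val h) m) u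

-- The torus element carries multiplication by the character of x to multiplication by the character
-- of s x. A non-zero diagonal entry at v would make the two characters agree at v for every x,
-- which fails for s ≠ 1.
open scoped Classical in
lemma oscG_torus_single [Finite F] {U : Type w} [AddCommGroup U] [Module F U] [Finite U]
    (Q : QuadSpace F U) {v : U} (hv : v ≠ 0) {s : Fˣ} (hs : s ≠ 1) :
    Q.oscG hψ (torus s) (Pi.single v 1) v = 0 := by
  have h0 : ((s : F) - 1) • v ≠ 0 := smul_ne_zero (sub_ne_zero.2 fun h => hs (Units.ext h)) hv
  obtain ⟨x, hx⟩ := exists_form_char_ne_one (Q := Q) hψ h0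
  have h1 : Q.heisOp ψ x 0 (Pi.single v 1) = ψ (-Q.form x v) • Pi.single v (1 : ℂ) := by
    refine funext fun u => ?_
    rw [heisOp_apply]
    by_cases hu : u = v
    · simp [hu]
    · simp [hu]
  have h2 := congrFun (LinearMap.congr_fun (oscG_heisOp (Q := Q) hψ (torus s) x 0)
    (Pi.single v 1)) v
  rw [Module.End.mul_apply, h1, map_smul, Module.End.mul_apply, heisOp_apply] at h2
  simp only [coe_torus, Matrix.of_apply, Matrix.cons_val_zero, Matrix.cons_val_one,
    Matrix.cons_val', Matrix.cons_val_fin_one, smul_zero, zero_smul, add_zero, map_zero,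
    mul_zero, sub_zero, Pi.smul_apply, smul_eq_mul, map_smul, LinearMap.smul_apply] at h2
  by_contra h3
  have h4 := mul_right_cancel₀ h3 h2
  refine hx ?_
  have h5 : Q.form (((s : F) - 1) • v) x = -(Q.form x v) - -(s * Q.form x v) := by
    rw [map_smul, LinearMap.smul_apply, smul_eq_mul, Q.symm v x]
    ring
  rw [h5, AddChar.map_sub_eq_div, h4, div_self]
  exact fun h0 => one_ne_zero (α := ℂ) (by
    rw [← AddChar.map_zero_eq_one ψ, ← neg_add_cancel (-(s * Q.form x v)),
      AddChar.map_add_eq_mul, h0, mul_zero])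

lemma fixedBorel_ne_bot [Fintype F] [DecidableEq F] {U : Type w} [AddCommGroup U] [Module F U]
    [Finite U] (Q : QuadSpace F U) {v : U} (hv : v ≠ 0) {l : Module.Dual ℂ M}
    (hl : l ∈ weightSpace ρ ψ (2⁻¹ * Q.form v v)) (hl0 : l ≠ 0) :
    fixedBorel (Representation.linHom ρ (Q.oscG hψ)) ≠ ⊥ := by
  classical
  set σ := Representation.linHom ρ (Q.oscG hψ) with hσ
  have h1 : LinearMap.pi (Pi.single v l) ∈ fixedUpper σ := by
    refine pi_mem_fixedUpper hψ Q fun u => ?_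
    by_cases hu : u = v
    · rw [hu, Pi.single_eq_same]; exact hl
    · rw [Pi.single_eq_of_ne hu]; exact zero_mem _
  have h2 := (isProj_projBorel σ).map_mem (LinearMap.pi (Pi.single v l))
  rw [← projTorus_mul_projUpper, Module.End.mul_apply, projUpper_apply σ h1] at h2
  intro hbot
  rw [hbot, Submodule.mem_bot] at h2
  refine hl0 (LinearMap.ext fun m => ?_)
  have h3 := congrFun (LinearMap.congr_fun h2 m) v
  have hpi : ∀ m, LinearMap.pi (Pi.single v l) m = l m • Pi.single v (1 : ℂ) := fun m => by
    refine funext fun u => ?_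
    rw [LinearMap.pi_apply]
    by_cases hu : u = v
    · simp [hu]
    · simp [hu]
  -- In the torus average of the map supported at v, only s = 1 contributes to the value at v, so
  -- the average does not vanish.
  have h4 : ∀ s : Fˣ, σ (torus s) (LinearMap.pi (Pi.single v l)) m v =
      if s = 1 then l m else 0 := by
    intro s
    rw [hσ, Representation.linHom_apply, LinearMap.comp_apply, LinearMap.comp_apply, hpi, map_smul,
      Pi.smul_apply]
    split_ifs with hs
    · simp [hs, torus_one]
    · rw [oscG_torus_single hψ Q hv hs, smul_zero]
  rw [projTorus, LinearMap.smul_apply, LinearMap.smul_apply, LinearMap.sum_apply,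
    LinearMap.sum_apply, Pi.smul_apply, Finset.sum_apply] at h3
  simp only [h4] at h3
  rw [Finset.sum_ite_eq' Finset.univ 1, if_pos (Finset.mem_univ _)] at h3
  exact (smul_eq_zero.1 h3).resolve_left (inv_ne_zero (by exact_mod_cast Fintype.card_ne_zero))

/-- An irreducible representation with a nonzero homomorphism to the oscillator representation
occurs in it. -/
lemma occurs_of_invariant {G : Type*} [Group G] {N : Type*} [AddCommGroup N] [Module ℂ N]
    {ρ : Representation ℂ G M} {ω : Representation ℂ G N} (hρ : ρ.IsIrreducible)
    (h : ¬ ∀ v, (∀ g, Representation.linHom ρ ω g v = v) → v = 0) : Occurs ρ ω := by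
  push Not at h
  obtain ⟨v, hv, h0⟩ := h
  let φ : IntertwiningMap ρ ω := ⟨v, fun g => by
    conv_lhs => rw [← hv g, Representation.linHom_apply]
    refine LinearMap.ext fun m => ?_
    rw [LinearMap.comp_apply, LinearMap.comp_apply, LinearMap.comp_apply, ← Module.End.mul_apply,
      ← map_mul, inv_mul_cancel, map_one]
    rfl⟩
  exact ⟨φ, (Representation.IsIrreducible.injective_or_eq_zero φ).resolve_right fun h =>
    h0 (congrArg IntertwiningMap.toLinearMap h)⟩

lemma sum_finrank_stdSpace_one [Fintype F] [FiniteDimensional ℂ M] (a : Fˣ) :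
    ∑ u, Module.finrank ℂ (weightSpace ρ ψ (2⁻¹ * (stdSpace a 1).form u u)) =
      Module.finrank ℂ (weightSpace ρ ψ 0) +
        (Fintype.card F - 1) * Module.finrank ℂ (weightSpace ρ ψ (2⁻¹ * a)) := by
  classical
  rw [Fintype.sum_equiv (Equiv.funUnique (Fin 1) F) _
    (fun x => Module.finrank ℂ (weightSpace ρ ψ (2⁻¹ * (a * (x * x))))) fun u => by
      rw [stdSpace_one]; rfl, sum_eq_zero_add_units]
  congr 1
  · rw [mul_zero, mul_zero, mul_zero]
  · rw [← Fintype.card_units, ← Finset.card_univ, ← smul_eq_mul, ← Finset.sum_const]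
    refine Finset.sum_congr rfl fun s _ => ?_
    rw [← finrank_weightSpace_sq s (2⁻¹ * a), mul_comm (a : F), mul_left_comm]

/-- Here e = dim ρ; A, B and z are the multiplicities of the weights ½, ε/2 and 0; d is the
multiplicity of the weight a/2 for the form a x²; n and b are the fixed dimensions in Hom(ρ, ω),
whose dimension is e q. If 2e = q + 1, the weight count forces z ≠ 0 because q ≠ 3, so n ≥ q and the
bound fails by q - 1. If 2e = q - 1, already n ≥ q - 1 is too large. -/
lemma not_le_of_dims {q e A B d z n b : ℕ} (hq : 1 < q) (h3 : q ≠ 3)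
    (hd : 2 * e = q + 1 ∨ 2 * e + 1 = q) (hsum : 2 * e = (q - 1) * (A + B) + 2 * z)
    (hpos : A ≠ 0 ∨ B ≠ 0) (ha : d ≠ 0) (hn : z + (q - 1) * d ≤ n) (hb : 1 ≤ b)
    (h : (q + 1) * n + (q - 1) * b ≤ 2 * (e * q)) : False := by
  obtain ⟨p, rfl⟩ : ∃ p, q = p + 1 := ⟨q - 1, by omega⟩
  rw [Nat.add_sub_cancel] at hsum hn h
  have h1 : p ≤ p * d := Nat.le_mul_of_pos_right p (by omega)
  rw [← mul_assoc] at h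
  rcases hd with hd | hd
  · have hz : z ≠ 0 := by
      rintro rfl
      rcases Nat.lt_or_ge (A + B) 2 with h2 | h2
      · have : A + B = 1 := by omega
        rw [this] at hsum
        omega
      · have := Nat.mul_le_mul_left p h2
        omega
    have h2 : (p + 1 + 1) * (p + 1) ≤ (p + 1 + 1) * n := Nat.mul_le_mul_left _ (by omega)
    have h4 : p ≤ p * b := Nat.le_mul_of_pos_right p hb
    rw [hd] at h
    omega
  · have h2 : (p + 1 + 1) * p ≤ (p + 1 + 1) * n := Nat.mul_le_mul_left _ (by omega)
    have h4 : 2 * e = p := by omega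
    rw [h4] at h
    have h5 : p ≤ p * b := Nat.le_mul_of_pos_right p hb
    nlinarith

/-- Some weight a/2 with a = 1 or a = ε appears in ρ, as otherwise ρ would be trivial and of
dimension 1, which needs q = 3. For this a, Hom(ρ, ω) must contain an invariant: otherwise its
N-fixed and B-fixed vectors are too many for `finrank_bound`. -/
theorem occurs_of_finrank [Finite F] {ε : Fˣ} (hε : ¬ IsSquare ε) (hρ : ρ.IsIrreducible)
    (hd : 2 * Module.finrank ℂ M = Nat.card F + 1 ∨ 2 * Module.finrank ℂ M + 1 = Nat.card F)
    (h3 : Nat.card F ≠ 3) :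
    Occurs ρ ((stdSpace 1 1).oscG hψ) ∨ Occurs ρ ((stdSpace ε 1).oscG hψ) := by
  classical
  have := Fintype.ofFinite F
  rw [Nat.card_eq_fintype_card] at hd h3
  have h2 : 1 < Fintype.card F := Fintype.one_lt_card
  have hM : 0 < Module.finrank ℂ M := by omega
  have : FiniteDimensional ℂ M := FiniteDimensional.of_finrank_pos hM
  have hsum := two_mul_finrank_eq (ρ := ρ) hψ hε
  have hpos : Module.finrank ℂ (weightSpace ρ ψ (2⁻¹ * (1 : Fˣ))) ≠ 0 ∨
      Module.finrank ℂ (weightSpace ρ ψ (2⁻¹ * ε)) ≠ 0 := by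
    by_contra! h
    rw [h.1, h.2] at hsum
    obtain ⟨e⟩ := nonempty_equiv_of_trivial hρ
      (apply_eq_of_weightSpace_eq (ψ := ψ) (by omega))
    have := e.finrank_eq
    rw [Module.finrank_self] at this
    have hF : Fintype.card F ≠ 1 := h2.ne'
    omega
  have key : ∀ a : Fˣ, Module.finrank ℂ (weightSpace ρ ψ (2⁻¹ * a)) ≠ 0 →
      Occurs ρ ((stdSpace a 1).oscG hψ) := by
    intro a ha
    refine occurs_of_invariant hρ fun h0 => ?_
    have hb := finrank_bound _ h0
    have hn := sum_finrank_le_finrank_fixedUpper (ρ := ρ) hψ (stdSpace a 1)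
    have hB : 1 ≤ Module.finrank ℂ
        (fixedBorel (Representation.linHom ρ ((stdSpace a 1).oscG hψ))) := by
      rw [Nat.one_le_iff_ne_zero, Ne, Submodule.finrank_eq_zero]
      obtain ⟨l, hl, hl0⟩ := Submodule.exists_mem_ne_zero_of_ne_bot
        fun h => ha (Submodule.finrank_eq_zero.2 h)
      refine fixedBorel_ne_bot hψ (stdSpace a 1) (v := fun _ => 1)
        (fun h => one_ne_zero (congrFun h 0)) (l := l) ?_ hl0
      rw [stdSpace_one]
      simpa using hl
    rw [sum_finrank_stdSpace_one] at hn
    rw [Module.finrank_linearMap, Module.finrank_pi, Fintype.card_fun, Fintype.card_fin,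
      pow_one] at hb
    exact not_le_of_dims h2 h3 hd hsum hpos ha hn hB hb
  exact hpos.imp (key 1) (key ε)

end Half

/-! ### Changing the model of the oscillator representation -/

section Models

variable {F : Type u} [Field F] [Finite F] [NeZero (2 : F)] {U : Type v} [AddCommGroup U]
  [Module F U] [Finite U]

/-- A representation with compatible Heisenberg operators, on which the unipotent matrices act by
the right characters, is the oscillator representation. -/
lemma nonempty_equiv_oscG (Q : QuadSpace F U) {ψ : AddChar F ℂ} (hψ : ψ ≠ 1) {N : Type*}
    [AddCommGroup N] [Module ℂ N] (κ : Representation ℂ (SpecialLinearGroup (Fin 2) F) N)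
    (C : N ≃ₗ[ℂ] (U → ℂ)) (H : U → U → Module.End ℂ N)
    (hH : ∀ x y n, C (H x y n) = Q.heisOp ψ x y (C n))
    (hκ : ∀ g x y n, κ g (H x y n) =
      H (g.1 0 0 • x + g.1 0 1 • y) (g.1 1 0 • x + g.1 1 1 • y) (κ g n))
    (hu : ∀ t n u, C (κ (upper t) n) u = ψ (2⁻¹ * (t * Q.form u u)) * C n u) :
    Nonempty (κ.Equiv (Q.oscG hψ)) := by
  let R : Representation ℂ (SpecialLinearGroup (Fin 2) F) (U → ℂ) :=
    { toFun := fun g => C.toLinearMap ∘ₗ κ g ∘ₗ C.symm.toLinearMap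
      map_one' := LinearMap.ext fun f => by simp
      map_mul' := fun g h => LinearMap.ext fun f => by simp }
  have hR : ∀ g n, R g (C n) = C (κ g n) := fun g n => by simp [R]
  have : R = Q.oscG hψ := by
    refine eq_oscG hψ R (fun g x y => LinearMap.ext fun f => ?_) fun t f u => ?_
    · obtain ⟨n, rfl⟩ := C.surjective f
      rw [Module.End.mul_apply, Module.End.mul_apply, ← hH, hR, hκ, hH, hR]
    · obtain ⟨n, rfl⟩ := C.surjective f
      rw [hR, hu]
  exact ⟨.mk C fun g => LinearMap.ext fun n => by rw [← this]; exact (hR g n).symm⟩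

/-- Oscillator representations of similar quadratic spaces. -/
lemma nonempty_equiv_oscG_of_linearEquiv {U' : Type w} [AddCommGroup U'] [Module F U'] [Finite U']
    {Q : QuadSpace F U} {Q' : QuadSpace F U'} {ψ ψ' : AddChar F ℂ} (hψ : ψ ≠ 1) (hψ' : ψ' ≠ 1)
    (L : U ≃ₗ[F] U') (h : ∀ x y, ψ' (Q'.form (L x) (L y)) = ψ (Q.form x y)) :
    Nonempty ((Q'.oscG hψ').Equiv (Q.oscG hψ)) := by
  refine nonempty_equiv_oscG Q hψ _ (LinearEquiv.funCongrLeft ℂ ℂ L.toEquiv)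
    (fun x y => Q'.heisOp ψ' (L x) (L y)) (fun x y n => funext fun u => ?_) (fun g x y n => ?_)
    fun t n u => ?_
  · rw [heisOp_apply]
    change Q'.heisOp ψ' (L x) (L y) n (L u) = _ * n (L (u + y))
    rw [heisOp_apply, map_add]
    congr 1
    -- One instance of the similarity hypothesis covers both terms of the Heisenberg phase, -β(x, u)
    -- - ½ β(x, y).
    have h1 := h x (-u - (2⁻¹ : F) • y)
    simp only [map_sub, map_neg, map_smul, smul_eq_mul] at h1
    exact h1
  · have := LinearMap.congr_fun (oscG_heisOp (Q := Q') hψ' g (L x) (L y)) n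
    rw [Module.End.mul_apply, Module.End.mul_apply] at this
    rw [this]
    simp only [map_add, map_smul]
  · change Q'.oscG hψ' (upper t) n (L u) = _ * n (L u)
    rw [oscG_upper]
    congr 1
    have h1 := h u (((2⁻¹ : F) * t) • u)
    simp only [map_smul, smul_eq_mul, mul_assoc] at h1
    exact h1

/-- The orthogonal sum. -/
def QuadSpace.prod {F : Type u} [Field F] {U : Type v} [AddCommGroup U] [Module F U] {U' : Type w}
    [AddCommGroup U'] [Module F U'] (Q : QuadSpace F U) (Q' : QuadSpace F U') :
    QuadSpace F (U × U') where
  form := Q.form.compl₁₂ (LinearMap.fst F U U') (LinearMap.fst F U U') +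
    Q'.form.compl₁₂ (LinearMap.snd F U U') (LinearMap.snd F U U')
  symm x y := by simp [Q.symm x.1, Q'.symm x.2]
  nondeg x hx := Prod.ext (Q.nondeg _ fun y => by simpa using hx (y, 0))
    (Q'.nondeg _ fun y => by simpa using hx (0, y))

lemma prod_form {F : Type u} [Field F] {U : Type v} [AddCommGroup U] [Module F U] {U' : Type w}
    [AddCommGroup U'] [Module F U'] (Q : QuadSpace F U) (Q' : QuadSpace F U') (x y : U × U') :
    (Q.prod Q').form x y = Q.form x.1 y.1 + Q'.form x.2 y.2 := rfl

/-- Functions on a product as a tensor product. -/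
def tensorFun (U : Type v) (U' : Type w) [Finite U] [Finite U'] :
    (U → ℂ) ⊗[ℂ] (U' → ℂ) ≃ₗ[ℂ] (U × U' → ℂ) :=
  ((Pi.basisFun ℂ U).tensorProduct (Pi.basisFun ℂ U')).equivFun

lemma tensorFun_tmul {U : Type v} {U' : Type w} [Finite U] [Finite U'] (f : U → ℂ) (f' : U' → ℂ)
    (p : U × U') : tensorFun U U' (f ⊗ₜ f') p = f p.1 * f' p.2 := by
  obtain ⟨i, j⟩ := p
  rw [tensorFun, Module.Basis.equivFun_apply, Module.Basis.tensorProduct_repr_tmul_apply]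
  simp [mul_comm]

/-- Heisenberg operators and unipotent characters are multiplicative over orthogonal sums, and these
data determine the oscillator representation. -/
lemma nonempty_tprod_equiv_oscG_prod {U' : Type w} [AddCommGroup U'] [Module F U'] [Finite U']
    (Q : QuadSpace F U) (Q' : QuadSpace F U') {ψ : AddChar F ℂ} (hψ : ψ ≠ 1) :
    Nonempty (((Q.oscG hψ).tprod (Q'.oscG hψ)).Equiv ((Q.prod Q').oscG hψ)) := by
  refine nonempty_equiv_oscG _ hψ _ (tensorFun U U')
    (fun x y => TensorProduct.map (Q.heisOp ψ x.1 y.1) (Q'.heisOp ψ x.2 y.2))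
    (fun x y n => ?_) (fun g x y n => ?_) fun t n p => ?_
  · induction n using TensorProduct.induction_on with
    | zero => simp
    | add n n' h h' => rw [map_add, map_add, map_add, map_add, h, h']
    | tmul f f' =>
      refine funext fun p => ?_
      rw [TensorProduct.map_tmul, tensorFun_tmul, heisOp_apply, heisOp_apply, heisOp_apply,
        tensorFun_tmul, mul_mul_mul_comm, ← AddChar.map_add_eq_mul]
      congr 2
      rw [prod_form, prod_form]
      ring
  · induction n using TensorProduct.induction_on with
    | zero => simp
    | add n n' h h' => rw [map_add, map_add, map_add, map_add, h, h']
    | tmul f f' =>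
      have h1 := LinearMap.congr_fun (oscG_heisOp (Q := Q) hψ g x.1 y.1) f
      have h2 := LinearMap.congr_fun (oscG_heisOp (Q := Q') hψ g x.2 y.2) f'
      rw [Module.End.mul_apply, Module.End.mul_apply] at h1 h2
      rw [TensorProduct.map_tmul, Representation.tprod_apply, TensorProduct.map_tmul, h1, h2,
        TensorProduct.map_tmul, TensorProduct.map_tmul]
      rfl
  · induction n using TensorProduct.induction_on with
    | zero => simp
    | add n n' h h' =>
      rw [map_add, map_add, map_add, Pi.add_apply, Pi.add_apply, h, h', mul_add]
    | tmul f f' =>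
      rw [Representation.tprod_apply, TensorProduct.map_tmul, tensorFun_tmul, tensorFun_tmul,
        oscG_upper, oscG_upper, mul_mul_mul_comm, ← AddChar.map_add_eq_mul, prod_form, mul_add,
        mul_add]

end Models

/-! ### Every irrep of rank at most two occurs -/

section Occurrence

variable {F : Type u} [Field F] [Finite F] [NeZero (2 : F)] {ψ : AddChar F ℂ} (hψ : ψ ≠ 1)

lemma exists_mul_sq_add_mul_sq (a b : Fˣ) : ∃ x y : F, a * x ^ 2 + b * y ^ 2 = 1 := by
  have := Fintype.ofFinite F
  have h1 : (Polynomial.C (a : F) * Polynomial.X ^ 2 - 1).degree = 2 := by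
    compute_degree!
  have h2 : (Polynomial.C (b : F) * Polynomial.X ^ 2).degree = 2 := by
    compute_degree!
  obtain ⟨x, y, h⟩ := FiniteField.exists_root_sum_quadratic h1 h2
    (FiniteField.odd_card_of_char_ne_two (ringChar_ne_two F))
  refine ⟨x, y, ?_⟩
  simp at h
  linear_combination h

/-- The classification of the binary forms. -/
lemma exists_linearEquiv_stdSpace_two {ε : Fˣ} (hε : ¬ IsSquare ε) (a b : Fˣ) :
    ∃ δ : Fˣ, (δ = 1 ∨ δ = ε) ∧ ∃ L : (Fin 2 → F) ≃ₗ[F] (Fin 1 → F) × (Fin 1 → F), ∀ x y,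
      ((stdSpace a 1).prod (stdSpace b 1)).form (L x) (L y) = (stdSpace δ 2).form x y := by
  -- The basis consists of (x₀, y₀), on which the form is 1, and the orthogonal vector s⁻¹(-b y₀, a
  -- x₀), on which it is a b s⁻² = -δ.
  obtain ⟨x₀, y₀, h₀⟩ := exists_mul_sq_add_mul_sq a b
  obtain ⟨δ, hδ, s, hs⟩ : ∃ δ : Fˣ, (δ = 1 ∨ δ = ε) ∧ ∃ s : Fˣ, -(a * b) = δ * (s * s) := by
    obtain ⟨s, hs | hs⟩ := eq_sq_or_eq_mul_sq hε (-(a * b))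
    · exact ⟨1, Or.inl rfl, s, by rw [hs, one_mul]⟩
    · exact ⟨ε, Or.inr rfl, s, hs⟩
  have hs' : -((a : F) * b) = δ * (s * s) := by exact_mod_cast congrArg Units.val hs
  let L : (Fin 2 → F) →ₗ[F] (Fin 1 → F) × (Fin 1 → F) :=
    { toFun := fun x => (fun _ => x₀ * x 0 - (s : F)⁻¹ * b * y₀ * x 1,
        fun _ => y₀ * x 0 + (s : F)⁻¹ * a * x₀ * x 1)
      map_add' := fun x y => by
        ext <;> simp <;> ring
      map_smul' := fun c x => by
        ext <;> simp <;> ring }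
  have hL : ∀ x y, ((stdSpace a 1).prod (stdSpace b 1)).form (L x) (L y) =
      (stdSpace δ 2).form x y := fun x y => by
    rw [prod_form, stdSpace_one, stdSpace_one, stdSpace_two]
    simp only [L, LinearMap.coe_mk, AddHom.coe_mk]
    have h1 : (a : F) * b * ((s : F)⁻¹ * (s : F)⁻¹) = -δ := by
      rw [← neg_neg ((a : F) * b), hs']
      field_simp
    linear_combination (x 0 * y 0 + (a : F) * b * ((s : F)⁻¹ * (s : F)⁻¹) * (x 1 * y 1)) * h₀ +
      x 1 * y 1 * h1
  have hinj : Function.Injective L := (injective_iff_map_eq_zero L).2 fun x hx =>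
    (stdSpace δ 2).nondeg x fun y => by rw [← hL, hx]; simp
  exact ⟨δ, hδ, L.linearEquivOfInjective hinj (by simp), hL⟩

/-- The shifts of ψ are distinct, and there are as many of them as additive characters. -/
lemma exists_eq_mulShift {F : Type u} [Field F] [Finite F] {ψ ψ' : AddChar F ℂ}
    (hψ : ψ ≠ 1) (hψ' : ψ' ≠ 1) : ∃ c : Fˣ, ∀ t, ψ' t = ψ (c * t) := by
  classical
  have := Fintype.ofFinite F
  have hinj : Function.Injective (AddChar.mulShift ψ) :=
    AddChar.to_mulShift_inj_of_isPrimitive (AddChar.IsPrimitive.of_ne_one hψ)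
  obtain ⟨c, hc⟩ := ((Fintype.bijective_iff_injective_and_card _).2
    ⟨hinj, AddChar.card_eq.symm⟩).2 ψ'
  have h0 : c ≠ 0 := by
    rintro rfl
    exact hψ' (by rw [← hc, AddChar.mulShift_zero])
  exact ⟨Units.mk0 c h0, fun t => by rw [← hc]; rfl⟩

/-- For q = 3 the definition supplies an oscillator representation, perhaps for another character
ψ(c ·). Passing back to ψ multiplies the form by c, which matters only modulo squares. -/
lemma IsHalf.occurs {M : Type*} [AddCommGroup M] [Module ℂ M]
    {ρ : Representation ℂ (SpecialLinearGroup (Fin 2) F) M} (h : IsHalf ρ) {ε : Fˣ}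
    (hε : ¬ IsSquare ε) :
    Occurs ρ ((stdSpace 1 1).oscG hψ) ∨ Occurs ρ ((stdSpace ε 1).oscG hψ) := by
  by_cases h3 : Nat.card F = 3
  · obtain ⟨ψ', hψ', ho⟩ := h.2.2 h3
    obtain ⟨c, hc⟩ := exists_eq_mulShift hψ hψ'
    have key : ∀ a s : Fˣ, c = a * (s * s) → Occurs ρ ((stdSpace a 1).oscG hψ) := by
      intro a s hs
      obtain ⟨e⟩ := nonempty_equiv_oscG_of_linearEquiv (Q := stdSpace a 1) (Q' := stdSpace 1 1)
        hψ hψ' (LinearEquiv.smulOfUnit s⁻¹) fun x y => by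
          rw [hc, hs, stdSpace_one, stdSpace_one]
          congr 1
          change ((a * (s * s) : Fˣ) : F) * ((1 : Fˣ) * (((s⁻¹ : Fˣ) : F) * x 0 *
            (((s⁻¹ : Fˣ) : F) * y 0))) = _
          push_cast
          field_simp
      exact ho.trans (occurs_of_equiv e)
    obtain ⟨s, hs | hs⟩ := eq_sq_or_eq_mul_sq hε c
    · exact Or.inl (key 1 s (by rw [hs, one_mul]))
    · exact Or.inr (key ε s hs)
  · exact occurs_of_finrank hψ hε h.1 h.2.1 h3

lemma Occurs.tprod {G : Type*} [Group G] {M M' N N' : Type*} [AddCommGroup M] [Module ℂ M]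
    [AddCommGroup M'] [Module ℂ M'] [AddCommGroup N] [Module ℂ N] [AddCommGroup N'] [Module ℂ N']
    {ρ : Representation ℂ G M} {ρ' : Representation ℂ G M'} {σ : Representation ℂ G N}
    {σ' : Representation ℂ G N'} (h : Occurs ρ σ) (h' : Occurs ρ' σ') :
    Occurs (ρ.tprod ρ') (σ.tprod σ') := by
  obtain ⟨f, hf⟩ := h
  obtain ⟨f', hf'⟩ := h'
  refine ⟨⟨TensorProduct.map f.toLinearMap f'.toLinearMap, fun g => ?_⟩, ?_⟩
  · refine TensorProduct.ext' fun m m' => ?_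
    simp [map_rep]
  · obtain ⟨r, hr⟩ := f.toLinearMap.exists_leftInverse_of_injective (LinearMap.ker_eq_bot.2 hf)
    obtain ⟨r', hr'⟩ := f'.toLinearMap.exists_leftInverse_of_injective (LinearMap.ker_eq_bot.2 hf')
    refine Function.LeftInverse.injective (g := TensorProduct.map r r') fun x => ?_
    have : TensorProduct.map r r' ∘ₗ TensorProduct.map f.toLinearMap f'.toLinearMap =
        LinearMap.id := by
      rw [← TensorProduct.map_comp, hr, hr', TensorProduct.map_id]
    exact LinearMap.congr_fun this x

lemma occurs_tprod_trivial {G : Type*} [Group G] {M : Type*} [AddCommGroup M] [Module ℂ M]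
    (ρ : Representation ℂ G M) : Occurs (ρ.tprod (Representation.trivial ℂ G ℂ)) ρ :=
  ⟨⟨(TensorProduct.rid ℂ M).toLinearMap, fun g => TensorProduct.ext' fun m z => by simp⟩,
    (TensorProduct.rid ℂ M).injective⟩

lemma occurs_trivial_oscG (Q : QuadSpace F (Fin 0 → F)) :
    Occurs (Representation.trivial ℂ (SpecialLinearGroup (Fin 2) F) ℂ) (Q.oscG hψ) := by
  obtain ⟨e⟩ := nonempty_equiv_oscG Q hψ
    (Representation.trivial ℂ (SpecialLinearGroup (Fin 2) F) ℂ)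
    (LinearEquiv.funUnique (Fin 0 → F) ℂ ℂ).symm (fun _ _ => 1)
    (fun x y n => funext fun u => by
      rw [heisOp_apply, Subsingleton.elim x 0, map_zero, LinearMap.zero_apply,
        LinearMap.zero_apply]
      simp)
    (fun g x y n => by simp) (fun t n u => by
      rw [Subsingleton.elim u 0, map_zero]
      simp)
  exact occurs_of_equiv e

/-- A product of two small irreps embeds in the oscillator representation of some a x² + b y², which
is equivalent to one of the two standard binary forms. -/
theorem IsHalfProduct.occurs {k : ℕ} (hk : k ≤ 2) {N : Type} [AddCommGroup N] [Module ℂ N]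
    {σ : Representation ℂ (SpecialLinearGroup (Fin 2) F) N} (h : IsHalfProduct F k N σ) {ε : Fˣ}
    (hε : ¬ IsSquare ε) :
    Occurs σ ((stdSpace 1 k).oscG hψ) ∨ Occurs σ ((stdSpace ε k).oscG hψ) := by
  cases h with
  | zero => exact Or.inl (occurs_trivial_oscG hψ _)
  | succ l M₁ ρ₁ N₁ σ₁ hρ₁ hσ₁ =>
    cases hσ₁ with
    | zero =>
      exact (hρ₁.occurs hψ hε).imp (occurs_tprod_trivial ρ₁).trans (occurs_tprod_trivial ρ₁).trans
    | succ l M₂ ρ₂ N₂ σ₂ hρ₂ hσ₂ =>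
      cases hσ₂ with
      | zero =>
        have key : ∀ a b : Fˣ, Occurs ρ₁ ((stdSpace a 1).oscG hψ) →
            Occurs ρ₂ ((stdSpace b 1).oscG hψ) →
            Occurs (ρ₁.tprod (ρ₂.tprod (Representation.trivial ℂ _ ℂ)))
              ((stdSpace 1 2).oscG hψ) ∨
            Occurs (ρ₁.tprod (ρ₂.tprod (Representation.trivial ℂ _ ℂ)))
              ((stdSpace ε 2).oscG hψ) := by
          intro a b h1 h2
          obtain ⟨δ, hδ, L, hL⟩ := exists_linearEquiv_stdSpace_two hε a b
          obtain ⟨e⟩ := nonempty_tprod_equiv_oscG_prod (stdSpace a 1) (stdSpace b 1) hψ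
          obtain ⟨e'⟩ := nonempty_equiv_oscG_of_linearEquiv hψ hψ L fun x y => by rw [hL]
          have := ((h1.tprod ((occurs_tprod_trivial ρ₂).trans h2)).trans
            (occurs_of_equiv e)).trans (occurs_of_equiv e')
          rcases hδ with rfl | rfl
          · exact Or.inl this
          · exact Or.inr this
        rcases hρ₁.occurs hψ hε with h1 | h1 <;> rcases hρ₂.occurs hψ hε with h2 | h2 <;>
          exact key _ _ h1 h2
      | succ l M₃ ρ₃ N₃ σ₃ hρ₃ hσ₃ => omega

theorem IsIrrepOfRank.occurs {k : ℕ} (hk : k ≤ 2) {M : Type*} [AddCommGroup M] [Module ℂ M]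
    {ρ : Representation ℂ (SpecialLinearGroup (Fin 2) F) M} (h : IsIrrepOfRank k ρ) {ε : Fˣ}
    (hε : ¬ IsSquare ε) :
    Occurs ρ ((stdSpace 1 k).oscG hψ) ∨ Occurs ρ ((stdSpace ε k).oscG hψ) := by
  obtain ⟨-, ⟨l, hl, N, i1, i2, σ, hσ, ho⟩, hlt⟩ := h
  -- Rank exactly k excludes products of fewer factors.
  obtain rfl : l = k := by
    by_contra hne
    exact hlt l (by omega) ⟨l, le_rfl, N, i1, i2, σ, hσ, ho⟩
  exact (hσ.occurs hψ hk hε).imp ho.trans ho.trans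

end Occurrence

end EtaCorrespondence

end

theorem theorem4 {F : Type*} [Field F] [Finite F] [NeZero (2 : F)]
    {ψ : AddChar F ℂ} (hψ : ψ ≠ 1) (k : ℕ) (hk : k ≤ 2) :
    (∀ Q : QuadSpace F (Fin k → F),
      Subalgebra.centralizer ℂ (Q.algO hψ k : Set (Module.End ℂ (Q.spec hψ k))) = Q.algG hψ k ∧
      Subalgebra.centralizer ℂ (Q.algG hψ k : Set (Module.End ℂ (Q.spec hψ k))) = Q.algO hψ k ∧
      (∀ (T : Type) [AddCommGroup T] [Module ℂ T] (τ : Representation ℂ Q.O T),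
        τ.IsIrreducible → Occurs τ (Q.specO hψ k) →
          IsIrrepOfRank (M := Q.etaSpace hψ k τ) k (Q.eta hψ k τ)) ∧
      (∀ (T T' : Type) [AddCommGroup T] [Module ℂ T] [AddCommGroup T'] [Module ℂ T']
        (τ : Representation ℂ Q.O T) (τ' : Representation ℂ Q.O T'),
        τ.IsIrreducible → τ'.IsIrreducible →
        Occurs τ (Q.specO hψ k) → Occurs τ' (Q.specO hψ k) →
        (Nonempty ((Q.eta hψ k τ).Equiv (Q.eta hψ k τ')) ↔ Nonempty (τ.Equiv τ')))) ∧
    (∀ ε : Fˣ, ¬ IsSquare ε →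
      ∀ (M : Type) [AddCommGroup M] [Module ℂ M]
        (ρ : Representation ℂ (Matrix.SpecialLinearGroup (Fin 2) F) M),
        ((stdSpace 1 k).InEtaImage hψ k ρ ∨ (stdSpace ε k).InEtaImage hψ k ρ) ↔
          IsIrrepOfRank k ρ) := by
  have hC : ∀ Q : QuadSpace F (Fin k → F), HasSpecCommutant Q hψ k :=
    fun Q A hA => exists_span_oscO_of_commute hψ hk Q hA
  refine ⟨fun Q => ⟨centralizer_algO hψ (hC Q), centralizer_algG hψ (hC Q),
    fun T _ _ τ hτ ho => eta_isIrrepOfRank hψ (hC Q) hτ ho,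
    fun T T' _ _ _ _ τ τ' hτ hτ' ho _ =>
      ⟨fun ⟨e⟩ => nonempty_equiv_of_eta_equiv hψ (hC Q) hτ hτ' ho e,
        fun ⟨e⟩ => ⟨etaCongr hψ e⟩⟩⟩, fun ε hε M _ _ ρ => ⟨?_, fun h => ?_⟩⟩
  · rintro (h | h)
    · exact isIrrepOfRank_of_inEtaImage hψ (hC _) h
    · exact isIrrepOfRank_of_inEtaImage hψ (hC _) h
  · exact (h.occurs hψ hk hε).imp (inEtaImage_of_occurs hψ (hC _) h)
      (inEtaImage_of_occurs hψ (hC _) h)
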